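/- Let $k$ be a (commutative) field and $\mathcal{A}$ an essentially small additive category which is $k$-trivial: for all objects $x,y$, the group $\mathcal{A}(x,y)$ is finite and its order is invertible in $k$. \textbf{Notation.} Let $\mathbf{Rep}(\mathcal{A})$ be the category of additive functors $\mathcal{A}\to\mathbf{Ab}$ and $\mathcal{F}(\mathcal{A};k)$ the category of all functors from $\mathcal{A}$ to $k$-vector spaces. An object of $\mathbf{Rep}(\mathcal{A})$ is \emph{finite} if it is noetherian and artinian; its \emph{length} is then the length of a filtration with simple subquotients. It is \emph{finitely generated} if every (non-empty) upward directed family of subobjects whose supremum is the whole object contains the whole object, and \emph{finitely cogenerated} if every (non-empty) downward directed family of subobjects with intersection $0$ contains $0$. For $n\in\mathbb{N}$, let $\mathcal{L}_n$ be a complete system of representatives of the isomorphism classes of finite objects of length $n$ of $\mathbf{Rep}(\mathcal{A})$. For a ring $R$ (resp. an abelian category $\mathcal{E}$), $\operatorname{Irr}(R)$ (resp. $\operatorname{Irr}(\mathcal{E})$) is the set of isomorphism classes of simple left $R$-modules (resp. of simple objects of $\mathcal{E}$). For $A$ in $\mathbf{Rep}(\mathcal{A})$, let $k[A]$ be the composite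 of $A$ with the $k$-linearization of sets, and put $$Q_A=\operatorname{Coker}\Big(\bigoplus_{B\subsetneq A}k[B]\to k[A]\Big),\qquad Q^A=\operatorname{Ker}\Big(k[A]\to\prod_{0\neq B\subset A}k[A/B]\Big),$$ both with their natural action of $\operatorname{Aut}(A)$. For a $k[\operatorname{Aut}(A)]$-module $M$, let $Q(A,M)$ be the image of the morphism $$M\underset{k[\operatorname{Aut}(A)]}{\otimes}Q^A\to M\underset{k[\operatorname{Aut}(A)]}{\otimes}Q_A$$ induced by $Q^A\hookrightarrow k[A]\twoheadrightarrow Q_A$, where $M\otimes_{k[G]}X$ means the coinvariants $(M\otimes_k X)_G$ for the diagonal action. For an object $x$ of $\mathcal{A}$ and $F$ in $\mathcal{F}(\mathcal{A};k)$, let $\tau_x(F)=F(x\oplus -)$, let $\bar\tau_x(F)(a)=F(x\oplus a)_{\mathcal{A}(x,a)}$ (coinvariants, $u\in\mathcal{A}(x,a)$ acting through the automorphism $\begin{pmatrix}1&0\\u&1\end{pmatrix}$ of $x\oplus a$), and let $\bar\delta_x(F)$ be the cokernel of the morphism $F\to\bar\tau_x(F)$ induced by the inclusions $a\to x\oplus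 a$. For $d\in\mathbb{N}$, $\mathcal{F}_d(\mathcal{A};k)$ is the full subcategory of $\mathcal{F}(\mathcal{A};k)$ of those $F$ with $\bar\delta_{a_0}\cdots\bar\delta_{a_d}\tau_x(F)=0$ for all objects $a_0,\dots,a_d,x$ of $\mathcal{A}$. \textbf{Theorem.} \begin{enumerate} \item If $A$ is a finite object of $\mathbf{Rep}(\mathcal{A})$ and $M$ a simple $k[\operatorname{Aut}(A)]$-module, then $Q(A,M)$ is a simple object of $\mathcal{F}(\mathcal{A};k)$. \item For every $d\in\mathbb{N}$, the assignment $(n,A,[M])\mapsto[Q(A,M)]$ is a well-defined bijection $$\bigsqcup_{n\le d,\ A\in\mathcal{L}_n}\operatorname{Irr}(k[\operatorname{Aut}(A)])\xrightarrow{\ \simeq\ }\operatorname{Irr}(\mathcal{F}_d(\mathcal{A};k)).$$ \item If every object of $\mathbf{Rep}(\mathcal{A})$ which is both finitely generated and finitely cogenerated is finite, then $(n,A,[M])\mapsto[Q(A,M)]$ is a well-defined bijection $$\bigsqcup_{n\in\mathbb{N},\ A\in\mathcal{L}_n}\operatorname{Irr}(k[\operatorname{Aut}(A)])\xrightarrow{\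 \simeq\ }\operatorname{Irr}(\mathcal{F}(\mathcal{A};k)).$$ This hypothesis holds in particular if $\mathbf{Rep}(\mathcal{A})$ is locally finite, i.e. generated by its finite objects. \end{enumerate} -/

import Mathlib

open CategoryTheory CategoryTheory.Limits

universe u v w

namespace AntiPoly

noncomputable section

/-! ### Simple objects -/

/-- Isomorphism of simple objects, as an equivalence relation. -/
def simpleSetoid (E : Type u) [Category.{w} E] [HasZeroMorphisms E] :
    Setoid {X : E // Simple X} where
  r X Y := Nonempty (X.1 ≅ Y.1)
  iseqv :=
    { refl := fun X => ⟨Iso.refl X.1⟩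
      symm := fun ⟨e⟩ => ⟨e.symm⟩
      trans := fun ⟨e⟩ ⟨e'⟩ => ⟨e.trans e'⟩ }

/-- `Irr E`: the isomorphism classes of simple objects of `E`. -/
def Irr (E : Type u) [Category.{w} E] [HasZeroMorphisms E] : Type u :=
  Quotient (simpleSetoid E)

/-- The class `[X]` of a simple object `X`. -/
def Irr.mk {E : Type u} [Category.{w} E] [HasZeroMorphisms E] (X : E) (hX : Simple X) : Irr E :=
  Quotient.mk (simpleSetoid E) ⟨X, hX⟩

/-! ### Additive representations of an additive category -/

/-- `C` is `k`-trivial: every Hom group is finite, of order invertible in `k`. -/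
def IsKTrivial (k : Type v) [Field k] (C : Type u) [Category.{v} C] : Prop :=
  ∀ x y : C, Finite (x ⟶ y) ∧ (Nat.card (x ⟶ y) : k) ≠ 0

/-- The category of additive functors from `C` to abelian groups. -/
abbrev AddRep (C : Type u) [Category.{v} C] [Preadditive C] := C ⥤+ AddCommGrpCat.{v}

section AddRep

variable {C : Type u} [Category.{v} C] [Preadditive C]

/-- A subfunctor of an additive functor. -/
@[ext]
structure SubRep (A : AddRep C) where
  /-- the subgroup at each object -/
  obj : ∀ a : C, AddSubgroup (A.obj.obj a)
  map_mem : ∀ {a b : C} (f : a ⟶ b) (ξ : A.obj.obj a), ξ ∈ obj a → A.obj.map f ξ ∈ obj b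

instance (A : AddRep C) : PartialOrder (SubRep A) :=
  PartialOrder.lift SubRep.obj fun _ _ h => SubRep.ext h

instance (A : AddRep C) : BoundedOrder (SubRep A) where
  top := { obj := fun _ => ⊤, map_mem := fun _ _ _ => AddSubgroup.mem_top _ }
  le_top _ := fun _ => le_top
  bot :=
    { obj := fun _ => ⊥
      map_mem := fun f ξ h => by
        rw [AddSubgroup.mem_bot] at h ⊢
        rw [h, map_zero] }
  bot_le _ := fun _ => bot_le

/-- Finite objects: both noetherian and artinian. -/
def IsFiniteRep : ObjectProperty (AddRep C) :=
  fun A => WellFoundedGT (SubRep A) ∧ WellFoundedLT (SubRep A)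

/-- `A` has a finite filtration `0 = A₀ ⋖ A₁ ⋖ ⋯ ⋖ Aₙ = A`, where each term is maximal among the
proper subfunctors of the next one, i.e. the subquotients are simple. -/
def HasLength (A : AddRep C) (n : ℕ) : Prop :=
  ∃ s : RelSeries {(B, B') : SubRep A × SubRep A | B ⋖ B'},
    s.head = ⊥ ∧ s.last = ⊤ ∧ s.length = n

/-- Finitely generated objects: a directed family of subfunctors with supremum `A` contains `A`. -/
def IsFinGen (A : AddRep C) : Prop :=
  ∀ S : Set (SubRep A), S.Nonempty → DirectedOn (· ≤ ·) S → IsLUB S ⊤ → ⊤ ∈ S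

/-- Finitely cogenerated objects: a codirected family of subfunctors with infimum `0`
contains `0`. -/
def IsFinCogen (A : AddRep C) : Prop :=
  ∀ S : Set (SubRep A), S.Nonempty → DirectedOn (· ≥ ·) S → IsGLB S ⊥ → ⊥ ∈ S

/-- `L n` is a complete system of representatives of the isomorphism classes of finite
objects of length `n`, for every `n`. -/
def IsSystemOfReps (L : ℕ → Set (AddRep C)) : Prop :=
  ∀ n : ℕ, (∀ A ∈ L n, IsFiniteRep A ∧ HasLength A n) ∧
    ∀ A : AddRep C, IsFiniteRep A → HasLength A n → ∃! B, B ∈ L n ∧ Nonempty (A ≅ B)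

end AddRep

/-! ### The functors `Q_A`, `Q^A` and `Q(A, M)` -/

section Q

variable (k : Type v) [Field k] {C : Type u} [Category.{v} C] [Preadditive C]

/-- `k[A(a)]`, with the action of `Aut A`. -/
def linRho (A : AddRep C) (a : C) : Representation k (Aut A) (A.obj.obj a →₀ k) where
  toFun g := Finsupp.lmapDomain k k (g.hom.hom.app a)
  map_one' := by
    ext x : 2
    simp
    rfl
  map_mul' g h := by
    ext x : 2
    simp
    rfl

/-- The linearization `k[A]`, as a functor to `k`-linear representations of `Aut A`. -/
def lin (A : AddRep C) : C ⥤ Rep.{v} k (Aut A) where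
  obj a := Rep.of (linRho k A a)
  map {a b} f := Rep.ofHom
    ⟨Finsupp.lmapDomain k k (A.obj.map f), fun g => by
      ext x : 2
      have := ConcreteCategory.congr_hom (g.hom.hom.naturality f) x
      simp only [ConcreteCategory.comp_apply] at this
      simp [linRho, this]⟩
  map_id a := by
    ext x : 4
    simp
  map_comp f g := by
    ext x : 4
    simp

/-- The value at `a` of the image of `⨁_{B ⊊ A} k[B] ⟶ k[A]`. -/
def lowerKer (A : AddRep C) (a : C) : Submodule k (A.obj.obj a →₀ k) :=
  ⨆ (B : SubRep A) (_ : B ≠ ⊤),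
    LinearMap.range (Finsupp.lmapDomain k k (Subtype.val : B.obj a → A.obj.obj a))

/-- The value at `a` of the kernel of `k[A] ⟶ ∏_{0 ≠ B ⊆ A} k[A/B]`. -/
def upperKer (A : AddRep C) (a : C) : Submodule k (A.obj.obj a →₀ k) :=
  ⨅ (B : SubRep A) (_ : B ≠ ⊥),
    LinearMap.ker (Finsupp.lmapDomain k k
      (QuotientAddGroup.mk : A.obj.obj a → A.obj.obj a ⧸ B.obj a))

/-- Inverse image of a subfunctor. -/
def SubRep.comap {A A' : AddRep C} (φ : A ⟶ A') (B : SubRep A') : SubRep A where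
  obj a := (B.obj a).comap (φ.hom.app a).hom
  map_mem {a b} f ξ h := by
    have := ConcreteCategory.congr_hom (φ.hom.naturality f) ξ
    simp only [ConcreteCategory.comp_apply] at this
    have h2 := B.map_mem f _ h
    rw [AddSubgroup.mem_comap]
    exact this ▸ h2

theorem aut_apply_inv (A : AddRep C) (g : Aut A) (a : C) (x : A.obj.obj a) :
    g.hom.hom.app a (g.inv.hom.app a x) = x := by
  have h : (g.inv ≫ g.hom).hom.app a = 𝟙 _ := by rw [g.inv_hom_id]; rfl
  exact ConcreteCategory.congr_hom h x

theorem aut_inv_apply (A : AddRep C) (g : Aut A) (a : C) (x : A.obj.obj a) :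
    g.inv.hom.app a (g.hom.hom.app a x) = x := by
  have h : (g.hom ≫ g.inv).hom.app a = 𝟙 _ := by rw [g.hom_inv_id]; rfl
  exact ConcreteCategory.congr_hom h x

theorem lowerKer_map (A : AddRep C) {a b : C} (f : a ⟶ b) :
    lowerKer k A a ≤ (lowerKer k A b).comap (Finsupp.lmapDomain k k (A.obj.map f)) := by
  refine iSup₂_le fun B hB => ?_
  rintro _ ⟨y, rfl⟩
  refine Submodule.mem_iSup_of_mem B (Submodule.mem_iSup_of_mem hB ?_)
  refine ⟨Finsupp.lmapDomain k k (fun z : B.obj a => (⟨A.obj.map f z.1,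
    B.map_mem f z.1 z.2⟩ : B.obj b)) y, ?_⟩
  simp only [Finsupp.lmapDomain_apply, ← Finsupp.mapDomain_comp]
  rfl

theorem lowerKer_aut (A : AddRep C) (a : C) (g : Aut A) :
    lowerKer k A a ≤ (lowerKer k A a).comap (linRho k A a g) := by
  refine iSup₂_le fun B hB => ?_
  rintro _ ⟨y, rfl⟩
  have hB' : B.comap g.inv ≠ ⊤ := by
    intro h
    apply hB
    ext c x
    have hx : g.hom.hom.app c x ∈ (B.comap g.inv).obj c := by rw [h]; exact AddSubgroup.mem_top _
    have hx' : g.inv.hom.app c (g.hom.hom.app c x) ∈ B.obj c := hx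
    rw [aut_inv_apply] at hx'
    exact ⟨fun _ => AddSubgroup.mem_top _, fun _ => hx'⟩
  refine Submodule.mem_iSup_of_mem (B.comap g.inv) (Submodule.mem_iSup_of_mem hB' ?_)
  refine ⟨Finsupp.lmapDomain k k (fun z : B.obj a => (⟨g.hom.hom.app a z.1, by
    change g.inv.hom.app a (g.hom.hom.app a z.1) ∈ B.obj a
    rw [aut_inv_apply]
    exact z.2⟩ : (B.comap g.inv).obj a)) y, ?_⟩
  change Finsupp.mapDomain _ (Finsupp.mapDomain _ y) = Finsupp.mapDomain _ (Finsupp.mapDomain _ y)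
  simp only [← Finsupp.mapDomain_comp]
  rfl

theorem upperKer_map (A : AddRep C) {a b : C} (f : a ⟶ b) :
    upperKer k A a ≤ (upperKer k A b).comap (Finsupp.lmapDomain k k (A.obj.map f)) := by
  intro y hy
  simp only [upperKer, Submodule.mem_iInf, Submodule.mem_comap, LinearMap.mem_ker] at hy ⊢
  intro B hB
  have h := congrArg (Finsupp.lmapDomain k k (QuotientAddGroup.map (B.obj a) (B.obj b)
    (A.obj.map f).hom (fun ξ hξ => B.map_mem f ξ hξ))) (hy B hB)
  rw [map_zero] at h
  rw [← h]
  simp only [Finsupp.lmapDomain_apply, ← Finsupp.mapDomain_comp]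
  rfl

theorem upperKer_aut (A : AddRep C) (a : C) (g : Aut A) :
    upperKer k A a ≤ (upperKer k A a).comap (linRho k A a g) := by
  intro y hy
  simp only [upperKer, Submodule.mem_iInf, Submodule.mem_comap, LinearMap.mem_ker] at hy ⊢
  intro B hB
  have hB' : B.comap g.hom ≠ ⊥ := by
    intro h
    apply hB
    ext c x
    refine ⟨fun hx => ?_, fun hx => ?_⟩
    · have hx' : g.inv.hom.app c x ∈ (B.comap g.hom).obj c := by
        change g.hom.hom.app c (g.inv.hom.app c x) ∈ B.obj c
        rw [aut_apply_inv]
        exact hx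
      rw [h] at hx'
      have h0 : g.inv.hom.app c x = 0 := hx'
      have h1 := aut_apply_inv A g c x
      rw [h0, map_zero] at h1
      rw [← h1]
      exact zero_mem _
    · have h0 : x = 0 := hx
      rw [h0]
      exact zero_mem _
  have h := congrArg (Finsupp.lmapDomain k k (QuotientAddGroup.map ((B.comap g.hom).obj a)
    (B.obj a) (g.hom.hom.app a).hom (fun ξ hξ => hξ))) (hy _ hB')
  rw [map_zero] at h
  rw [← h]
  change Finsupp.mapDomain _ (Finsupp.mapDomain _ y) = Finsupp.mapDomain _ (Finsupp.mapDomain _ y)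
  simp only [← Finsupp.mapDomain_comp]
  rfl

/-- The action of `Aut A` on `Q_A(a)`. -/
def lowerRho (A : AddRep C) (a : C) :
    Representation k (Aut A) ((A.obj.obj a →₀ k) ⧸ lowerKer k A a) :=
  Representation.quotient (linRho k A a) (lowerKer k A a) (lowerKer_aut k A a)

/-- `Q_A`, the cokernel of `⨁_{B ⊊ A} k[B] ⟶ k[A]`, with its action of `Aut A`. -/
def qLower (A : AddRep C) : C ⥤ Rep.{v} k (Aut A) where
  obj a := Rep.of (lowerRho k A a)
  map {a b} f := Rep.ofHom
    ⟨Submodule.mapQ _ _ (Finsupp.lmapDomain k k (A.obj.map f)) (lowerKer_map k A f), fun g => by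
      ext x : 3
      exact congrArg (Submodule.Quotient.mk (p := lowerKer k A b))
        (LinearMap.congr_fun (((lin k A).map f).hom.2 g) (Finsupp.single x 1))⟩
  map_id a := by
    ext x : 5
    simp
  map_comp f g := by
    ext x : 5
    simp

/-- The action of `Aut A` on `Q^A(a)`. -/
def upperRho (A : AddRep C) (a : C) : Representation k (Aut A) (upperKer k A a) :=
  Representation.subrepresentation (linRho k A a) (upperKer k A a) (upperKer_aut k A a)

/-- The map `Q^A(a) → Q^A(b)` induced by `f : a ⟶ b`. -/
def upperMap (A : AddRep C) {a b : C} (f : a ⟶ b) :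
    (upperRho k A a).IntertwiningMap (upperRho k A b) where
  toLinearMap := (Finsupp.lmapDomain k k (A.obj.map f)).restrict (upperKer_map k A f)
  isIntertwining' g := by
    refine LinearMap.ext fun x => Subtype.ext ?_
    exact LinearMap.congr_fun (((lin k A).map f).hom.2 g) x.1

/-- `Q^A(a)` as a representation of `Aut A`. -/
def upperObj (A : AddRep C) (a : C) : Rep.{v} k (Aut A) :=
  Rep.of (X := upperKer k A a) (upperRho k A a)

/-- `Q^A`, the kernel of `k[A] ⟶ ∏_{0 ≠ B ⊆ A} k[A/B]`, with its action of `Aut A`. -/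
def qUpper (A : AddRep C) : C ⥤ Rep.{v} k (Aut A) where
  obj a := upperObj k A a
  map {a b} f := Rep.ofHom (upperMap k A f)
  map_id a := by
    refine Rep.hom_ext (Representation.IntertwiningMap.ext
      (LinearMap.ext fun x => Subtype.ext ?_))
    exact congrArg (fun φ => φ.hom x.1) ((lin k A).map_id a)
  map_comp f g := by
    refine Rep.hom_ext (Representation.IntertwiningMap.ext
      (LinearMap.ext fun x => Subtype.ext ?_))
    exact congrArg (fun φ => φ.hom x.1) ((lin k A).map_comp f g)

/-- The composite `Q^A(a) → k[A(a)] → Q_A(a)` of the inclusion and the projection. -/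
def upperToLower (A : AddRep C) (a : C) :
    (upperRho k A a).IntertwiningMap (lowerRho k A a) where
  toLinearMap := (lowerKer k A a).mkQ ∘ₗ (upperKer k A a).subtype
  isIntertwining' _ := rfl

/-- The composite `Q^A ⟶ k[A] ⟶ Q_A` of the inclusion and the projection. -/
def qUpperToLower (A : AddRep C) : qUpper k A ⟶ qLower k A where
  app a := Rep.ofHom (upperToLower k A a)
  naturality _ _ _ := rfl

variable {k}

/-- The functor `M ⊗_{k[G]} -`, i.e. `X ↦ (M ⊗ X)_G` for the diagonal action of `G`. -/
def tensorOver {G : Type w} [Group G] (M : ModuleCat.{v} (MonoidAlgebra k G)) :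
    Rep.{v} k G ⥤ ModuleCat.{v} k :=
  (Rep.coinvariantsTensor k G).obj (Rep.ofModuleMonoidAlgebra.obj M)

/-- `Q(A, M)`: the image of the morphism `M ⊗_{k[Aut A]} Q^A ⟶ M ⊗_{k[Aut A]} Q_A = Q_{A, M}`
obtained by applying `M ⊗_{k[Aut A]} -` to `Q^A ↪ k[A] ↠ Q_A`.
(When `A` is finite and `C` is `k`-trivial, the norm
identifies its source with the invariants `Q^{A, M} = (M ⊗ Q^A)^{Aut A}`; the image is the
same.) -/
def Q (A : AddRep C) (M : ModuleCat.{v} (MonoidAlgebra k (Aut A))) : C ⥤ ModuleCat.{v} k :=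
  image (Functor.whiskerRight (qUpperToLower k A) (tensorOver M))

end Q

/-! ### The subcategories `F_d` -/

section Fd

variable {k : Type v} [Field k] {C : Type u} [Category.{v} C] [Preadditive C]
  [HasBinaryBiproducts C]

/-- The functor `x ⊕ - : C ⥤ C`. -/
def biprodLeft (x : C) : C ⥤ C where
  obj a := x ⊞ a
  map f := biprod.map (𝟙 x) f

/-- The shift `τ_x F = F(x ⊕ -)`. -/
def tau (x : C) (F : C ⥤ ModuleCat.{v} k) : C ⥤ ModuleCat.{v} k :=
  biprodLeft x ⋙ F

/-- The endomorphism of `x ⊕ a` with matrix `(1 0; u 1)`. -/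
def transvection {x a : C} (u : x ⟶ a) : x ⊞ a ⟶ x ⊞ a :=
  biprod.lift biprod.fst (biprod.fst ≫ u + biprod.snd)

/-- The span of the `u • y - y`, for `u` in `C(x, a)` and `y` in `F(x ⊕ a)`. -/
def coinvKer (x : C) (F : C ⥤ ModuleCat.{v} k) (a : C) : Submodule k (F.obj (x ⊞ a)) :=
  Submodule.span k
    (Set.range fun p : (x ⟶ a) × F.obj (x ⊞ a) => F.map (transvection p.1) p.2 - p.2)

theorem coinvKer_map (x : C) (F : C ⥤ ModuleCat.{v} k) {a b : C} (f : a ⟶ b) :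
    coinvKer x F a ≤ (coinvKer x F b).comap (F.map (biprod.map (𝟙 x) f)).hom := by
  refine Submodule.span_le.2 ?_
  rintro _ ⟨⟨u, y⟩, rfl⟩
  refine Submodule.subset_span ⟨(u ≫ f, F.map (biprod.map (𝟙 x) f) y), ?_⟩
  have h : biprod.map (𝟙 x) f ≫ transvection (u ≫ f) =
      transvection u ≫ biprod.map (𝟙 x) f := by
    ext <;> simp [transvection]
  have h' := ConcreteCategory.congr_hom (congrArg F.map h) y
  simp only [Functor.map_comp, ConcreteCategory.comp_apply] at h'
  change F.map (transvection (u ≫ f)) (F.map (biprod.map (𝟙 x) f) y) -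
    F.map (biprod.map (𝟙 x) f) y = F.map (biprod.map (𝟙 x) f) (F.map (transvection u) y - y)
  rw [map_sub, h']

/-- The parabolic shift: `a ↦ F(x ⊕ a)_{C(x, a)}` (coinvariants). -/
def barTau (x : C) (F : C ⥤ ModuleCat.{v} k) : C ⥤ ModuleCat.{v} k where
  obj a := ModuleCat.of k (F.obj (x ⊞ a) ⧸ coinvKer x F a)
  map {a b} f := ModuleCat.ofHom
    (Submodule.mapQ _ _ (F.map (biprod.map (𝟙 x) f)).hom (coinvKer_map x F f))
  map_id a := by
    have h : biprod.map (𝟙 x) (𝟙 a) = 𝟙 (x ⊞ a) := by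
      ext <;> simp
    ext y
    simp [h]
  map_comp f g := by
    ext y
    have h : biprod.map (𝟙 x) (f ≫ g) = biprod.map (𝟙 x) f ≫ biprod.map (𝟙 x) g := by
      ext <;> simp
    simp [h]

/-- The canonical map `F ⟶ τ̄_x F`, given by `F(a) → F(x ⊕ a) ↠ F(x ⊕ a)_{C(x, a)}`. -/
def toBarTau (x : C) (F : C ⥤ ModuleCat.{v} k) : F ⟶ barTau x F where
  app a := ModuleCat.ofHom ((coinvKer x F a).mkQ ∘ₗ (F.map (biprod.inr : a ⟶ x ⊞ a)).hom)
  naturality a b f := by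
    have h : f ≫ (biprod.inr : b ⟶ x ⊞ b) = biprod.inr ≫ biprod.map (𝟙 x) f := by simp
    have h' := congrArg F.map h
    rw [F.map_comp, F.map_comp] at h'
    ext y
    exact congrArg (coinvKer x F b).mkQ (ConcreteCategory.congr_hom h' y)

/-- The parabolic difference functor: `δ̄_x F` is the cokernel of `F ⟶ τ̄_x F`. -/
def barDelta (x : C) (F : C ⥤ ModuleCat.{v} k) : C ⥤ ModuleCat.{v} k :=
  cokernel (toBarTau x F)

/-- `F_d(C; k)`: the functors `F` with `δ̄_{a_0} ⋯ δ̄_{a_d} τ_x F = 0` for all objects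
`a_0, …, a_d, x`. -/
def Fd (k : Type v) [Field k] (C : Type u) [Category.{v} C] [Preadditive C]
    [HasBinaryBiproducts C] (d : ℕ) : ObjectProperty (C ⥤ ModuleCat.{v} k) :=
  fun F => ∀ (l : List C) (x : C), l.length = d + 1 → IsZero (l.foldr barDelta (tau x F))

end Fd

end

end AntiPoly

/-!
Averaging over the finite groups `C(x, a)`, whose orders are invertible in `k`, identifies
coinvariants with invariants and splits the surjections `k[A(c)] → k[(A/B)(c)]`.

If `v : A(a)` generates `A`, the generators of `A` in `A(a)` form a free `Aut A`-set and a basis of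
`Q_A(a)`, so every element of `(M ⊗ Q_A)(a)` has an `M`-valued coefficient at `v`. For `η : Q^A(b)`,
the operator `∑ η(A(f) v) • f` over `f : a ⟶ b` sends `t : (M ⊗ Q^A)(a)` to an invertible multiple
of `m ⊗ η`, where `m` is the coefficient at `v` of the image of `t` in `M ⊗ Q_A`. So, when `M` is
simple, every subfunctor of `M ⊗ Q^A` which does not vanish in `M ⊗ Q_A` is the whole functor,
whence `Q(A, M)` is simple; the same computation recovers `A` and `M` from `Q(A, M)`.

Conversely, a simple functor `S` with `S(a) ≠ 0` receives a nonzero map from the `k`-linearization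
of `C(a, -)`. Choose a quotient `A` of `C(a, -)` with `A(a)` of least cardinality such that a
kernel of projections `k[A] → k[A/⟨n⟩]`, `n : A(a)`, maps nontrivially to `S`. Minimality makes `A`
cogenerated by `a` and turns this kernel into `Q^A`; as `Aut A` is finite, the nonzero
`k[Aut A]`-module of morphisms `Q^A → S` contains a simple module `M`, and `S ≅ Q(A, M)`.

The functor `δ̄_x` replaces `k[A]` by the functors `k[A/⟨v⟩]`, `0 ≠ v : A(x)`: each application
shortens `A` by at least one, so `Q(A, M)` lies in `F_d` exactly when `A` has length at most `d`.
-/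

namespace AntiPoly

noncomputable section

/-! ### Sums over finite groups and coinvariants -/

section FiniteGroup

theorem sum_comp_surjective {G H N : Type*} [AddGroup G] [AddGroup H] [Fintype G] [Fintype H]
    [AddCommMonoid N] (p : G →+ H) (hp : Function.Surjective p) (φ : H → N) :
    ∑ g, φ (p g) = Nat.card p.ker • ∑ h, φ h := by
  classical
  rw [← Finset.sum_fiberwise (s := Finset.univ) (g := p), Finset.smul_sum]
  refine Finset.sum_congr rfl fun h _ => ?_
  have hcard : Nat.card p.ker = (Finset.univ.filter fun g => p g = h).card := by
    rw [AddMonoidHom.card_fiber_eq_of_mem_range p (hp h) (hp 0), Nat.card_eq_fintype_card,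
      Fintype.card_subtype]
    simp only [AddMonoidHom.mem_ker]
  rw [hcard, ← Finset.sum_const]
  exact Finset.sum_congr rfl fun g hg => by rw [(Finset.mem_filter.1 hg).2]

theorem card_addSubgroup_ne_zero {R G : Type*} [Semiring R] [AddGroup G] (N : AddSubgroup G)
    (hG : (Nat.card G : R) ≠ 0) : (Nat.card N : R) ≠ 0 := by
  obtain ⟨m, hm⟩ := AddSubgroup.card_addSubgroup_dvd_card N
  rw [hm, Nat.cast_mul] at hG
  exact left_ne_zero_of_mul hG

variable {R G X : Type*} [CommRing R] [Group G] [Fintype G] [AddCommGroup X] [Module R X]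
  (ρ : Representation R G X)

theorem norm_eq_zero_of_mem_coinvariantsKer {x : X} (hx : x ∈ Representation.Coinvariants.ker ρ) :
    ρ.norm x = 0 := by
  have hle : Representation.Coinvariants.ker ρ ≤ LinearMap.ker ρ.norm := by
    refine Submodule.span_le.2 ?_
    rintro _ ⟨⟨g, y⟩, rfl⟩
    simp
  exact hle hx

theorem norm_sub_card_smul_mem_coinvariantsKer (x : X) :
    ρ.norm x - (Nat.card G : R) • x ∈ Representation.Coinvariants.ker ρ := by
  have h : ρ.norm x - (Nat.card G : R) • x = ∑ g, (ρ g x - x) := by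
    simp [Representation.norm, Nat.cast_smul_eq_nsmul]
  rw [h]
  exact Submodule.sum_mem _ fun g _ => Representation.Coinvariants.sub_mem_ker g x

end FiniteGroup

/-! ### The kernel of `k[V] → k[V/N]` -/

section CosetKer

theorem ker_lmapDomain_le {R α β : Type*} [Ring R] (π : α → β) {p : Submodule R (α →₀ R)}
    (h : ∀ x y, π x = π y → Finsupp.single x 1 - Finsupp.single y 1 ∈ p) :
    LinearMap.ker (Finsupp.lmapDomain R R π) ≤ p := by
  intro ξ hξ
  cases isEmpty_or_nonempty α
  · rw [Subsingleton.elim ξ 0]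
    exact p.zero_mem
  have hsection (ζ : α →₀ R) : ζ - (ζ.mapDomain π).mapDomain (Function.invFun π) ∈ p := by
    induction ζ using Finsupp.induction_linear with
    | zero => simp
    | add ζ ζ' hζ hζ' =>
      rw [Finsupp.mapDomain_add, Finsupp.mapDomain_add, add_sub_add_comm]
      exact p.add_mem hζ hζ'
    | single x r =>
      have := p.smul_mem r (h x _ (Function.invFun_eq ⟨x, rfl⟩).symm)
      simpa [smul_sub, Finsupp.mapDomain_single] using this
  have h0 : ξ.mapDomain π = 0 := hξ
  simpa [h0] using hsection ξ

variable (R : Type*) [CommRing R] {V W : Type*} [AddCommGroup V] [AddCommGroup W]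

/-- The kernel of the map `R[V] → R[V/N]`; the functors `Q^A` are intersections of such kernels. -/
def cosetKer (N : AddSubgroup V) : Submodule R (V →₀ R) :=
  LinearMap.ker (Finsupp.lmapDomain R R (QuotientAddGroup.mk : V → V ⧸ N))

/-- The action of `N` on `R[V]` by translations. -/
def translation (N : AddSubgroup V) : Representation R (Multiplicative N) (V →₀ R) where
  toFun n := Finsupp.lmapDomain R R (fun x => x + n.toAdd.1)
  map_one' := by ext : 2; simp
  map_mul' m n := by
    ext : 2
    simp [add_comm, add_left_comm]

variable {R} {N N' : AddSubgroup V}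

theorem mem_cosetKer {ξ : V →₀ R} :
    ξ ∈ cosetKer R N ↔ ξ.mapDomain (QuotientAddGroup.mk : V → V ⧸ N) = 0 := Iff.rfl

theorem translation_single (n : Multiplicative N) (x : V) (r : R) :
    translation R N n (Finsupp.single x r) = Finsupp.single (x + n.toAdd.1) r :=
  Finsupp.mapDomain_single

theorem single_sub_single_mem_cosetKer {x y : V} (h : x - y ∈ N) (r : R) :
    Finsupp.single x r - Finsupp.single y r ∈ cosetKer R N := by
  have hxy : (x : V ⧸ N) = y := (QuotientAddGroup.eq.2 (by rwa [neg_add_eq_sub])).symm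
  rw [cosetKer, LinearMap.mem_ker, map_sub, Finsupp.lmapDomain_apply, Finsupp.lmapDomain_apply,
    Finsupp.mapDomain_single, Finsupp.mapDomain_single, hxy, sub_self]

theorem mapDomain_sub_mapDomain_mem_cosetKer {X : Type*} {f g : X → V} (h : ∀ x, f x - g x ∈ N)
    (ξ : X →₀ R) : ξ.mapDomain f - ξ.mapDomain g ∈ cosetKer R N := by
  have hfg : (QuotientAddGroup.mk : V → V ⧸ N) ∘ f = QuotientAddGroup.mk ∘ g :=
    funext fun x => (QuotientAddGroup.eq.2 (by rw [neg_add_eq_sub]; exact h x)).symm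
  rw [cosetKer, LinearMap.mem_ker, map_sub, Finsupp.lmapDomain_apply, Finsupp.lmapDomain_apply,
    ← Finsupp.mapDomain_comp, ← Finsupp.mapDomain_comp, hfg, sub_self]

theorem cosetKer_le {p : Submodule R (V →₀ R)}
    (h : ∀ x y, x - y ∈ N → Finsupp.single x 1 - Finsupp.single y 1 ∈ p) : cosetKer R N ≤ p :=
  ker_lmapDomain_le _ fun x y hxy => h x y (by
    rw [← neg_add_eq_sub]
    exact QuotientAddGroup.eq.1 hxy.symm)

theorem mapDomain_mem_cosetKer {N' : AddSubgroup W} (g : V → W)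
    (hg : ∀ x y, x - y ∈ N → g x - g y ∈ N') {ξ : V →₀ R} (hξ : ξ ∈ cosetKer R N) :
    ξ.mapDomain g ∈ cosetKer R N' := by
  have hle : cosetKer R N ≤ (cosetKer R N').comap (Finsupp.lmapDomain R R g) :=
    cosetKer_le fun x y hxy => by
      rw [Submodule.mem_comap, map_sub, Finsupp.lmapDomain_apply, Finsupp.lmapDomain_apply,
        Finsupp.mapDomain_single, Finsupp.mapDomain_single]
      exact single_sub_single_mem_cosetKer (hg x y hxy) 1
  exact hle hξ

theorem cosetKer_mono (h : N ≤ N') : cosetKer R N ≤ cosetKer R N' :=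
  cosetKer_le fun _ _ hxy => single_sub_single_mem_cosetKer (h hxy) 1

theorem cosetKer_bot : cosetKer R (⊥ : AddSubgroup V) = ⊥ :=
  bot_unique <| cosetKer_le fun x y hxy => by
    rw [sub_eq_zero.1 (AddSubgroup.mem_bot.1 hxy), sub_self]
    exact Submodule.zero_mem _

theorem coinvariantsKer_translation :
    Representation.Coinvariants.ker (translation R N) = cosetKer R N := by
  refine le_antisymm (Submodule.span_le.2 ?_) (cosetKer_le fun x y hxy => ?_)
  · rintro _ ⟨⟨n, ξ⟩, rfl⟩
    induction ξ using Finsupp.induction_linear with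
    | zero => simp
    | add ξ ζ hξ hζ =>
      simp only [map_add, add_sub_add_comm]
      exact Submodule.add_mem _ hξ hζ
    | single x r =>
      simp only [translation_single]
      exact single_sub_single_mem_cosetKer (by simp) r
  · have := Representation.Coinvariants.sub_mem_ker (ρ := translation R N)
      (.ofAdd ⟨x - y, hxy⟩) (Finsupp.single y 1)
    simpa [translation_single] using this

theorem sum_add_eq_zero_of_mem_cosetKer [Fintype N] {ξ : V →₀ R} (hξ : ξ ∈ cosetKer R N) (x : V) :
    ∑ n : N, ξ (x + n) = 0 := by
  rw [← coinvariantsKer_translation] at hξ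
  have h := DFunLike.congr_fun (norm_eq_zero_of_mem_coinvariantsKer _ hξ) x
  rw [Representation.norm, LinearMap.sum_apply, Finsupp.finsetSum_apply] at h
  refine Eq.trans (Fintype.sum_equiv ((Equiv.neg N).trans Multiplicative.ofAdd) _ _ fun n => ?_) h
  have hx : x = x + n + (-n).1 := by simp
  conv_rhs => rw [hx]
  exact (Finsupp.mapDomain_apply (add_left_injective _) ξ (x + n)).symm

section Average

variable (k : Type*) [Field k]

/-- The average of the translations of `k[V]` by the elements of `N`: it is `0` when the order of
`N` vanishes in `k`. -/
def cosetAverage (N : AddSubgroup V) [Fintype N] : (V →₀ k) →ₗ[k] (V →₀ k) :=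
  (Nat.card N : k)⁻¹ • (translation k N).norm

variable {k} [Fintype N]

theorem cosetAverage_eq_zero {ξ : V →₀ k} (hξ : ξ ∈ cosetKer k N) : cosetAverage k N ξ = 0 := by
  rw [← coinvariantsKer_translation] at hξ
  rw [cosetAverage, LinearMap.smul_apply, norm_eq_zero_of_mem_coinvariantsKer _ hξ, smul_zero]

theorem cosetAverage_sub_mem_cosetKer (hN : (Nat.card N : k) ≠ 0) (ξ : V →₀ k) :
    cosetAverage k N ξ - ξ ∈ cosetKer k N := by
  have h := norm_sub_card_smul_mem_coinvariantsKer (translation k N) ξ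
  rw [coinvariantsKer_translation, Nat.card_congr Multiplicative.toAdd] at h
  have h' := Submodule.smul_mem _ (Nat.card N : k)⁻¹ h
  rwa [smul_sub, smul_smul, inv_mul_cancel₀ hN, one_smul] at h'

theorem cosetAverage_mem_cosetKer {N' : AddSubgroup V} {ξ : V →₀ k}
    (hξ : ξ ∈ cosetKer k (N' ⊔ N)) : cosetAverage k N ξ ∈ cosetKer k N' := by
  have hle : cosetKer k (N' ⊔ N) ≤ (cosetKer k N').comap (cosetAverage k N) := by
    refine cosetKer_le fun x y hxy => ?_
    obtain ⟨n', hn', n, hn, hsum⟩ := AddSubgroup.mem_sup.1 hxy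
    have hsplit : Finsupp.single x (1 : k) - Finsupp.single y 1 =
        (Finsupp.single x 1 - Finsupp.single (y + n') 1) +
          (Finsupp.single (y + n') 1 - Finsupp.single y 1) := by abel
    have hx : x - (y + n') ∈ N := by
      rwa [← sub_sub, ← hsum, add_sub_cancel_left]
    rw [hsplit, Submodule.mem_comap, map_add,
      cosetAverage_eq_zero (single_sub_single_mem_cosetKer hx 1), zero_add, cosetAverage,
      LinearMap.smul_apply, Representation.norm, LinearMap.sum_apply]
    refine Submodule.smul_mem _ _ (Submodule.sum_mem _ fun m _ => ?_)
    rw [map_sub, translation_single, translation_single]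
    exact single_sub_single_mem_cosetKer (by simpa using hn') 1
  exact hle hξ

end Average

/-! ### Transport of elements of `k[V]` along a pair of homomorphisms -/

section Transport

variable {k G : Type*} [Field k] [AddCommGroup G] [Fintype G]

theorem sum_smul_single_comp {α : Type*} (p : G →+ V) (hp : Function.Surjective p) (ξ : V →₀ k)
    (s : V → α) :
    ∑ g, ξ (p g) • Finsupp.single (s (p g)) (1 : k) = (Nat.card p.ker : k) • ξ.mapDomain s := by
  have := Finite.of_surjective p hp
  have : Fintype V := Fintype.ofFinite V
  rw [sum_comp_surjective p hp fun x => ξ x • Finsupp.single (s x) (1 : k),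
    Nat.cast_smul_eq_nsmul, Finsupp.mapDomain, Finsupp.sum_fintype _ _ (by simp)]
  simp

/- Grouping the terms along the cosets of `ker q`, the coefficients are the sums of `ξ` over the
cosets of `p (ker q)`. -/
theorem sum_smul_single_eq_zero (p : G →+ V) (q : G →+ W) (hq : (Nat.card q.ker : k) ≠ 0)
    {ξ : V →₀ k} (hξ : ξ ∈ cosetKer k (q.ker.map p)) :
    ∑ g, ξ (p g) • Finsupp.single (q g) (1 : k) = 0 := by
  have : Fintype q.ker := Fintype.ofFinite _
  have : Fintype (q.ker.map p) :=
    have := Finite.of_surjective _ (p.addSubgroupMap_surjective q.ker)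
    Fintype.ofFinite _
  have hcoset (x : V) : ∑ h : q.ker, ξ (x + p h) = 0 := by
    have := sum_comp_surjective _ (p.addSubgroupMap_surjective q.ker)
      fun n : q.ker.map p => ξ (x + n)
    rw [sum_add_eq_zero_of_mem_cosetKer hξ, smul_zero] at this
    exact this
  have hshift (h : q.ker) : ∑ g, ξ (p g) • Finsupp.single (q g) (1 : k) =
      ∑ g, ξ (p g + p h) • Finsupp.single (q g) (1 : k) := by
    refine (Fintype.sum_equiv (Equiv.addRight h.1) _ _ fun g => ?_).symm
    simp [AddMonoidHom.mem_ker.1 h.2]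
  refine (smul_eq_zero.1 ?_).resolve_left hq
  calc (Nat.card q.ker : k) • ∑ g, ξ (p g) • Finsupp.single (q g) (1 : k)
      = ∑ h : q.ker, ∑ g, ξ (p g + p h) • Finsupp.single (q g) (1 : k) := by
        simp only [← hshift, Finset.sum_const, Finset.card_univ, Nat.card_eq_fintype_card,
          Nat.cast_smul_eq_nsmul]
    _ = ∑ g, (∑ h : q.ker, ξ (p g + p h)) • Finsupp.single (q g) (1 : k) := by
        rw [Finset.sum_comm]
        simp only [Finset.sum_smul]
    _ = 0 := by simp only [hcoset, zero_smul, Finset.sum_const_zero]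

end Transport

end CosetKer

/-! ### Subfunctors, generators and cogenerators -/

section AddRep

variable {C : Type u} [Category.{v} C] [Preadditive C]

instance (A : AddRep C) : A.obj.Additive := A.property

namespace AddRep

variable {A A' : AddRep C}

theorem map_add_apply (A : AddRep C) {a b : C} (f g : a ⟶ b) (x : A.obj.obj a) :
    A.obj.map (f + g) x = A.obj.map f x + A.obj.map g x := by
  rw [Functor.map_add]
  rfl

theorem map_zero_apply (A : AddRep C) {a b : C} (x : A.obj.obj a) :
    A.obj.map (0 : a ⟶ b) x = 0 := by
  rw [Functor.map_zero]
  rfl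

theorem iso_hom_inv_apply (e : A ≅ A') {a : C} (x : A.obj.obj a) :
    e.inv.hom.app a (e.hom.hom.app a x) = x :=
  (((ObjectProperty.ι _).mapIso e).app a).hom_inv_id_apply x

theorem iso_inv_hom_apply (e : A ≅ A') {a : C} (x : A'.obj.obj a) :
    e.hom.hom.app a (e.inv.hom.app a x) = x :=
  iso_hom_inv_apply e.symm x

section Pair

variable {b c : C} [HasBinaryBiproduct b c]

/-- The element of `A(b ⊞ c)` corresponding to `(x, y)` under `A(b ⊞ c) ≅ A(b) × A(c)`. -/
def pair (A : AddRep C) (x : A.obj.obj b) (y : A.obj.obj c) : A.obj.obj (b ⊞ c) :=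
  A.obj.map biprod.inl x + A.obj.map biprod.inr y

@[simp]
theorem map_fst_pair (x : A.obj.obj b) (y : A.obj.obj c) :
    A.obj.map biprod.fst (A.pair x y) = x := by
  rw [pair, map_add, ← Functor.map_comp_apply, ← Functor.map_comp_apply, biprod.inl_fst,
    biprod.inr_fst, Functor.map_id_apply, A.map_zero_apply, add_zero]

@[simp]
theorem map_snd_pair (x : A.obj.obj b) (y : A.obj.obj c) :
    A.obj.map biprod.snd (A.pair x y) = y := by
  rw [pair, map_add, ← Functor.map_comp_apply, ← Functor.map_comp_apply, biprod.inl_snd,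
    biprod.inr_snd, Functor.map_id_apply, A.map_zero_apply, zero_add]

theorem pair_left_injective (y : A.obj.obj c) :
    Function.Injective fun x : A.obj.obj b => A.pair x y :=
  Function.LeftInverse.injective fun x => map_fst_pair x y

theorem pair_sub_pair (x x' : A.obj.obj b) (y y' : A.obj.obj c) :
    A.pair x y - A.pair x' y' = A.pair (x - x') (y - y') := by
  rw [pair, pair, pair, map_sub, map_sub, add_sub_add_comm]

end Pair

theorem isIso_of_bijective (φ : A ⟶ A') (hφ : ∀ a, Function.Bijective (φ.hom.app a)) :
    IsIso φ := by
  have : IsIso ((ObjectProperty.ι _).map φ) := (NatTrans.isIso_iff_isIso_app _).2 fun a =>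
    (ConcreteCategory.isIso_iff_bijective _).2 (hφ a)
  exact isIso_of_reflects_iso φ (ObjectProperty.ι _)

end AddRep

/-- The map `f ↦ A(f)(v)` given by an element `v` of `A(a)`; by Yoneda it is the morphism
`C(a, -) ⟶ A` corresponding to `v`. -/
def orbit (A : AddRep C) {a : C} (v : A.obj.obj a) (c : C) : (a ⟶ c) →+ A.obj.obj c where
  toFun f := A.obj.map f v
  map_zero' := A.map_zero_apply v
  map_add' f g := A.map_add_apply f g v

@[simp]
theorem orbit_apply (A : AddRep C) {a : C} (v : A.obj.obj a) {c : C} (f : a ⟶ c) :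
    orbit A v c f = A.obj.map f v := rfl

/-- The element `v` of `A(a)` generates `A`. -/
def IsGen (A : AddRep C) {a : C} (v : A.obj.obj a) : Prop :=
  ∀ c : C, Function.Surjective (orbit A v c)

/-- The object `b` cogenerates `A`: every nonzero element of `A` is detected by a morphism
to `b`. -/
def IsCogen (A : AddRep C) (b : C) : Prop :=
  ∀ (c : C) (u : A.obj.obj c), (∀ f : c ⟶ b, A.obj.map f u = 0) → u = 0

namespace SubRep

variable {A A' : AddRep C}

theorem pair_mem {b c : C} [HasBinaryBiproduct b c] (B : SubRep A) {x : A.obj.obj b}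
    {y : A.obj.obj c} (hx : x ∈ B.obj b) (hy : y ∈ B.obj c) : A.pair x y ∈ B.obj (b ⊞ c) :=
  add_mem (B.map_mem _ _ hx) (B.map_mem _ _ hy)

theorem mem_top {a : C} (x : A.obj.obj a) : x ∈ (⊤ : SubRep A).obj a := AddSubgroup.mem_top _

theorem mem_bot {a : C} {x : A.obj.obj a} : x ∈ (⊥ : SubRep A).obj a ↔ x = 0 :=
  AddSubgroup.mem_bot

theorem eq_top_iff_forall {B : SubRep A} : B = ⊤ ↔ ∀ a x, x ∈ B.obj a :=
  ⟨fun h _ x => h ▸ mem_top x, fun h => top_unique fun a x _ => h a x⟩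

theorem eq_bot_iff_forall {B : SubRep A} : B = ⊥ ↔ ∀ a, ∀ x ∈ B.obj a, x = 0 :=
  ⟨fun h _ _ hx => mem_bot.1 (h ▸ hx), fun h => bot_unique fun a x hx => mem_bot.2 (h a x hx)⟩

instance : Lattice (SubRep A) where
  sup B B' :=
    { obj := fun a => B.obj a ⊔ B'.obj a
      map_mem := fun f ξ h => by
        obtain ⟨y, hy, z, hz, rfl⟩ := AddSubgroup.mem_sup.1 h
        rw [map_add]
        exact AddSubgroup.add_mem_sup (B.map_mem f y hy) (B'.map_mem f z hz) }
  inf B B' :=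
    { obj := fun a => B.obj a ⊓ B'.obj a
      map_mem := fun f ξ h => ⟨B.map_mem f ξ h.1, B'.map_mem f ξ h.2⟩ }
  le_sup_left _ _ := fun _ => le_sup_left
  le_sup_right _ _ := fun _ => le_sup_right
  sup_le _ _ _ h h' := fun a => sup_le (h a) (h' a)
  inf_le_left _ _ := fun _ => inf_le_left
  inf_le_right _ _ := fun _ => inf_le_right
  le_inf _ _ _ h h' := fun a => le_inf (h a) (h' a)

instance : IsModularLattice (SubRep A) where
  sup_inf_le_assoc_of_le {_} y {_} h := fun a =>
    IsModularLattice.sup_inf_le_assoc_of_le (y.obj a) (h a)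

/-- The subfunctor of `A` generated by `v`. -/
def span {a : C} (v : A.obj.obj a) : SubRep A where
  obj c := (orbit A v c).range
  map_mem := by
    rintro b c f _ ⟨g, rfl⟩
    exact ⟨g ≫ f, A.obj.map_comp_apply g f v⟩

theorem mem_span {a c : C} {v : A.obj.obj a} {x : A.obj.obj c} :
    x ∈ (span v).obj c ↔ ∃ f : a ⟶ c, A.obj.map f v = x := Iff.rfl

theorem self_mem_span {a : C} (v : A.obj.obj a) : v ∈ (span v).obj a :=
  ⟨𝟙 a, A.obj.map_id_apply a v⟩

theorem span_le {a : C} {v : A.obj.obj a} {B : SubRep A} : span v ≤ B ↔ v ∈ B.obj a := by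
  refine ⟨fun h => h a (self_mem_span v), fun h c => ?_⟩
  rintro _ ⟨f, rfl⟩
  exact B.map_mem f v h

theorem span_eq_top {a : C} {v : A.obj.obj a} : span v = ⊤ ↔ IsGen A v :=
  eq_top_iff_forall

theorem span_eq_bot {a : C} {v : A.obj.obj a} : span v = ⊥ ↔ v = 0 := by
  rw [← le_bot_iff, span_le, mem_bot]

/-- The union of a nonempty directed family of subfunctors. -/
def directedUnion (S : Set (SubRep A)) (hS : S.Nonempty) (hdir : DirectedOn (· ≤ ·) S) :
    SubRep A where
  obj c :=
    { carrier := {x | ∃ B ∈ S, x ∈ B.obj c}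
      zero_mem' := let ⟨B, hB⟩ := hS; ⟨B, hB, zero_mem _⟩
      add_mem' := by
        rintro x y ⟨B, hB, hx⟩ ⟨B', hB', hy⟩
        obtain ⟨D, hD, h, h'⟩ := hdir B hB B' hB'
        exact ⟨D, hD, add_mem (h c hx) (h' c hy)⟩
      neg_mem' := by
        rintro x ⟨B, hB, hx⟩
        exact ⟨B, hB, neg_mem hx⟩ }
  map_mem := by
    rintro b c f x ⟨B, hB, hx⟩
    exact ⟨B, hB, B.map_mem f x hx⟩

theorem mem_comap {φ : A ⟶ A'} {B : SubRep A'} {a : C} {x : A.obj.obj a} :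
    x ∈ (comap φ B).obj a ↔ φ.hom.app a x ∈ B.obj a := Iff.rfl

theorem comap_mono (φ : A ⟶ A') : Monotone (comap φ) :=
  fun _ _ h a _ hx => h a hx

/-- The image of a subfunctor. -/
def map (φ : A ⟶ A') (B : SubRep A) : SubRep A' where
  obj a := (B.obj a).map (φ.hom.app a).hom
  map_mem := by
    rintro a b f _ ⟨x, hx, rfl⟩
    exact ⟨A.obj.map f x, B.map_mem f x hx, NatTrans.naturality_apply φ.hom f x⟩

theorem map_le_iff {φ : A ⟶ A'} {B : SubRep A} {B' : SubRep A'} :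
    map φ B ≤ B' ↔ B ≤ comap φ B' := by
  refine ⟨fun h a x hx => h a ⟨x, hx, rfl⟩, ?_⟩
  rintro h a _ ⟨x, hx, rfl⟩
  exact h a hx

theorem map_mono (φ : A ⟶ A') : Monotone (map φ) :=
  fun _ _ h => map_le_iff.2 fun _ x hx => ⟨x, h _ hx, rfl⟩

/-- The order isomorphism of the lattices of subfunctors of two isomorphic functors. -/
def orderIsoOfIso (e : A ≅ A') : SubRep A ≃o SubRep A' where
  toFun := comap e.inv
  invFun := comap e.hom
  left_inv B := by
    ext a x
    rw [mem_comap, mem_comap, AddRep.iso_hom_inv_apply]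
  right_inv B := by
    ext a x
    rw [mem_comap, mem_comap, AddRep.iso_inv_hom_apply]
  map_rel_iff' {B B'} := by
    refine ⟨fun h a x hx => ?_, fun h => comap_mono _ h⟩
    rw [← AddRep.iso_hom_inv_apply e x] at hx ⊢
    exact h a hx

/-- The quotient functor `A/B`. -/
def quot (B : SubRep A) : AddRep C where
  obj :=
    { obj := fun a => AddCommGrpCat.of (A.obj.obj a ⧸ B.obj a)
      map := fun {a b} f => AddCommGrpCat.ofHom (QuotientAddGroup.map (B.obj a) (B.obj b)
        (A.obj.map f).hom (fun ξ hξ => B.map_mem f ξ hξ))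
      map_id := fun a => by
        ext x
        simp
      map_comp := fun {a b c} f g => by
        ext x
        exact congrArg (QuotientAddGroup.mk : _ → A.obj.obj c ⧸ B.obj c)
          (A.obj.map_comp_apply f g x) }
  property :=
    { map_add := fun {a b f g} => by
        ext x
        exact congrArg (QuotientAddGroup.mk : _ → A.obj.obj b ⧸ B.obj b) (A.map_add_apply f g x) }

/-- The projection `A(a) → (A/B)(a)`. -/
def cls (B : SubRep A) (a : C) : A.obj.obj a →+ B.quot.obj.obj a :=
  QuotientAddGroup.mk' (B.obj a)

theorem cls_surjective (B : SubRep A) (a : C) : Function.Surjective (B.cls a) :=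
  QuotientAddGroup.mk'_surjective _

theorem cls_eq_zero {B : SubRep A} {a : C} {x : A.obj.obj a} : B.cls a x = 0 ↔ x ∈ B.obj a :=
  QuotientAddGroup.eq_zero_iff x

theorem cls_eq_cls {B : SubRep A} {a : C} {x y : A.obj.obj a} :
    B.cls a x = B.cls a y ↔ x - y ∈ B.obj a := by
  rw [← sub_eq_zero, ← map_sub, cls_eq_zero]

theorem quot_map (B : SubRep A) {a b : C} (f : a ⟶ b) (x : A.obj.obj a) :
    B.quot.obj.map f (B.cls a x) = B.cls b (A.obj.map f x) := rfl

/-- The projection `A ⟶ A/B`. -/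
def proj (B : SubRep A) : A ⟶ B.quot where
  hom :=
    { app := fun a => AddCommGrpCat.ofHom (B.cls a)
      naturality := fun _ _ _ => rfl }

theorem proj_app (B : SubRep A) (a : C) (x : A.obj.obj a) : B.proj.hom.app a x = B.cls a x := rfl

/-- The correspondence between the subfunctors of `A` containing `B` and those of `A/B`. -/
def quotOrderIso (B : SubRep A) : Set.Ici B ≃o SubRep B.quot where
  toFun D := map B.proj D.1
  invFun D := ⟨comap B.proj D, fun a x hx => by
    rw [mem_comap, proj_app, cls_eq_zero.2 hx]
    exact zero_mem _⟩
  left_inv D := by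
    refine Subtype.ext (le_antisymm ?_ (map_le_iff.1 le_rfl))
    rintro a x ⟨y, hy, hyx⟩
    have hsub := D.2 a (cls_eq_cls.1 (hyx : B.cls a y = B.cls a x))
    simpa using sub_mem hy hsub
  right_inv D := by
    refine le_antisymm (map_le_iff.2 le_rfl) fun a x hx => ?_
    obtain ⟨x, rfl⟩ := B.cls_surjective a x
    exact ⟨x, hx, rfl⟩
  map_rel_iff' {D D'} := by
    refine ⟨fun h a x hx => ?_, fun h => map_mono _ h⟩
    obtain ⟨y, hy, hyx⟩ := h a ⟨x, hx, rfl⟩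
    have hsub := D'.2 a (cls_eq_cls.1 (hyx : B.cls a y = B.cls a x))
    simpa using sub_mem hy hsub

end SubRep

namespace IsGen

variable {A : AddRep C} {a : C} {v : A.obj.obj a}

theorem cls (hv : IsGen A v) (B : SubRep A) : IsGen B.quot (B.cls a v) := by
  intro c x
  obtain ⟨x, rfl⟩ := B.cls_surjective c x
  obtain ⟨f, rfl⟩ := hv c x
  exact ⟨f, rfl⟩

theorem of_map {b : C} (f : a ⟶ b) (h : IsGen A (A.obj.map f v)) : IsGen A v := by
  intro c x
  obtain ⟨g, rfl⟩ := h c x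
  exact ⟨f ≫ g, A.obj.map_comp_apply f g v⟩

theorem hom_apply {A' : AddRep C} (hv : IsGen A v) (φ : A ⟶ A')
    (hφ : ∀ c, Function.Surjective (φ.hom.app c)) : IsGen A' (φ.hom.app a v) := by
  intro c x
  obtain ⟨x, rfl⟩ := hφ c x
  obtain ⟨f, rfl⟩ := hv c x
  exact ⟨f, (NatTrans.naturality_apply φ.hom f v).symm⟩

theorem aut_apply (hv : IsGen A v) (g : Aut A) : IsGen A (g.hom.hom.app a v) :=
  hv.hom_apply g.hom fun c x => ⟨g.inv.hom.app c x, aut_apply_inv A g c x⟩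

theorem hom_ext {A' : AddRep C} (hv : IsGen A v) {φ ψ : A ⟶ A'}
    (h : φ.hom.app a v = ψ.hom.app a v) : φ = ψ := by
  refine ObjectProperty.hom_ext _ ?_
  ext c x
  obtain ⟨f, rfl⟩ := hv c x
  rw [orbit_apply, NatTrans.naturality_apply, NatTrans.naturality_apply, h]

theorem aut_ext (hv : IsGen A v) {g h : Aut A} (heq : g.hom.hom.app a v = h.hom.hom.app a v) :
    g = h :=
  Iso.ext (hv.hom_ext heq)

theorem isFinGen (hv : IsGen A v) : IsFinGen A := by
  intro S hS hdir hlub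
  have htop : ⊤ ≤ SubRep.directedUnion S hS hdir := hlub.2 fun B hB c x hx => ⟨B, hB, hx⟩
  obtain ⟨B, hB, hvB⟩ := htop a (SubRep.mem_top v)
  rw [← SubRep.span_le, SubRep.span_eq_top.2 hv, top_le_iff] at hvB
  exact hvB ▸ hB

end IsGen

theorem IsCogen.isFinCogen {A : AddRep C} {b : C} (hb : IsCogen A b) [Finite (A.obj.obj b)] :
    IsFinCogen A := by
  intro S hS hdir hglb
  have havoid (u : A.obj.obj b) : ∃ B : S, u ∈ B.1.obj b → u = 0 := by
    by_contra! h
    obtain ⟨B, hB⟩ := hS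
    have hle : SubRep.span u ≤ ⊥ := hglb.2 fun B hB => SubRep.span_le.2 (h ⟨B, hB⟩).1
    exact (h ⟨B, hB⟩).2 (SubRep.span_eq_bot.1 (le_bot_iff.1 hle))
  choose D hD using havoid
  have := hS.to_subtype
  obtain ⟨B, hB⟩ := (directedOn_iff_directed.1 hdir).finite_le D
  have hbot : B.1 = ⊥ := SubRep.eq_bot_iff_forall.2 fun c x hx =>
    hb c x fun g => hD _ (hB _ b (B.1.map_mem g x hx))
  exact hbot ▸ B.2

/-- The largest subfunctor of `A` which vanishes at `b`. -/
def annih (A : AddRep C) (b : C) : SubRep A where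
  obj c := ⨅ f : c ⟶ b, (A.obj.map f).hom.ker
  map_mem g ξ h := by
    simp only [AddSubgroup.mem_iInf, AddMonoidHom.mem_ker] at h ⊢
    exact fun f => (A.obj.map_comp_apply g f ξ).symm.trans (h _)

theorem mem_annih {A : AddRep C} {b c : C} {x : A.obj.obj c} :
    x ∈ (annih A b).obj c ↔ ∀ f : c ⟶ b, A.obj.map f x = 0 := by
  simp only [annih, AddSubgroup.mem_iInf]
  rfl

namespace IsFiniteRep

variable [HasBinaryBiproducts C] [Nonempty C] {A : AddRep C}

theorem exists_isGen (hA : IsFiniteRep A) : ∃ (a : C) (v : A.obj.obj a), IsGen A v := by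
  have := hA.1
  have : Nonempty (Σ a : C, A.obj.obj a) := ⟨Classical.arbitrary C, 0⟩
  obtain ⟨_, ⟨⟨a, v⟩, rfl⟩, hmax⟩ := (wellFounded_gt (α := SubRep A)).has_min
    (Set.range fun p : (Σ a : C, A.obj.obj a) => SubRep.span p.2) (Set.range_nonempty _)
  refine ⟨a, v, SubRep.span_eq_top.1 (SubRep.eq_top_iff_forall.2 fun c x => ?_)⟩
  have hle : SubRep.span v ≤ SubRep.span (A.pair v x) :=
    SubRep.span_le.2 ⟨_, AddRep.map_fst_pair v x⟩
  have heq := hle.eq_or_lt.resolve_right (hmax _ ⟨⟨a ⊞ c, A.pair v x⟩, rfl⟩)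
  exact (heq.symm.le : _ ≤ SubRep.span v) c ⟨_, AddRep.map_snd_pair v x⟩

theorem exists_isCogen (hA : IsFiniteRep A) : ∃ b : C, IsCogen A b := by
  have := hA.2
  obtain ⟨_, ⟨b, rfl⟩, hmin⟩ := (wellFounded_lt (α := SubRep A)).has_min
    (Set.range (annih A)) (Set.range_nonempty _)
  refine ⟨b, fun c u hu => ?_⟩
  have hle : annih A (b ⊞ c) ≤ annih A b := fun d x hx => mem_annih.2 fun f => by
    have h := congrArg (A.obj.map biprod.fst) (mem_annih.1 hx (f ≫ biprod.inl))
    rwa [← Functor.map_comp_apply, Category.assoc, biprod.inl_fst, Category.comp_id,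
      map_zero] at h
  have heq := hle.eq_or_lt.resolve_right (hmin _ ⟨_, rfl⟩)
  have h := congrArg (A.obj.map biprod.snd)
    (mem_annih.1 ((heq.symm.le : _ ≤ annih A (b ⊞ c)) c (mem_annih.2 hu)) biprod.inr)
  rwa [← Functor.map_comp_apply, biprod.inr_snd, Functor.map_id_apply, map_zero] at h

end IsFiniteRep

/-! ### Length -/

/-- All chains of subfunctors of `A` have length at most `n`. Unlike `HasLength`, this makes sense
for a functor which is not known to be finite, and it implies finiteness. -/
def LengthLE (A : AddRep C) (n : ℕ) : Prop :=
  ∀ s : LTSeries (SubRep A), s.length ≤ n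

namespace HasLength

variable {A : AddRep C} {n : ℕ}

theorem of_iso {A' : AddRep C} (e : A ≅ A') (h : HasLength A n) : HasLength A' n := by
  obtain ⟨s, h0, h1, hn⟩ := h
  refine ⟨s.map ⟨SubRep.orderIsoOfIso e, fun {_ _} hab => ?_⟩, ?_, ?_, hn⟩
  · exact (apply_covBy_apply_iff (SubRep.orderIsoOfIso e)).2 hab
  · exact (congrArg (SubRep.orderIsoOfIso e) h0).trans (map_bot _)
  · exact (congrArg (SubRep.orderIsoOfIso e) h1).trans (map_top _)

theorem lengthLE (h : HasLength A n) (hA : IsFiniteRep A) : LengthLE A n := by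
  have := hA.1
  have := hA.2
  obtain ⟨s, h0, h1, rfl⟩ := h
  intro t
  obtain ⟨t', i, -, ht₁, ht₂⟩ := t.exists_relSeries_covBy_and_head_eq_bot_and_last_eq_bot
  have hle : t.length ≤ t'.length := by simpa using Fintype.card_le_of_embedding i
  have heq : t'.length = s.length := by
    have e := (CompositionSeries.jordan_holder s t' (h0.trans ht₁.symm) (h1.trans ht₂.symm)).choose
    simpa using Fintype.card_congr e.symm
  exact hle.trans heq.le

theorem le {m : ℕ} (h : HasLength A n) (h' : LengthLE A m) : n ≤ m := by
  obtain ⟨s, -, -, rfl⟩ := h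
  exact h' (s.map ⟨id, fun h => h.1⟩)

end HasLength

theorem IsFiniteRep.exists_hasLength {A : AddRep C} (hA : IsFiniteRep A) :
    ∃ n, HasLength A n := by
  have := hA.1
  have := hA.2
  obtain ⟨f, f0, n, hn⟩ := exists_covBy_seq_of_wellFoundedLT_wellFoundedGT (SubRep A)
  exact ⟨n, ⟨n, fun i ↦ f i, fun i ↦ hn.2 i i.2⟩, f0.eq_bot, hn.1.eq_top, rfl⟩

namespace LengthLE

variable {A : AddRep C} {n : ℕ}

theorem isFiniteRep (h : LengthLE A n) : IsFiniteRep A := by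
  have : FiniteDimensionalOrder (SubRep A) := by
    by_contra hf
    have : InfiniteDimensionalOrder (SubRep A) := by
      rwa [not_finiteDimensionalOrder_iff] at hf
    have := h (LTSeries.withLength (SubRep A) (n + 1))
    simp at this
  exact ⟨⟨SetRel.IsWellFounded.inv_of_finiteDimensional {(a, b) : SubRep A × SubRep A | a < b}⟩,
    ⟨SetRel.IsWellFounded.of_finiteDimensional {(a, b) : SubRep A × SubRep A | a < b}⟩⟩

theorem mono {m : ℕ} (h : LengthLE A n) (hnm : n ≤ m) : LengthLE A m :=
  fun s => (h s).trans hnm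

theorem eq_zero (h : LengthLE A 0) {a : C} (v : A.obj.obj a) : v = 0 := by
  by_contra hv
  have hlt : (⊥ : SubRep A) < SubRep.span v := bot_lt_iff_ne_bot.2 (mt SubRep.span_eq_bot.1 hv)
  exact Nat.not_succ_le_zero _ (h ((RelSeries.singleton _ ⊥).snoc (SubRep.span v) hlt))

theorem quot_succ (h : LengthLE A (n + 1)) {B : SubRep A} (hB : B ≠ ⊥) :
    LengthLE B.quot n := by
  intro s
  have hmono : StrictMono fun D => (B.quotOrderIso.symm D).1 :=
    (Subtype.strictMono_coe _).comp B.quotOrderIso.symm.strictMono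
  have hlt : (⊥ : SubRep A) < (s.map _ hmono).head :=
    (bot_lt_iff_ne_bot.2 hB).trans_le (B.quotOrderIso.symm s.head).2
  simpa using h ((s.map _ hmono).cons ⊥ hlt)

theorem of_quot_span (h : ∀ (a : C) (v : A.obj.obj a), v ≠ 0 →
    ∃ m < n, LengthLE (SubRep.span v).quot m) : LengthLE A n := by
  rintro ⟨_ | m, s, hstep⟩
  · exact Nat.zero_le _
  have hs : StrictMono s := Fin.strictMono_iff_lt_succ.2 hstep
  obtain ⟨a, v, hv1, hv0⟩ : ∃ a, ∃ v ∈ (s 1).obj a, v ∉ (s 0).obj a := by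
    by_contra! hle
    exact (hs (by simp) : s 0 < s 1).not_ge hle
  have hmem (i : Fin (m + 1)) : SubRep.span v ≤ s i.succ :=
    SubRep.span_le.2 (hs.monotone (Fin.le_def.2 (by simp)) a hv1)
  obtain ⟨l, hln, hl⟩ := h a v fun h0 => hv0 (h0 ▸ zero_mem _)
  exact (hl (LTSeries.mk m (fun i => (SubRep.span v).quotOrderIso ⟨s i.succ, hmem i⟩)
    fun i j hij => OrderIso.strictMono _ (hs (Fin.succ_lt_succ_iff.2 hij)))).trans_lt hln

end LengthLE

end AddRep

/-! ### Morphisms out of a generated functor -/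

section Generator

variable {C : Type u} [Category.{v} C] [Preadditive C] {A A' : AddRep C}

namespace IsGen

variable {a : C} {v : A.obj.obj a} {w : A'.obj.obj a}

/-- The morphism sending a generator `v` to `w`. -/
def desc (hv : IsGen A v) (h : ∀ c, (orbit A v c).ker ≤ (orbit A' w c).ker) : A ⟶ A' where
  hom :=
    { app := fun c => AddCommGrpCat.ofHom ((orbit A v c).liftOfSurjective (hv c)
        ⟨orbit A' w c, h c⟩)
      naturality := fun b c f => by
        have happ (d : C) (g : a ⟶ d) : (orbit A v d).liftOfSurjective (hv d)
            ⟨orbit A' w d, h d⟩ (A.obj.map g v) = A'.obj.map g w :=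
          (orbit A v d).liftOfRightInverse_comp_apply _ _ _ g
        ext x
        obtain ⟨g, rfl⟩ := hv b x
        have hcomp := happ c (g ≫ f)
        rw [Functor.map_comp_apply, Functor.map_comp_apply] at hcomp
        exact hcomp.trans (congrArg (A'.obj.map f) (happ b g).symm) }

theorem desc_apply (hv : IsGen A v) (h : ∀ c, (orbit A v c).ker ≤ (orbit A' w c).ker) :
    (hv.desc h).hom.app a v = w := by
  have hid : (orbit A v a).liftOfSurjective (hv a) ⟨orbit A' w a, h a⟩ (A.obj.map (𝟙 a) v) =
      A'.obj.map (𝟙 a) w := (orbit A v a).liftOfRightInverse_comp_apply _ _ _ (𝟙 a)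
  rwa [Functor.map_id_apply, Functor.map_id_apply] at hid

theorem surjective_of_apply_eq (hv : IsGen A v) {φ : A' ⟶ A} (hφ : φ.hom.app a w = v) (c : C) :
    Function.Surjective (φ.hom.app c) := by
  intro x
  obtain ⟨f, rfl⟩ := hv c x
  exact ⟨A'.obj.map f w, by rw [NatTrans.naturality_apply, hφ, orbit_apply]⟩

theorem injective_orbit_surjInv (hv : IsGen A v) (h : ∀ c, (orbit A' w c).ker ≤ (orbit A v c).ker)
    (c : C) : Function.Injective fun u => orbit A' w c (Function.surjInv (hv c) u) := by
  intro u u' huu'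
  have hker := h c (AddMonoidHom.sub_mem_ker_iff _ |>.2 huu')
  rw [AddMonoidHom.sub_mem_ker_iff] at hker
  exact (Function.surjInv_eq (hv c) u).symm.trans (hker.trans (Function.surjInv_eq (hv c) u'))

theorem of_card_le [∀ c, Finite (A'.obj.obj c)]
    (hcard : ∀ c, Nat.card (A'.obj.obj c) ≤ Nat.card (A.obj.obj c)) (hv : IsGen A v)
    (h : ∀ c, (orbit A' w c).ker ≤ (orbit A v c).ker) : IsGen A' w := by
  intro c y
  obtain ⟨u, hu⟩ := ((hv.injective_orbit_surjInv h c).bijective_of_nat_card_le (hcard c)).2 y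
  exact ⟨_, hu⟩

theorem exists_iso_of_card_le [∀ c, Finite (A.obj.obj c)] [∀ c, Finite (A'.obj.obj c)]
    (hcard : ∀ c, Nat.card (A'.obj.obj c) ≤ Nat.card (A.obj.obj c)) (hv : IsGen A v)
    (h : ∀ c, (orbit A' w c).ker ≤ (orbit A v c).ker) :
    ∃ e : A ≅ A', e.hom.hom.app a v = w := by
  have hw : IsGen A' w := hv.of_card_le hcard h
  have hsurj := hv.surjective_of_apply_eq (hw.desc_apply h)
  have := AddRep.isIso_of_bijective (hw.desc h) fun c =>
    (hsurj c).bijective_of_nat_card_le (hcard c)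
  let e := asIso (hw.desc h)
  refine ⟨e.symm, ?_⟩
  rw [← hw.desc_apply h]
  exact AddRep.iso_hom_inv_apply e w

theorem finite {k : Type v} [Field k] (hC : IsKTrivial k C) (hv : IsGen A v) (c : C) :
    Finite (A.obj.obj c) :=
  have := (hC a c).1
  Finite.of_surjective _ (hv c)

end IsGen

/-! ### Elements of `Q^A` and twisting -/

variable {k : Type v} [Field k]

theorem mem_upperKer {a : C} {ξ : A.obj.obj a →₀ k} :
    ξ ∈ upperKer k A a ↔ ∀ B : SubRep A, B ≠ ⊥ → ξ ∈ cosetKer k (B.obj a) := by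
  simp only [upperKer, Submodule.mem_iInf]
  rfl

theorem mapDomain_pair_mem_cosetKer {b c : C} [HasBinaryBiproduct b c] (B : SubRep A)
    (y : A.obj.obj c) {ξ : A.obj.obj b →₀ k} (hξ : ξ ∈ cosetKer k (B.obj b)) :
    ξ.mapDomain (A.pair · y) ∈ cosetKer k (B.obj (b ⊞ c)) :=
  mapDomain_mem_cosetKer _ (fun x x' hxx' => by
    rw [AddRep.pair_sub_pair, sub_self]
    exact B.pair_mem hxx' (zero_mem _)) hξ

theorem mapDomain_pair_mem_upperKer {b c : C} [HasBinaryBiproduct b c] (y : A.obj.obj c)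
    {ξ : A.obj.obj b →₀ k} (hξ : ξ ∈ upperKer k A b) :
    ξ.mapDomain (A.pair · y) ∈ upperKer k A (b ⊞ c) :=
  mem_upperKer.2 fun B hB => mapDomain_pair_mem_cosetKer B y (mem_upperKer.1 hξ B hB)

theorem single_mem_lowerKer {a : C} {x : A.obj.obj a} (hx : ¬ IsGen A x) (r : k) :
    Finsupp.single x r ∈ lowerKer k A a :=
  Submodule.mem_iSup_of_mem (SubRep.span x) (Submodule.mem_iSup_of_mem
    (mt SubRep.span_eq_top.1 hx) ⟨Finsupp.single ⟨x, SubRep.self_mem_span x⟩ r, by simp⟩)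

section Twist

variable {a b : C} [Fintype (a ⟶ b)]

/-- The element `∑ η(A(f)(v)) [A'(f)(w)]` of `k[A'(b)]`, where `f` runs over `C(a, b)`: the
effect of `η` on `w`, through the functor `k[A']`, when morphisms are weighted along `v`. -/
def twist (v : A.obj.obj a) (η : A.obj.obj b →₀ k) (w : A'.obj.obj a) : A'.obj.obj b →₀ k :=
  ∑ f : a ⟶ b, η (A.obj.map f v) • Finsupp.single (A'.obj.map f w) 1

theorem twist_eq_zero {v : A.obj.obj a} {η : A.obj.obj b →₀ k} (hη : η ∈ upperKer k A b)
    {w : A'.obj.obj a} (hk : (Nat.card (a ⟶ b) : k) ≠ 0) {c : C}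
    (h : ¬ (orbit A' w c).ker ≤ (orbit A v c).ker) : twist v η w = 0 := by
  let B : SubRep A :=
    { obj := fun c => (orbit A' w c).ker.map (orbit A v c)
      map_mem := by
        rintro c d g _ ⟨f, hf, rfl⟩
        refine ⟨f ≫ g, ?_, A.obj.map_comp_apply f g v⟩
        rw [SetLike.mem_coe, AddMonoidHom.mem_ker, orbit_apply] at hf ⊢
        rw [Functor.map_comp_apply, hf, map_zero] }
  have hB : B ≠ ⊥ := fun hbot => h fun f hf =>
    SubRep.eq_bot_iff_forall.1 hbot c _ ⟨f, hf, rfl⟩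
  exact sum_smul_single_eq_zero (orbit A v b) (orbit A' w b) (card_addSubgroup_ne_zero _ hk)
    (mem_upperKer.1 hη B hB)

theorem twist_hom_apply {v : A.obj.obj a} (hv : IsGen A v) (η : A.obj.obj b →₀ k) (σ : A ⟶ A') :
    twist v η (σ.hom.app a v) =
      (Nat.card (orbit A v b).ker : k) • η.mapDomain (σ.hom.app b) := by
  rw [← sum_smul_single_comp _ (hv b), twist]
  simp only [NatTrans.naturality_apply, orbit_apply]

theorem sum_smul_mapDomain_eq_linearCombination_twist (v : A.obj.obj a) (η : A.obj.obj b →₀ k)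
    (ξ : A'.obj.obj a →₀ k) : ∑ f : a ⟶ b, η (A.obj.map f v) • ξ.mapDomain (A'.obj.map f) =
      Finsupp.linearCombination k (twist v η) ξ := by
  induction ξ using Finsupp.induction_linear with
  | zero => simp
  | add ξ ζ hξ hζ => simp only [Finsupp.mapDomain_add, smul_add, Finset.sum_add_distrib, hξ, hζ,
      map_add]
  | single w r =>
    rw [Finsupp.linearCombination_single, twist, Finset.smul_sum]
    refine Finset.sum_congr rfl fun f _ => ?_
    simp [Finsupp.mapDomain_single, mul_comm]

end Twist

end Generator

/-! ### The tensor product over a group algebra -/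

section Tensor

variable {k : Type v} [Field k] {G : Type w} [Group G] (M : ModuleCat.{v} (MonoidAlgebra k G))
  (X : Rep.{v} k G)

/-- The module `M`, as a representation. -/
abbrev repOf : Rep.{v} k G := Rep.ofModuleMonoidAlgebra.obj M

namespace tensorOver

/-- The class of `m ⊗ x` in the coinvariants `M ⊗_{k[G]} X`. -/
def mk : repOf M →ₗ[k] X →ₗ[k] (tensorOver M).obj X :=
  (TensorProduct.mk k (repOf M) X).compr₂
    (Representation.Coinvariants.mk ((repOf M).ρ.tprod X.ρ))

theorem mk_rho (g : G) (m : repOf M) (x : X) :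
    mk M X ((repOf M).ρ g m) (X.ρ g x) = mk M X m x :=
  Representation.Coinvariants.mk_self_apply ((repOf M).ρ.tprod X.ρ) g (m ⊗ₜ[k] x)

theorem induction {p : (tensorOver M).obj X → Prop} (zero : p 0)
    (add : ∀ s t, p s → p t → p (s + t)) (mk : ∀ m x, p (mk M X m x))
    (t : (tensorOver M).obj X) : p t := by
  obtain ⟨t, rfl⟩ := Representation.Coinvariants.mk_surjective ((repOf M).ρ.tprod X.ρ) t
  induction t using TensorProduct.induction_on with
  | zero => rwa [map_zero]
  | tmul m x => exact mk m x
  | add s t hs ht => rw [map_add]; exact add _ _ hs ht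

/-- The linear map out of the coinvariants induced by an invariant bilinear map. -/
def lift {N : Type*} [AddCommGroup N] [Module k N] (φ : repOf M →ₗ[k] X →ₗ[k] N)
    (h : ∀ g m x, φ ((repOf M).ρ g m) (X.ρ g x) = φ m x) : (tensorOver M).obj X →ₗ[k] N :=
  Representation.Coinvariants.lift ((repOf M).ρ.tprod X.ρ) (TensorProduct.lift φ)
    (fun g => TensorProduct.ext' fun m x => h g m x)

end tensorOver

end Tensor

/-! ### Elements of `M ⊗ Q^A` and `M ⊗ Q_A` -/

section QTensor

variable {k : Type v} [Field k] {C : Type u} [Category.{v} C] [Preadditive C]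
  (A : AddRep C) (M : ModuleCat.{v} (MonoidAlgebra k (Aut A)))

/-- The functor `M ⊗_{k[Aut A]} Q^A`, of which `Q(A, M)` is a quotient. -/
abbrev upperTensor : C ⥤ ModuleCat.{v} k := qUpper k A ⋙ tensorOver M

/-- The functor `M ⊗_{k[Aut A]} Q_A`, of which `Q(A, M)` is a subfunctor. -/
abbrev lowerTensor : C ⥤ ModuleCat.{v} k := qLower k A ⋙ tensorOver M

/-- The morphism `M ⊗ Q^A ⟶ M ⊗ Q_A` with image `Q(A, M)`. -/
abbrev tensorMap : upperTensor A M ⟶ lowerTensor A M :=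
  Functor.whiskerRight (qUpperToLower k A) (tensorOver M)

/-- The class of `m ⊗ ξ` in `(M ⊗ Q^A)(a)`, for `ξ` in `Q^A(a)`. -/
def upperTensor.mk (a : C) : repOf M →ₗ[k] upperKer k A a →ₗ[k] (upperTensor A M).obj a :=
  tensorOver.mk M (upperObj k A a)

/-- The class of `m ⊗ ξ` in `(M ⊗ Q_A)(a)`, for `ξ` in `k[A(a)]`. -/
def lowerTensor.mk (a : C) : repOf M →ₗ[k] (A.obj.obj a →₀ k) →ₗ[k] (lowerTensor A M).obj a :=
  (tensorOver.mk M (Rep.of (lowerRho k A a))).compl₂ (lowerKer k A a).mkQ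

variable {A M} {a b : C}

theorem upperTensor.map_mk (f : a ⟶ b) (m : repOf M) (ξ : upperKer k A a) :
    (upperTensor A M).map f (mk A M a m ξ) =
      mk A M b m ((Finsupp.lmapDomain k k (A.obj.map f)).restrict (upperKer_map k A f) ξ) := rfl

theorem upperTensor.mk_rho (g : Aut A) (m : repOf M) (ξ : upperKer k A a) :
    mk A M a ((repOf M).ρ g m) (upperRho k A a g ξ) = mk A M a m ξ :=
  tensorOver.mk_rho M (upperObj k A a) g m ξ

theorem upperTensor.induction {p : (upperTensor A M).obj a → Prop} (zero : p 0)
    (add : ∀ s t, p s → p t → p (s + t)) (mk : ∀ m ξ, p (mk A M a m ξ))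
    (t : (upperTensor A M).obj a) : p t :=
  tensorOver.induction M (upperObj k A a) zero add mk t

theorem upperTensor.hom_ext {F : C ⥤ ModuleCat.{v} k} {φ ψ : upperTensor A M ⟶ F}
    (h : ∀ a m ξ, φ.app a (mk A M a m ξ) = ψ.app a (mk A M a m ξ)) : φ = ψ := by
  ext a t
  induction t using upperTensor.induction with
  | zero => rw [map_zero, map_zero]
  | add s t hs ht => rw [map_add, map_add, hs, ht]
  | mk m ξ => exact h a m ξ

theorem lowerTensor.map_mk (f : a ⟶ b) (m : repOf M) (ξ : A.obj.obj a →₀ k) :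
    (lowerTensor A M).map f (mk A M a m ξ) = mk A M b m (ξ.mapDomain (A.obj.map f)) := rfl

theorem lowerTensor.mk_mapDomain (g : Aut A) (m : repOf M) (ξ : A.obj.obj a →₀ k) :
    mk A M a ((repOf M).ρ g m) (ξ.mapDomain (g.hom.hom.app a)) = mk A M a m ξ :=
  tensorOver.mk_rho M (Rep.of (lowerRho k A a)) g m ((lowerKer k A a).mkQ ξ)

theorem lowerTensor.mk_eq_zero (m : repOf M) {ξ : A.obj.obj a →₀ k} (hξ : ξ ∈ lowerKer k A a) :
    mk A M a m ξ = 0 := by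
  have h : (lowerKer k A a).mkQ ξ = 0 := (Submodule.Quotient.mk_eq_zero _).2 hξ
  exact (congrArg (tensorOver.mk M (Rep.of (lowerRho k A a)) m) h).trans (map_zero _)

theorem lowerTensor.induction {p : (lowerTensor A M).obj a → Prop} (zero : p 0)
    (add : ∀ s t, p s → p t → p (s + t)) (mk_single : ∀ m x r, p (mk A M a m (Finsupp.single x r)))
    (t : (lowerTensor A M).obj a) : p t := by
  refine tensorOver.induction M (Rep.of (lowerRho k A a)) zero add (fun m x => ?_) t
  obtain ⟨ξ, rfl⟩ := (lowerKer k A a).mkQ_surjective x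
  change p (lowerTensor.mk A M a m ξ)
  induction ξ using Finsupp.induction_linear with
  | zero => rwa [map_zero]
  | add ξ ζ hξ hζ => rw [map_add]; exact add _ _ hξ hζ
  | single x r => exact mk_single m x r

theorem tensorMap_mk (m : repOf M) (ξ : upperKer k A a) :
    (tensorMap A M).app a (upperTensor.mk A M a m ξ) = lowerTensor.mk A M a m ξ.1 := rfl

/-! ### Coefficients of elements of `M ⊗ Q_A` -/

open Classical in
variable (M) in
/-- The endomorphism of `M` given by `σ⁻¹` if `w = σ v` for an automorphism `σ` of `A`, and by `0`
otherwise, where `v` is a generator; it is `0` if `v` is not a generator. -/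
def transporter (v w : A.obj.obj a) : repOf M →ₗ[k] repOf M :=
  if h : IsGen A v ∧ ∃ σ : Aut A, σ.hom.hom.app a v = w then (repOf M).ρ (h.2.choose)⁻¹ else 0

theorem transporter_aut_apply {v : A.obj.obj a} (hv : IsGen A v) (σ : Aut A) :
    transporter M v (σ.hom.hom.app a v) = (repOf M).ρ σ⁻¹ := by
  have h : IsGen A v ∧ ∃ τ : Aut A, τ.hom.hom.app a v = σ.hom.hom.app a v := ⟨hv, σ, rfl⟩
  rw [transporter, dif_pos h, hv.aut_ext h.2.choose_spec]

theorem transporter_self {v : A.obj.obj a} (hv : IsGen A v) :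
    transporter M v v = LinearMap.id := by
  have h := transporter_aut_apply (M := M) hv 1
  rwa [inv_one, map_one] at h

theorem transporter_eq_zero {v w : A.obj.obj a}
    (h : ¬ (IsGen A v ∧ ∃ σ : Aut A, σ.hom.hom.app a v = w)) : transporter M v w = 0 :=
  dif_neg h

theorem transporter_rho (v w : A.obj.obj a) (g : Aut A) (m : repOf M) :
    transporter M v (g.hom.hom.app a w) ((repOf M).ρ g m) = transporter M v w m := by
  by_cases h : IsGen A v ∧ ∃ σ : Aut A, σ.hom.hom.app a v = w
  · obtain ⟨hv, σ, rfl⟩ := h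
    have hmul : g.hom.hom.app a (σ.hom.hom.app a v) = (g * σ).hom.hom.app a v := rfl
    rw [hmul, transporter_aut_apply hv, transporter_aut_apply hv, mul_inv_rev, map_mul,
      Module.End.mul_apply, Representation.inv_self_apply]
  · rw [transporter_eq_zero h, transporter_eq_zero, LinearMap.zero_apply, LinearMap.zero_apply]
    rintro ⟨hv, σ, hσ⟩
    refine h ⟨hv, g⁻¹ * σ, ?_⟩
    change g.inv.hom.app a (σ.hom.hom.app a v) = w
    rw [hσ, aut_inv_apply]

theorem lowerKer_le_ker_linearCombination_transporter (v : A.obj.obj a) :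
    lowerKer k A a ≤ LinearMap.ker (Finsupp.linearCombination k (transporter M v)) := by
  refine iSup₂_le fun B hB => ?_
  rintro _ ⟨ξ, rfl⟩
  rw [LinearMap.mem_ker, Finsupp.lmapDomain_apply, Finsupp.linearCombination_mapDomain]
  refine Finset.sum_eq_zero fun x _ => ?_
  have hx : transporter M v x.1 = 0 := by
    refine transporter_eq_zero ?_
    rintro ⟨hv, σ, hσ⟩
    refine hB (top_unique ?_)
    rw [← SubRep.span_eq_top.2 (hv.aut_apply σ), SubRep.span_le, hσ]
    exact x.2
  simp [hx]

theorem linearCombination_transporter_mapDomain (v : A.obj.obj a) (g : Aut A) (m : repOf M)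
    (ξ : A.obj.obj a →₀ k) :
    Finsupp.linearCombination k (transporter M v) (ξ.mapDomain (g.hom.hom.app a))
      ((repOf M).ρ g m) = Finsupp.linearCombination k (transporter M v) ξ m := by
  induction ξ using Finsupp.induction_linear with
  | zero => simp
  | add ξ ζ hξ hζ =>
    rw [Finsupp.mapDomain_add, map_add, map_add, LinearMap.add_apply, hξ, hζ,
      LinearMap.add_apply]
  | single x r =>
    rw [Finsupp.mapDomain_single, Finsupp.linearCombination_single,
      Finsupp.linearCombination_single, LinearMap.smul_apply, LinearMap.smul_apply,
      transporter_rho]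

variable (M) in
/-- The coefficient at the generator `v` of an element of `M ⊗ Q_A`: the generators of `A` in
`A(a)` form free orbits of `Aut A`, and the classes of the `m ⊗ [v]`, for `v` in a set of
representatives, describe `(M ⊗ Q_A)(a)` as a sum of copies of `M`. -/
def coeff (v : A.obj.obj a) : (lowerTensor A M).obj a →ₗ[k] repOf M :=
  tensorOver.lift M (Rep.of (lowerRho k A a))
    ((lowerKer k A a).liftQ (Finsupp.linearCombination k (transporter M v))
      (lowerKer_le_ker_linearCombination_transporter v)).flip fun g m x => by
    obtain ⟨ξ, rfl⟩ := (lowerKer k A a).mkQ_surjective x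
    exact linearCombination_transporter_mapDomain v g m ξ

theorem coeff_mk (v : A.obj.obj a) (m : repOf M) (ξ : A.obj.obj a →₀ k) :
    coeff M v (lowerTensor.mk A M a m ξ) = Finsupp.linearCombination k (transporter M v) ξ m := rfl

theorem coeff_mk_single (v w : A.obj.obj a) (m : repOf M) (r : k) :
    coeff M v (lowerTensor.mk A M a m (Finsupp.single w r)) = r • transporter M v w m := by
  rw [coeff_mk, Finsupp.linearCombination_single, LinearMap.smul_apply]

theorem mk_coeff_mk_single {v : A.obj.obj a} (σ : Aut A) (m : repOf M) (r : k) :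
    lowerTensor.mk A M a
        (coeff M v (lowerTensor.mk A M a m (Finsupp.single (σ.hom.hom.app a v) r)))
        (Finsupp.single v 1) =
      lowerTensor.mk A M a m (Finsupp.single (σ.hom.hom.app a v) r) := by
  by_cases hv : IsGen A v
  · have h := lowerTensor.mk_mapDomain σ ((repOf M).ρ σ⁻¹ m) (Finsupp.single v r)
    rw [Finsupp.mapDomain_single, Representation.self_inv_apply] at h
    rw [h, coeff_mk_single, transporter_self hv, LinearMap.id_apply, map_smul,
      LinearMap.smul_apply, ← map_smul, Finsupp.smul_single, smul_eq_mul, mul_one]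
  · have hσv : ¬ IsGen A (σ.hom.hom.app a v) := fun h => hv <| by
      rw [← aut_inv_apply A σ a v]
      exact h.aut_apply σ⁻¹
    rw [lowerTensor.mk_eq_zero m (single_mem_lowerKer hσv r), map_zero, map_zero,
      LinearMap.zero_apply]

variable (A a) in
/-- The relation on `A(a)` of being conjugate under `Aut A`. -/
def autSetoid : Setoid (A.obj.obj a) where
  r x y := ∃ σ : Aut A, σ.hom.hom.app a x = y
  iseqv :=
    { refl := fun _ => ⟨1, rfl⟩
      symm := by
        rintro x _ ⟨σ, rfl⟩
        exact ⟨σ⁻¹, aut_inv_apply A σ a x⟩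
      trans := by
        rintro x _ _ ⟨σ, rfl⟩ ⟨τ, rfl⟩
        exact ⟨τ * σ, rfl⟩ }

theorem eq_sum_coeff [Fintype (Quotient (autSetoid A a))] (t : (lowerTensor A M).obj a) :
    t = ∑ q : Quotient (autSetoid A a),
      lowerTensor.mk A M a (coeff M q.out t) (Finsupp.single q.out 1) := by
  induction t using lowerTensor.induction with
  | zero => simp
  | add s t hs ht =>
    simp only [map_add, LinearMap.add_apply, Finset.sum_add_distrib]
    rw [← hs, ← ht]
  | mk_single m x r =>
    rw [Finset.sum_eq_single (Quotient.mk (autSetoid A a) x)]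
    · obtain ⟨σ, hσ⟩ := Quotient.mk_out (s := autSetoid A a) x
      have h := mk_coeff_mk_single (v := (Quotient.mk (autSetoid A a) x).out) σ m r
      rw [hσ] at h
      exact h.symm
    · intro q _ hq
      rw [coeff_mk_single, transporter_eq_zero, LinearMap.zero_apply, smul_zero, map_zero,
        LinearMap.zero_apply]
      rintro ⟨-, h⟩
      rw [← Quotient.out_eq q] at hq
      exact hq (Quotient.sound h)
    · exact fun h => absurd (Finset.mem_univ _) h

theorem exists_coeff_ne_zero [Finite (A.obj.obj a)] {t : (lowerTensor A M).obj a} (ht : t ≠ 0) :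
    ∃ v : A.obj.obj a, IsGen A v ∧ coeff M v t ≠ 0 := by
  have : Fintype (Quotient (autSetoid A a)) := Fintype.ofFinite _
  by_contra! h
  refine ht ((eq_sum_coeff t).trans (Finset.sum_eq_zero fun q _ => ?_))
  by_cases hq : IsGen A q.out
  · rw [h _ hq, map_zero, LinearMap.zero_apply]
  · exact lowerTensor.mk_eq_zero _ (single_mem_lowerKer hq 1)

theorem coeff_mk_of_forall_map_eq (h : b ⟶ a) {w : A.obj.obj a} (hw : IsGen A w)
    {v : A.obj.obj b} (hv : A.obj.map h v = w) (m : repOf M) {ζ : A.obj.obj b →₀ k}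
    (hζ : ∀ s ∈ ζ.support, A.obj.map h s = w) :
    coeff M v (lowerTensor.mk A M b m ζ) = ζ v • m := by
  have hgen : IsGen A v := .of_map h (hv ▸ hw)
  rw [coeff_mk, Finsupp.linearCombination_apply, Finsupp.sum, LinearMap.sum_apply,
    Finset.sum_eq_single v, transporter_self hgen, LinearMap.smul_apply, LinearMap.id_apply]
  · intro s hs hsv
    rw [transporter_eq_zero, smul_zero, LinearMap.zero_apply]
    rintro ⟨-, σ, rfl⟩
    have hσw : σ.hom.hom.app a w = w := by
      rw [← hv, NatTrans.naturality_apply, hζ _ hs, hv]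
    have hσ : σ = 1 := hw.aut_ext hσw
    exact hsv (by rw [hσ]; rfl)
  · intro hv
    rw [Finsupp.notMem_support_iff.1 hv, zero_smul, LinearMap.zero_apply]

/-! ### The action of weighted sums of morphisms on `M ⊗ Q^A` -/

section KTrivial

variable [Fintype (a ⟶ b)] (hC : IsKTrivial k C) {v : A.obj.obj a} (hv : IsGen A v)
include hC hv

theorem exists_twist (η : upperKer k A b) (w : A.obj.obj a) :
    ∃ T : upperKer k A b, T.1 = twist v η.1 w ∧ ∀ m : repOf M, upperTensor.mk A M b m T =
      (Nat.card (orbit A v b).ker : k) • upperTensor.mk A M b (transporter M v w m) η := by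
  by_cases h : ∃ σ : Aut A, σ.hom.hom.app a v = w
  · obtain ⟨σ, rfl⟩ := h
    refine ⟨(Nat.card (orbit A v b).ker : k) • upperRho k A b σ η, ?_, fun m => ?_⟩
    · rw [twist_hom_apply hv]
      rfl
    · rw [map_smul, transporter_aut_apply hv, ← upperTensor.mk_rho σ _ η,
        Representation.self_inv_apply]
  · have := hv.finite hC
    obtain ⟨c, hc⟩ : ∃ c, ¬ (orbit A w c).ker ≤ (orbit A v c).ker := by
      by_contra! hker
      exact h (hv.exists_iso_of_card_le (fun _ => le_rfl) hker)
    refine ⟨0, (twist_eq_zero η.2 (hC a b).2 hc).symm, fun m => ?_⟩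
    rw [transporter_eq_zero fun hw => h hw.2, LinearMap.zero_apply, map_zero, map_zero,
      LinearMap.zero_apply, smul_zero]

theorem sum_smul_map_upperTensor (η : upperKer k A b) (t : (upperTensor A M).obj a) :
    ∑ f : a ⟶ b, η.1 (A.obj.map f v) • (upperTensor A M).map f t =
      (Nat.card (orbit A v b).ker : k) •
        upperTensor.mk A M b (coeff M v ((tensorMap A M).app a t)) η := by
  induction t using upperTensor.induction with
  | zero => simp
  | add s t hs ht =>
    simp only [map_add, smul_add, Finset.sum_add_distrib, LinearMap.add_apply]
    rw [hs, ht]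
  | mk m ξ =>
    choose T hT hmk using exists_twist (M := M) hC hv η
    have hsum : ∑ f : a ⟶ b, η.1 (A.obj.map f v) •
        (Finsupp.lmapDomain k k (A.obj.map f)).restrict (upperKer_map k A f) ξ =
          Finsupp.linearCombination k T ξ.1 := by
      refine Subtype.ext ?_
      have hTξ := Finsupp.apply_linearCombination k (upperKer k A b).subtype T ξ.1
      rw [show (upperKer k A b).subtype ∘ T = twist v η.1 from funext hT] at hTξ
      rw [AddSubmonoidClass.coe_finsetSum]
      exact (sum_smul_mapDomain_eq_linearCombination_twist v η.1 ξ.1).trans hTξ.symm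
    calc ∑ f : a ⟶ b, η.1 (A.obj.map f v) • (upperTensor A M).map f (upperTensor.mk A M a m ξ)
        = upperTensor.mk A M b m (Finsupp.linearCombination k T ξ.1) := by
          simp only [← hsum, map_sum, map_smul, upperTensor.map_mk]
      _ = ((Nat.card (orbit A v b).ker : k) • (upperTensor.mk A M b).flip η ∘ₗ
            LinearMap.applyₗ m) (Finsupp.linearCombination k (transporter M v) ξ.1) := by
          rw [Finsupp.apply_linearCombination, Finsupp.apply_linearCombination]
          exact congrArg (fun T => Finsupp.linearCombination k T ξ.1) (funext fun w => hmk w m)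
      _ = _ := rfl

end KTrivial

/-! ### Nonzero elements of `Q^A` -/

variable [HasBinaryBiproducts C]

theorem exists_forall_mem_cosetKer {n : A.obj.obj b} (hn : n ≠ 0) {η : A.obj.obj a →₀ k}
    (hη : η ≠ 0) : ∃ (c : C) (η' : A.obj.obj c →₀ k), η' ≠ 0 ∧ ∀ B : SubRep A,
      n ∈ B.obj b ∨ η ∈ cosetKer k (B.obj a) → η' ∈ cosetKer k (B.obj c) := by
  refine ⟨a ⊞ b, η.mapDomain (A.pair · n) - η.mapDomain (A.pair · 0), ?_, ?_⟩
  · obtain ⟨u, hu⟩ := Finsupp.ne_iff.1 hη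
    refine Finsupp.ne_iff.2 ⟨A.pair u 0, ?_⟩
    rw [Finsupp.sub_apply, Finsupp.mapDomain_apply (AddRep.pair_left_injective 0),
      Finsupp.mapDomain_of_notMem_range]
    · simpa using hu
    · rintro ⟨u', hu'⟩
      exact hn (by simpa using congrArg (A.obj.map biprod.snd) hu')
  · rintro B (hB | hB)
    · refine mapDomain_sub_mapDomain_mem_cosetKer (fun u => ?_) η
      rw [AddRep.pair_sub_pair, sub_self, sub_zero]
      exact B.pair_mem (zero_mem _) hB
    · exact Submodule.sub_mem _ (mapDomain_pair_mem_cosetKer B n hB)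
        (mapDomain_pair_mem_cosetKer B 0 hB)

variable (k) in
theorem IsCogen.exists_mem_upperKer_ne_zero (hb : IsCogen A b) [Finite (A.obj.obj b)] :
    ∃ (c : C) (η : A.obj.obj c →₀ k), η ∈ upperKer k A c ∧ η ≠ 0 := by
  classical
  have : Fintype (A.obj.obj b) := Fintype.ofFinite _
  have hfinset (s : Finset (A.obj.obj b)) (hs : 0 ∉ s) : ∃ (c : C) (η : A.obj.obj c →₀ k), η ≠ 0 ∧
      ∀ B : SubRep A, (∃ n ∈ s, n ∈ B.obj b) → η ∈ cosetKer k (B.obj c) := by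
    induction s using Finset.induction_on with
    | empty => exact ⟨b, Finsupp.single 0 1, by simp, by simp⟩
    | insert n s _ ih =>
      obtain ⟨hn, hs⟩ := not_or.1 (mt Finset.mem_insert.2 hs)
      obtain ⟨c, η, hη, h⟩ := ih hs
      obtain ⟨c', η', hη', h'⟩ := exists_forall_mem_cosetKer (Ne.symm hn) hη
      refine ⟨c', η', hη', fun B hB => h' B ?_⟩
      exact ((Finset.exists_mem_insert _ _ _).1 hB).imp_right (h B)
  obtain ⟨c, η, hη, h⟩ := hfinset (Finset.univ.erase 0) (Finset.notMem_erase _ _)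
  refine ⟨c, η, mem_upperKer.2 fun B hB => h B ?_, hη⟩
  by_contra! hn
  refine hB (SubRep.eq_bot_iff_forall.2 fun c x hx => hb c x fun f => ?_)
  by_contra hfx
  exact hn _ (Finset.mem_erase.2 ⟨hfx, Finset.mem_univ _⟩) (B.map_mem f x hx)

variable (k) in
theorem IsCogen.exists_mem_upperKer_forall_map_eq (hb : IsCogen A b) [Finite (A.obj.obj b)]
    (w : A.obj.obj a) : ∃ (c : C) (f : c ⟶ a) (η : A.obj.obj c →₀ k), η ∈ upperKer k A c ∧
      η ≠ 0 ∧ ∀ s ∈ η.support, A.obj.map f s = w := by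
  classical
  obtain ⟨c, η, hη, hne⟩ := hb.exists_mem_upperKer_ne_zero k
  refine ⟨c ⊞ a, biprod.snd, η.mapDomain (A.pair · w), mapDomain_pair_mem_upperKer w hη,
    fun h0 => hne (Finsupp.mapDomain_injective (AddRep.pair_left_injective w) (by simpa using h0)),
    fun s hs => ?_⟩
  obtain ⟨u, -, rfl⟩ := Finset.mem_image.1 (Finsupp.mapDomain_support hs)
  exact AddRep.map_snd_pair u w

variable (k) in
theorem exists_coeff_mk_eq_self {w : A.obj.obj a} (hw : IsGen A w) (hb : IsCogen A b)
    [Finite (A.obj.obj b)] : ∃ (c : C) (η : upperKer k A c) (v : A.obj.obj c), IsGen A v ∧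
      ∀ (M : ModuleCat.{v} (MonoidAlgebra k (Aut A))) (m : repOf M),
        coeff M v ((tensorMap A M).app c (upperTensor.mk A M c m η)) = m := by
  obtain ⟨c, f, η, hη, hne, hsupp⟩ := hb.exists_mem_upperKer_forall_map_eq k w
  obtain ⟨v, hv⟩ := Finsupp.ne_iff.1 hne
  have hfv : A.obj.map f v = w := hsupp v (Finsupp.mem_support_iff.2 hv)
  refine ⟨c, (η v)⁻¹ • ⟨η, hη⟩, v, .of_map f (hfv ▸ hw), fun M m => ?_⟩
  rw [map_smul, map_smul, map_smul, tensorMap_mk, coeff_mk_of_forall_map_eq f hw hfv m hsupp,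
    inv_smul_smul₀ hv]

end QTensor

/-! ### Functors to `k`-vector spaces -/

section Pointwise

variable {k : Type v} [Field k] {C : Type u} [Category.{v} C] {F F' : C ⥤ ModuleCat.{v} k}

theorem mono_iff_injective (α : F ⟶ F') : Mono α ↔ ∀ a, Function.Injective (α.app a) := by
  rw [NatTrans.mono_iff_mono_app]
  exact forall_congr' fun a => ModuleCat.mono_iff_injective _

theorem epi_iff_surjective (α : F ⟶ F') : Epi α ↔ ∀ a, Function.Surjective (α.app a) := by
  rw [NatTrans.epi_iff_epi_app]
  exact forall_congr' fun a => ModuleCat.epi_iff_surjective _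

theorem exists_app_ne_zero {α : F ⟶ F'} (h : α ≠ 0) : ∃ (a : C) (x : F.obj a), α.app a x ≠ 0 := by
  by_contra! h'
  refine h ?_
  ext a x
  exact h' a x

theorem isZero_of_forall_eq_zero (h : ∀ (a : C) (y : F.obj a), y = 0) : IsZero F := by
  rw [Functor.isZero_iff]
  intro a
  have : Subsingleton (F.obj a) := ⟨fun y z => (h a y).trans (h a z).symm⟩
  exact ModuleCat.isZero_of_subsingleton _

end Pointwise

/-! ### The functors `Q(A, M)` -/

section Q

variable {k : Type v} [Field k] {C : Type u} [Category.{v} C] [Preadditive C]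

/-- `A` is generated by one element, and some object detects all its nonzero elements. -/
def IsGenCogen (A : AddRep C) : Prop :=
  (∃ (a : C) (v : A.obj.obj a), IsGen A v) ∧ ∃ b : C, IsCogen A b

theorem IsFiniteRep.isGenCogen [Nonempty C] [HasBinaryBiproducts C] {A : AddRep C}
    (hA : IsFiniteRep A) : IsGenCogen A :=
  ⟨hA.exists_isGen, hA.exists_isCogen⟩

variable (A A' : AddRep C) (M N : ModuleCat.{v} (MonoidAlgebra k (Aut A)))
  {M' : ModuleCat.{v} (MonoidAlgebra k (Aut A'))}

/-- The projection `M ⊗ Q^A ⟶ Q(A, M)`. -/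
def toQ : upperTensor A M ⟶ Q A M :=
  factorThruImage (tensorMap A M)

/-- The inclusion `Q(A, M) ⟶ M ⊗ Q_A`. -/
def fromQ : Q A M ⟶ lowerTensor A M :=
  image.ι (tensorMap A M)

instance : Epi (toQ A M) := inferInstanceAs (Epi (factorThruImage (tensorMap A M)))

instance : Mono (fromQ A M) := inferInstanceAs (Mono (image.ι (tensorMap A M)))

theorem toQ_fromQ : toQ A M ≫ fromQ A M = tensorMap A M := image.fac _

variable {A A' M N} {a : C}

theorem fromQ_toQ_apply (t : (upperTensor A M).obj a) :
    (fromQ A M).app a ((toQ A M).app a t) = (tensorMap A M).app a t := by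
  rw [← toQ_fromQ]
  rfl

theorem toQ_surjective (a : C) : Function.Surjective ((toQ A M).app a) :=
  (epi_iff_surjective (toQ A M)).1 inferInstance a

theorem fromQ_injective (a : C) : Function.Injective ((fromQ A M).app a) :=
  (mono_iff_injective (fromQ A M)).1 inferInstance a

theorem nonempty_Q_iso_of_iso (e : M ≅ N) : Nonempty (Q A M ≅ Q A N) := by
  let ε : tensorOver M ≅ tensorOver N :=
    (Rep.coinvariantsTensor k (Aut A)).mapIso (Rep.ofModuleMonoidAlgebra.mapIso e)
  exact ⟨im.mapIso (Arrow.isoMk (f := Arrow.mk (tensorMap A M)) (g := Arrow.mk (tensorMap A N))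
    (Functor.isoWhiskerLeft (qUpper k A) ε) (Functor.isoWhiskerLeft (qLower k A) ε)
    (Functor.whiskerLeft_comp_whiskerRight ..))⟩

/-! ### Simplicity of `Q(A, M)` -/

/-- The subrepresentation of `M` of those `m` such that the image of `φ` contains all `m ⊗ η`. -/
def rangeCoeffs {Y : C ⥤ ModuleCat.{v} k} (φ : Y ⟶ upperTensor A M) :
    Subrepresentation (repOf M).ρ where
  toSubmodule := ⨅ (b : C) (η : upperKer k A b),
    (LinearMap.range (φ.app b).hom).comap ((upperTensor.mk A M b).flip η)
  apply_mem_toSubmodule g m hm := by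
    simp only [Submodule.mem_iInf] at hm ⊢
    intro b η
    have h := upperTensor.mk_rho g m (upperRho k A b g⁻¹ η)
    rw [Representation.self_inv_apply] at h
    exact (congrArg (· ∈ LinearMap.range (φ.app b).hom) h).mpr (hm b _)

theorem mem_rangeCoeffs {Y : C ⥤ ModuleCat.{v} k} {φ : Y ⟶ upperTensor A M} {m : repOf M} :
    m ∈ rangeCoeffs φ ↔
      ∀ b η, upperTensor.mk A M b m η ∈ LinearMap.range (φ.app b).hom := by
  refine Submodule.mem_iInf _ |>.trans (forall_congr' fun b => ?_)
  exact Submodule.mem_iInf _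

section KTrivial

variable (hC : IsKTrivial k C)
include hC

theorem sum_smul_map_Q {v : A.obj.obj a} (hv : IsGen A v) {b : C} [Fintype (a ⟶ b)]
    (η : upperKer k A b) (y : (Q A M).obj a) :
    ∑ f : a ⟶ b, η.1 (A.obj.map f v) • (Q A M).map f y =
      (Nat.card (orbit A v b).ker : k) •
        (toQ A M).app b (upperTensor.mk A M b (coeff M v ((fromQ A M).app a y)) η) := by
  obtain ⟨t, rfl⟩ := toQ_surjective a y
  rw [fromQ_toQ_apply, ← map_smul, ← sum_smul_map_upperTensor hC hv η t, map_sum]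
  exact Finset.sum_congr rfl fun f _ => by rw [map_smul, NatTrans.naturality_apply]

theorem exists_coeff_fromQ_eq_self [HasBinaryBiproducts C] (hA : IsGenCogen A) :
    ∃ (c : C) (η : upperKer k A c) (v : A.obj.obj c), IsGen A v ∧
      ∀ (M : ModuleCat.{v} (MonoidAlgebra k (Aut A))) (m : repOf M),
        coeff M v ((fromQ A M).app c ((toQ A M).app c (upperTensor.mk A M c m η))) = m := by
  obtain ⟨⟨a, w, hw⟩, b, hb⟩ := hA
  have := hw.finite hC b
  simpa only [fromQ_toQ_apply] using exists_coeff_mk_eq_self k hw hb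

theorem exists_coeff_fromQ_ne_zero (hA : IsGenCogen A) {y : (Q A M).obj a} (hy : y ≠ 0) :
    ∃ v : A.obj.obj a, IsGen A v ∧ coeff M v ((fromQ A M).app a y) ≠ 0 := by
  obtain ⟨⟨_, w, hw⟩, -⟩ := hA
  have := hw.finite hC a
  exact exists_coeff_ne_zero ((map_ne_zero_iff _ (fromQ_injective a)).2 hy)

theorem epi_of_comp_toQ_ne_zero (hA : IsGenCogen A) (hM : Simple M) {Y : C ⥤ ModuleCat.{v} k}
    (φ : Y ⟶ upperTensor A M) (hφ : φ ≫ toQ A M ≠ 0) : Epi φ := by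
  obtain ⟨a, y, hy⟩ := exists_app_ne_zero hφ
  obtain ⟨v, hv, hm⟩ := exists_coeff_fromQ_ne_zero hC hA hy
  have hmem : coeff M v ((fromQ A M).app a ((φ ≫ toQ A M).app a y)) ∈ rangeCoeffs φ := by
    refine mem_rangeCoeffs.2 fun b η => ?_
    have : Fintype (a ⟶ b) := @Fintype.ofFinite _ (hC a b).1
    have hcard : (Nat.card (orbit A v b).ker : k) ≠ 0 := card_addSubgroup_ne_zero _ (hC a b).2
    refine (Submodule.smul_mem_iff _ hcard).1 ?_
    have h := sum_smul_map_upperTensor hC hv η (φ.app a y)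
    rw [← fromQ_toQ_apply] at h
    refine (congrArg (· ∈ LinearMap.range (φ.app b).hom) h).mp (Submodule.sum_mem _ fun f _ => ?_)
    exact Submodule.smul_mem _ _ ⟨Y.map f y, NatTrans.naturality_apply φ f y⟩
  have : IsSimpleOrder (Subrepresentation (repOf M).ρ) :=
    (Representation.isSimpleModule_iff_irreducible_ofModule M).1
      ((simple_iff_isSimpleModule' M).1 hM)
  have htop : rangeCoeffs φ = ⊤ :=
    (eq_bot_or_eq_top _).resolve_left fun h => hm (by rwa [h] at hmem)
  refine (epi_iff_surjective φ).2 fun b t => ?_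
  change t ∈ LinearMap.range (φ.app b).hom
  induction t using upperTensor.induction with
  | zero => exact Submodule.zero_mem _
  | add s t hs ht => exact Submodule.add_mem _ hs ht
  | mk m η => exact mem_rangeCoeffs.1 (htop ▸ (Submodule.mem_top : m ∈ (⊤ : Submodule k _))) b η

variable [HasBinaryBiproducts C]

theorem toQ_ne_zero (hA : IsGenCogen A) (hM : Simple M) : toQ A M ≠ 0 := by
  have := (simple_iff_isSimpleModule' M).1 hM
  have := IsSimpleModule.nontrivial (MonoidAlgebra k (Aut A)) M
  obtain ⟨m, hm⟩ : ∃ m : repOf M, m ≠ 0 := exists_ne (0 : M)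
  obtain ⟨c, η, v, -, h⟩ := exists_coeff_fromQ_eq_self hC hA
  intro h0
  refine hm ((h M m).symm.trans ?_)
  rw [h0]
  exact (congrArg _ (map_zero _)).trans (map_zero _)

theorem simple_Q (hA : IsGenCogen A) (hM : Simple M) : Simple (Q A M) := by
  refine ⟨fun {Y} i _ => ⟨fun _ h0 => ?_, fun hi => ?_⟩⟩
  · have hid : 𝟙 (Q A M) = 0 := (cancel_epi i).1 (by rw [h0, zero_comp, zero_comp])
    exact toQ_ne_zero hC hA hM (by rw [← Category.comp_id (toQ A M), hid, comp_zero])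
  · have hcomp : pullback.snd i (toQ A M) ≫ toQ A M ≠ 0 := by
      rwa [← pullback.condition, Ne, ← comp_zero (f := pullback.fst i (toQ A M)), cancel_epi]
    have := epi_of_comp_toQ_ne_zero hC hA hM _ hcomp
    have : Epi (pullback.fst i (toQ A M) ≫ i) := by
      rw [pullback.condition]
      exact epi_comp _ _
    have := epi_of_epi (pullback.fst i (toQ A M)) i
    exact isIso_of_mono_of_epi i

theorem nonempty_iso_Q (hA : IsGenCogen A) (hM : Simple M) {S : C ⥤ ModuleCat.{v} k}
    (hS : Simple S) (ρ : upperTensor A M ⟶ S) (hρ : ρ ≠ 0) : Nonempty (S ≅ Q A M) := by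
  have : Epi ρ := epi_of_nonzero_to_simple hρ
  have hker : kernel.ι ρ ≫ toQ A M = 0 := by
    by_contra h
    have := epi_of_comp_toQ_ne_zero hC hA hM _ h
    exact hρ ((cancel_epi (kernel.ι ρ)).1 (by rw [kernel.condition, comp_zero]))
  have hdesc : Abelian.epiDesc ρ (toQ A M) hker ≠ 0 := fun h0 => toQ_ne_zero hC hA hM <| by
    rw [← Abelian.comp_epiDesc ρ (toQ A M) hker, h0, comp_zero]
  have := simple_Q hC hA hM
  have := isIso_of_hom_simple hdesc
  exact ⟨asIso (Abelian.epiDesc ρ (toQ A M) hker)⟩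

/-! ### `Q(A, M)` determines `A` and `M` -/

theorem exists_ker_orbit_le (hA : IsGenCogen A) {ψ : upperTensor A' M' ⟶ Q A M} (hψ : ψ ≠ 0) :
    ∃ (a : C) (v : A.obj.obj a) (w : A'.obj.obj a), IsGen A v ∧
      ∀ c, (orbit A' w c).ker ≤ (orbit A v c).ker := by
  obtain ⟨a, m', ξ, hξ⟩ : ∃ (a : C) (m' : repOf M') (ξ : upperKer k A' a),
      ψ.app a (upperTensor.mk A' M' a m' ξ) ≠ 0 := by
    by_contra! h
    exact hψ (upperTensor.hom_ext h)
  obtain ⟨v, hv, hm⟩ := exists_coeff_fromQ_ne_zero hC hA hξ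
  obtain ⟨b, η, w, -, hη⟩ := exists_coeff_fromQ_eq_self hC hA
  have : Fintype (a ⟶ b) := @Fintype.ofFinite _ (hC a b).1
  have hcard : (Nat.card (orbit A v b).ker : k) ≠ 0 := card_addSubgroup_ne_zero _ (hC a b).2
  by_contra! hno
  have htwist : (twist v η.1 : A'.obj.obj a → _) = 0 := funext fun w => by
    obtain ⟨c, hc⟩ := hno a v w hv
    exact twist_eq_zero η.2 (hC a b).2 hc
  have hsum : ∑ f : a ⟶ b, η.1 (A.obj.map f v) •
      (Finsupp.lmapDomain k k (A'.obj.map f)).restrict (q := upperKer k A' b)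
        (upperKer_map k A' f) ξ = 0 := by
    refine Subtype.ext ?_
    rw [AddSubmonoidClass.coe_finsetSum]
    refine (sum_smul_mapDomain_eq_linearCombination_twist v η.1 ξ.1).trans ?_
    rw [htwist]
    simp
  have hmap (f : a ⟶ b) :
      η.1 (A.obj.map f v) • (Q A M).map f (ψ.app a (upperTensor.mk A' M' a m' ξ)) =
        ψ.app b (upperTensor.mk A' M' b m' (η.1 (A.obj.map f v) •
          (Finsupp.lmapDomain k k (A'.obj.map f)).restrict (upperKer_map k A' f) ξ)) := by
    rw [← NatTrans.naturality_apply, upperTensor.map_mk, map_smul, map_smul]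
  have hzero := sum_smul_map_Q hC hv η (ψ.app a (upperTensor.mk A' M' a m' ξ))
  rw [Finset.sum_congr rfl fun f _ => hmap f, ← map_sum, ← map_sum, hsum, map_zero, map_zero,
    eq_comm, smul_eq_zero_iff_right hcard] at hzero
  refine hm ((hη M _).symm.trans ?_)
  rw [hzero, map_zero, map_zero]

theorem nonempty_iso_of_Q_iso (hA : IsGenCogen A) (hA' : IsGenCogen A') (hM : Simple M)
    (hM' : Simple M') (e : Q A' M' ≅ Q A M) : Nonempty (A ≅ A') := by
  have := simple_Q hC hA hM
  have hne : toQ A' M' ≫ e.hom ≠ 0 := fun h => toQ_ne_zero hC hA' hM' <| by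
    rw [← cancel_mono e.hom, h, zero_comp]
  have hne' : toQ A M ≫ e.inv ≠ 0 := fun h => toQ_ne_zero hC hA hM <| by
    rw [← cancel_mono e.inv, h, zero_comp]
  obtain ⟨a, v, w, hv, h⟩ := exists_ker_orbit_le hC hA hne
  obtain ⟨a', v', w', hv', h'⟩ := exists_ker_orbit_le hC hA' hne'
  have := hv.finite hC
  have := hv'.finite hC
  have hcard (c : C) : Nat.card (A'.obj.obj c) ≤ Nat.card (A.obj.obj c) :=
    Nat.card_le_card_of_injective _ (hv'.injective_orbit_surjInv h' c)
  exact ⟨(hv.exists_iso_of_card_le hcard h).choose⟩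

theorem exists_hom_eq_toQ (hA : IsGenCogen A) (ψ : upperTensor A M ⟶ Q A N) :
    ∃ φ : repOf M ⟶ repOf N, ∀ (b : C) (m : repOf M) (η : upperKer k A b),
      ψ.app b (upperTensor.mk A M b m η) =
        (toQ A N).app b (upperTensor.mk A N b (φ m) η) := by
  obtain ⟨c, η₀, v, hv, hcoeff⟩ := exists_coeff_fromQ_eq_self (k := k) hC hA
  let φ : repOf M →ₗ[k] repOf N := coeff N v ∘ₗ ((fromQ A N).app c).hom ∘ₗ (ψ.app c).hom ∘ₗ
    (upperTensor.mk A M c).flip η₀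
  have hφ (b : C) (m : repOf M) (η : upperKer k A b) : ψ.app b (upperTensor.mk A M b m η) =
      (toQ A N).app b (upperTensor.mk A N b (φ m) η) := by
    have : Fintype (c ⟶ b) := @Fintype.ofFinite _ (hC c b).1
    have hcard : (Nat.card (orbit A v b).ker : k) ≠ 0 := card_addSubgroup_ne_zero _ (hC c b).2
    have h := congrArg (ψ.app b)
      (sum_smul_map_upperTensor hC hv η (upperTensor.mk A M c m η₀))
    rw [← fromQ_toQ_apply, hcoeff] at h
    simp only [map_sum, map_smul, NatTrans.naturality_apply] at h
    rw [sum_smul_map_Q hC hv] at h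
    exact (smul_right_injective _ hcard h).symm
  refine ⟨Rep.ofHom (ρ := (repOf M).ρ) (σ := (repOf N).ρ)
    ⟨φ, fun g => LinearMap.ext fun m => ?_⟩, hφ⟩
  have hmk (m : repOf M) : (toQ A N).app c (upperTensor.mk A N c (φ ((repOf M).ρ g m)) η₀) =
      (toQ A N).app c (upperTensor.mk A N c ((repOf N).ρ g (φ m)) η₀) := by
    have hM := upperTensor.mk_rho g m (upperRho k A c g⁻¹ η₀)
    have hN := upperTensor.mk_rho g (φ m) (upperRho k A c g⁻¹ η₀)
    rw [Representation.self_inv_apply] at hM hN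
    rw [hN, ← hφ, ← hφ, hM]
  exact (hcoeff N _).symm.trans ((congrArg (fun y => coeff N v ((fromQ A N).app c y)) (hmk m)).trans
    (hcoeff N _))

theorem comp_eq_id_of_eq_toQ (hA : IsGenCogen A) (e : Q A M ≅ Q A N)
    {φ : repOf M ⟶ repOf N} {φ' : repOf N ⟶ repOf M}
    (hφ : ∀ (b : C) (m : repOf M) (η : upperKer k A b), (toQ A M ≫ e.hom).app b
      (upperTensor.mk A M b m η) = (toQ A N).app b (upperTensor.mk A N b (φ m) η))
    (hφ' : ∀ (b : C) (n : repOf N) (η : upperKer k A b), (toQ A N ≫ e.inv).app b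
      (upperTensor.mk A N b n η) = (toQ A M).app b (upperTensor.mk A M b (φ' n) η)) :
    φ ≫ φ' = 𝟙 _ := by
  obtain ⟨c, η, v, -, hcoeff⟩ := exists_coeff_fromQ_eq_self (k := k) hC hA
  ext m
  refine (hcoeff M _).symm.trans (Eq.trans (congrArg _ (congrArg _ ?_)) (hcoeff M m))
  calc (toQ A M).app c (upperTensor.mk A M c (φ' (φ m)) η)
      = e.inv.app c (e.hom.app c ((toQ A M).app c (upperTensor.mk A M c m η))) :=
        (hφ' c (φ m) η).symm.trans (congrArg (e.inv.app c) (hφ c m η).symm)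
    _ = (toQ A M).app c (upperTensor.mk A M c m η) :=
        ConcreteCategory.congr_hom (e.hom_inv_id_app c) _

theorem nonempty_iso_module_of_Q_iso (hA : IsGenCogen A) (e : Q A M ≅ Q A N) :
    Nonempty (M ≅ N) := by
  obtain ⟨φ, hφ⟩ := exists_hom_eq_toQ hC hA (toQ A M ≫ e.hom)
  obtain ⟨φ', hφ'⟩ := exists_hom_eq_toQ hC hA (toQ A N ≫ e.inv)
  exact ⟨Rep.ofModuleMonoidAlgebra.preimageIso
    ⟨φ, φ', comp_eq_id_of_eq_toQ hC hA e hφ hφ', comp_eq_id_of_eq_toQ hC hA e.symm hφ' hφ⟩⟩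

end KTrivial

end Q

/-! ### Parabolic differences -/

section ParabolicDifference

variable {k : Type v} [Field k] {C : Type u} [Category.{v} C] [Preadditive C]
  [HasBinaryBiproducts C]

/-- The projection `F(x ⊞ a) → δ̄_x F(a)`. -/
def deltaProj (x : C) (F : C ⥤ ModuleCat.{v} k) (a : C) :
    F.obj (x ⊞ a) →ₗ[k] (barDelta x F).obj a :=
  ((cokernel.π (toBarTau x F)).app a).hom ∘ₗ (coinvKer x F a).mkQ

variable {x a b : C} {F F' : C ⥤ ModuleCat.{v} k}

theorem deltaProj_surjective (x : C) (F : C ⥤ ModuleCat.{v} k) (a : C) :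
    Function.Surjective (deltaProj x F a) :=
  ((epi_iff_surjective (cokernel.π (toBarTau x F))).1 inferInstance a).comp
    (Submodule.mkQ_surjective _)

theorem deltaProj_map (f : a ⟶ b) (y : F.obj (x ⊞ a)) :
    (barDelta x F).map f (deltaProj x F a y) =
      deltaProj x F b (F.map (biprod.map (𝟙 x) f) y) :=
  (NatTrans.naturality_apply (cokernel.π (toBarTau x F)) f ((coinvKer x F a).mkQ y)).symm

theorem deltaProj_eq_zero_iff_exists {y : F.obj (x ⊞ a)} :
    deltaProj x F a y = 0 ↔ ∃ z : F.obj a, y - F.map biprod.inr z ∈ coinvKer x F a := by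
  have hexact := (ShortComplex.exact_cokernel (toBarTau x F)).map
    ((evaluation C (ModuleCat.{v} k)).obj a)
  rw [ShortComplex.moduleCat_exact_iff] at hexact
  constructor
  · intro h
    obtain ⟨z, hz⟩ := hexact ((coinvKer x F a).mkQ y) h
    exact ⟨z, (Submodule.Quotient.eq _).1 hz.symm⟩
  · rintro ⟨z, hz⟩
    have hy : (coinvKer x F a).mkQ y = (toBarTau x F).app a z :=
      (Submodule.Quotient.eq (coinvKer x F a)).2 hz
    have hcond := congr_app (cokernel.condition (toBarTau x F)) a
    change (cokernel.π (toBarTau x F)).app a ((coinvKer x F a).mkQ y) = 0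
    rw [hy]
    exact ConcreteCategory.congr_hom hcond z

theorem deltaProj_map_inr (z : F.obj a) :
    deltaProj x F a (F.map biprod.inr z) = 0 :=
  deltaProj_eq_zero_iff_exists.2 ⟨z, by rw [sub_self]; exact Submodule.zero_mem _⟩

theorem transvection_zero : transvection (0 : x ⟶ a) = 𝟙 (x ⊞ a) := by
  ext <;> simp [transvection]

theorem transvection_comp (u u' : x ⟶ a) :
    transvection u ≫ transvection u' = transvection (u + u') := by
  ext <;> simp [transvection, add_comm]

theorem inl_transvection (u : x ⟶ a) :
    (biprod.inl : x ⟶ x ⊞ a) ≫ transvection u = biprod.inl + u ≫ biprod.inr := by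
  ext <;> simp [transvection]

theorem inr_transvection (u : x ⟶ a) :
    (biprod.inr : a ⟶ x ⊞ a) ≫ transvection u = biprod.inr := by
  ext <;> simp [transvection]

/-- The action of the additive group `C(x, a)` on `F(x ⊞ a)` by transvections, whose coinvariants
are `τ̄_x F(a)`. -/
def transvectionRho (x : C) (F : C ⥤ ModuleCat.{v} k) (a : C) :
    Representation k (Multiplicative (x ⟶ a)) (F.obj (x ⊞ a)) where
  toFun u := (F.map (transvection u.toAdd)).hom
  map_one' := by
    ext y
    simp [transvection_zero]
  map_mul' u u' := by
    ext y
    simp [add_comm u.toAdd, ← transvection_comp]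

theorem deltaProj_transvection (u : x ⟶ a) (y : F.obj (x ⊞ a)) :
    deltaProj x F a (F.map (transvection u) y) = deltaProj x F a y := by
  rw [← sub_eq_zero, ← map_sub, deltaProj_eq_zero_iff_exists]
  refine ⟨0, ?_⟩
  rw [map_zero, sub_zero]
  exact Submodule.subset_span ⟨(u, y), rfl⟩

/-- The morphism `τ̄_x F ⟶ τ̄_x F'` induced by a morphism `F ⟶ F'`. -/
def barTauMap (x : C) (α : F ⟶ F') : barTau x F ⟶ barTau x F' where
  app a := ModuleCat.ofHom (Submodule.mapQ (coinvKer x F a) (coinvKer x F' a)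
    (α.app (x ⊞ a)).hom (by
      refine Submodule.span_le.2 ?_
      rintro _ ⟨⟨u, y⟩, rfl⟩
      refine Submodule.subset_span ⟨(u, α.app _ y), ?_⟩
      dsimp only
      rw [map_sub, NatTrans.naturality_apply]))
  naturality a b f := by
    ext y
    obtain ⟨y, rfl⟩ := (coinvKer x F a).mkQ_surjective y
    exact congrArg (coinvKer x F' b).mkQ (NatTrans.naturality_apply α (biprod.map (𝟙 x) f) y)

theorem toBarTau_naturality (x : C) (α : F ⟶ F') :
    toBarTau x F ≫ barTauMap x α = α ≫ toBarTau x F' := by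
  ext a y
  exact congrArg (coinvKer x F' a).mkQ (NatTrans.naturality_apply α biprod.inr y)

/-- The morphism `δ̄_x F ⟶ δ̄_x F'` induced by a morphism `F ⟶ F'`. -/
def barDeltaMap (x : C) (α : F ⟶ F') : barDelta x F ⟶ barDelta x F' :=
  cokernel.map (toBarTau x F) (toBarTau x F') α (barTauMap x α) (toBarTau_naturality x α)

theorem barDeltaMap_deltaProj (α : F ⟶ F') (y : F.obj (x ⊞ a)) :
    (barDeltaMap x α).app a (deltaProj x F a y) = deltaProj x F' a (α.app (x ⊞ a) y) := by
  have h : cokernel.π (toBarTau x F) ≫ barDeltaMap x α =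
      barTauMap x α ≫ cokernel.π (toBarTau x F') := cokernel.π_desc _ _ _
  exact ConcreteCategory.congr_hom (congr_app h a) ((coinvKer x F a).mkQ y)

section Norm

variable [Fintype (x ⟶ a)]

theorem norm_transvectionRho_apply (y : F.obj (x ⊞ a)) :
    (transvectionRho x F a).norm y = ∑ u : x ⟶ a, F.map (transvection u) y := by
  rw [Representation.norm, LinearMap.sum_apply]
  exact Fintype.sum_equiv Multiplicative.toAdd _ _ fun _ => rfl

theorem norm_transvectionRho_naturality (α : F ⟶ F') (y : F.obj (x ⊞ a)) :
    α.app (x ⊞ a) ((transvectionRho x F a).norm y) =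
      (transvectionRho x F' a).norm (α.app (x ⊞ a) y) := by
  rw [norm_transvectionRho_apply, norm_transvectionRho_apply, map_sum]
  exact Finset.sum_congr rfl fun u _ => NatTrans.naturality_apply α (transvection u) y

theorem norm_transvectionRho_map_inr (z : F.obj a) :
    (transvectionRho x F a).norm (F.map biprod.inr z) =
      (Nat.card (x ⟶ a) : k) • F.map biprod.inr z := by
  simp only [norm_transvectionRho_apply, ← Functor.map_comp_apply, inr_transvection,
    Finset.sum_const, Finset.card_univ, Nat.card_eq_fintype_card, Nat.cast_smul_eq_nsmul]

theorem deltaProj_norm (y : F.obj (x ⊞ a)) :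
    deltaProj x F a ((transvectionRho x F a).norm y) =
      (Nat.card (x ⟶ a) : k) • deltaProj x F a y := by
  simp only [norm_transvectionRho_apply, map_sum, deltaProj_transvection, Finset.sum_const,
    Finset.card_univ, Nat.card_eq_fintype_card, Nat.cast_smul_eq_nsmul]

/- As the order of `C(x, a)` is invertible, the coinvariants `τ̄_x F(a)` are identified by the norm
with the invariants, in which `F(a)` is the image of the idempotent `snd ≫ inr`. -/
theorem deltaProj_eq_zero_iff (hcard : (Nat.card (x ⟶ a) : k) ≠ 0) {y : F.obj (x ⊞ a)} :
    deltaProj x F a y = 0 ↔ F.map (biprod.snd ≫ biprod.inr) ((transvectionRho x F a).norm y) =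
      (transvectionRho x F a).norm y := by
  constructor
  · rw [deltaProj_eq_zero_iff_exists]
    rintro ⟨z, hz⟩
    have hnorm := norm_eq_zero_of_mem_coinvariantsKer (transvectionRho x F a) hz
    rw [map_sub, norm_transvectionRho_map_inr, sub_eq_zero] at hnorm
    rw [hnorm, map_smul, ← Functor.map_comp_apply, biprod.inr_snd_assoc]
  · intro h
    have hzero := deltaProj_map_inr (x := x) (F.map biprod.snd ((transvectionRho x F a).norm y))
    rw [← Functor.map_comp_apply, h, deltaProj_norm] at hzero
    exact (smul_eq_zero.1 hzero).resolve_left hcard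

end Norm

theorem mono_barDeltaMap (hC : IsKTrivial k C) (x : C) (α : F ⟶ F') [Mono α] :
    Mono (barDeltaMap x α) := by
  rw [mono_iff_injective]
  refine fun a => (injective_iff_map_eq_zero ((barDeltaMap x α).app a).hom).2 fun z hz => ?_
  have : Fintype (x ⟶ a) := @Fintype.ofFinite _ (hC x a).1
  obtain ⟨y, rfl⟩ := deltaProj_surjective x F a z
  have hy : deltaProj x F' a (α.app (x ⊞ a) y) = 0 := (barDeltaMap_deltaProj α y).symm.trans hz
  rw [deltaProj_eq_zero_iff (hC x a).2, ← norm_transvectionRho_naturality,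
    ← NatTrans.naturality_apply] at hy
  exact (deltaProj_eq_zero_iff (hC x a).2).2
    ((mono_iff_injective α).1 inferInstance _ hy)

theorem exists_mono_foldr_barDelta (hC : IsKTrivial k C) (α : F ⟶ F') [Mono α] (l : List C) :
    ∃ β : l.foldr barDelta F ⟶ l.foldr barDelta F', Mono β := by
  induction l with
  | nil => exact ⟨α, ‹Mono α›⟩
  | cons x l ih =>
    obtain ⟨β, hβ⟩ := ih
    exact ⟨barDeltaMap x β, mono_barDeltaMap hC x β⟩

theorem Fd_of_mono (hC : IsKTrivial k C) {d : ℕ} (α : F ⟶ F') [Mono α] (h : Fd k C d F') :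
    Fd k C d F := by
  intro l x hl
  let τα : tau x F ⟶ tau x F' := Functor.whiskerLeft (biprodLeft x) α
  have : Mono τα := (mono_iff_injective _).2 fun a => (mono_iff_injective α).1 inferInstance _
  obtain ⟨β, hβ⟩ := exists_mono_foldr_barDelta hC τα l
  exact IsZero.of_mono β (h l x hl)

end ParabolicDifference

/-! ### Natural families and polynomial degree -/

section NatFamily

variable {k : Type v} [Field k] {C : Type u} [Category.{v} C] [Preadditive C]

/-- A natural family of maps of sets `A(a) → F(a)`, i.e. a morphism `k[A] ⟶ F`. -/
structure NatFamily (A : AddRep C) (F : C ⥤ ModuleCat.{v} k) where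
  app : ∀ a : C, A.obj.obj a → F.obj a
  naturality : ∀ {a b : C} (f : a ⟶ b) (w : A.obj.obj a),
    F.map f (app a w) = app b (A.obj.map f w)

/-- `F` is generated by morphisms `k[A] ⟶ F` with `A` of length at most `n`. -/
def IsGenByLength (F : C ⥤ ModuleCat.{v} k) (n : ℕ) : Prop :=
  ∀ a : C, Submodule.span k {y : F.obj a | ∃ A : AddRep C, LengthLE A n ∧
    ∃ (φ : NatFamily A F) (w : A.obj.obj a), φ.app a w = y} = ⊤

variable {A : AddRep C} {F : C ⥤ ModuleCat.{v} k} {n : ℕ}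

theorem isGenByLength_lowerTensor (hA : LengthLE A n)
    (M : ModuleCat.{v} (MonoidAlgebra k (Aut A))) : IsGenByLength (lowerTensor A M) n := by
  refine fun a => Submodule.eq_top_iff'.2 fun t => ?_
  induction t using lowerTensor.induction with
  | zero => exact Submodule.zero_mem _
  | add s t hs ht => exact Submodule.add_mem _ hs ht
  | mk_single m x r =>
    let φ : NatFamily A (lowerTensor A M) :=
      { app := fun a x => lowerTensor.mk A M a m (Finsupp.single x 1)
        naturality := fun f x => by rw [lowerTensor.map_mk, Finsupp.mapDomain_single] }
    rw [← mul_one r, ← smul_eq_mul, ← Finsupp.smul_single, map_smul]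
    exact Submodule.smul_mem _ _ (Submodule.subset_span ⟨A, hA, φ, x, rfl⟩)

namespace NatFamily

theorem map_linearCombination (φ : NatFamily A F) {a b : C} (f : a ⟶ b) (ξ : A.obj.obj a →₀ k) :
    F.map f (Finsupp.linearCombination k (φ.app a) ξ) =
      Finsupp.linearCombination k (φ.app b) (ξ.mapDomain (A.obj.map f)) := by
  induction ξ using Finsupp.induction_linear with
  | zero => simp
  | add ξ ζ hξ hζ => rw [Finsupp.mapDomain_add, map_add, map_add, map_add, hξ, hζ]
  | single w r => simp [Finsupp.mapDomain_single, φ.naturality]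

end NatFamily

variable [HasBinaryBiproducts C] {x a b : C}

namespace AddRep

theorem pair_map_fst_map_snd (ω : A.obj.obj (x ⊞ a)) :
    A.pair (A.obj.map biprod.fst ω) (A.obj.map biprod.snd ω) = ω := by
  rw [pair, ← Functor.map_comp_apply, ← Functor.map_comp_apply, ← map_add_apply, biprod.total,
    Functor.map_id_apply]

theorem map_biprodMap_pair (f : a ⟶ b) (v : A.obj.obj x) (w : A.obj.obj a) :
    A.obj.map (biprod.map (𝟙 x) f) (A.pair v w) = A.pair v (A.obj.map f w) := by
  rw [pair, pair, map_add, ← Functor.map_comp_apply, ← Functor.map_comp_apply,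
    ← Functor.map_comp_apply, biprod.inl_map, biprod.inr_map, Category.id_comp]

theorem map_transvection_pair (u : x ⟶ a) (v : A.obj.obj x) (w : A.obj.obj a) :
    A.obj.map (transvection u) (A.pair v w) = A.pair v (A.obj.map u v + w) := by
  rw [pair, pair, map_add, ← Functor.map_comp_apply, ← Functor.map_comp_apply, inl_transvection,
    inr_transvection, map_add_apply, Functor.map_comp_apply, map_add, add_assoc]

theorem linearCombination_mapDomain_pair_apply (η : A.obj.obj x →₀ k) (ζ : A.obj.obj a →₀ k)
    (v : A.obj.obj x) (w : A.obj.obj a) :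
    Finsupp.linearCombination k (fun w' => η.mapDomain (A.pair · w')) ζ (A.pair v w) =
      ζ w * η v := by
  induction ζ using Finsupp.induction_linear with
  | zero => simp
  | add ζ ζ' h h' => rw [map_add, Finsupp.add_apply, h, h', Finsupp.add_apply, add_mul]
  | single w' r =>
    rw [Finsupp.linearCombination_single, Finsupp.smul_apply, smul_eq_mul]
    by_cases hw : w' = w
    · rw [hw, Finsupp.single_eq_same, Finsupp.mapDomain_apply (pair_left_injective w)]
    · rw [Finsupp.single_eq_of_ne' hw, zero_mul, Finsupp.mapDomain_of_notMem_range, mul_zero]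
      rintro ⟨v', hv'⟩
      exact hw (by simpa using congrArg (A.obj.map biprod.snd) hv')

theorem mapDomain_sum_transvection [Fintype (x ⟶ a)] (v : A.obj.obj x)
    (ζ : (SubRep.span v).quot.obj.obj a →₀ k) :
    (∑ u : x ⟶ a, (ζ.mapDomain fun q => A.pair v
      (Function.surjInv ((SubRep.span v).cls_surjective a) q)).mapDomain
        (A.obj.map (transvection u))).mapDomain
      (fun ω => (A.obj.map biprod.fst ω, (SubRep.span v).cls a (A.obj.map biprod.snd ω))) =
    (Nat.card (x ⟶ a) : k) • ζ.mapDomain (Prod.mk v) := by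
  have hcls (u : x ⟶ a) : (SubRep.span v).cls a (A.obj.map u v) = 0 :=
    SubRep.cls_eq_zero.2 (SubRep.mem_span.2 ⟨u, rfl⟩)
  simp only [Finsupp.mapDomain_finsetSum, ← Finsupp.mapDomain_comp, Function.comp_def,
    map_transvection_pair, map_fst_pair, map_snd_pair, map_add, hcls, zero_add,
    Function.surjInv_eq ((SubRep.span v).cls_surjective a), Finset.sum_const, Finset.card_univ,
    Nat.card_eq_fintype_card, Nat.cast_smul_eq_nsmul]

end AddRep

namespace NatFamily

variable (φ : NatFamily A F)

/-- The natural family `w ↦ φ(v, w)` with values in the shift `τ_x F`. -/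
def shift (v : A.obj.obj x) : NatFamily A (tau x F) where
  app a w := φ.app (x ⊞ a) (A.pair v w)
  naturality f w := (φ.naturality (biprod.map (𝟙 x) f) _).trans
    (congrArg (φ.app _) (AddRep.map_biprodMap_pair f v w))

theorem deltaProj_app_eq {v : A.obj.obj x} {w w' : A.obj.obj a}
    (h : (SubRep.span v).cls a w = (SubRep.span v).cls a w') :
    deltaProj x F a (φ.app (x ⊞ a) (A.pair v w)) =
      deltaProj x F a (φ.app (x ⊞ a) (A.pair v w')) := by
  obtain ⟨u, hu⟩ := SubRep.cls_eq_cls.1 h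
  rw [orbit_apply] at hu
  rw [← deltaProj_transvection u (φ.app (x ⊞ a) (A.pair v w')), φ.naturality,
    AddRep.map_transvection_pair, hu, sub_add_cancel]

/-- The natural family `w ↦ φ(v, w)` with values in `δ̄_x F`; it depends only on the class of `w`
modulo the subfunctor generated by `v`. -/
def delta (v : A.obj.obj x) : NatFamily (SubRep.span v).quot (barDelta x F) where
  app a q := deltaProj x F a (φ.app (x ⊞ a)
    (A.pair v (Function.surjInv ((SubRep.span v).cls_surjective a) q)))
  naturality f q := by
    rw [deltaProj_map, φ.naturality, AddRep.map_biprodMap_pair]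
    refine φ.deltaProj_app_eq ?_
    rw [Function.surjInv_eq ((SubRep.span v).cls_surjective _), ← SubRep.quot_map,
      Function.surjInv_eq ((SubRep.span v).cls_surjective _)]

theorem delta_app_cls (v : A.obj.obj x) (w : A.obj.obj a) :
    (φ.delta v).app a ((SubRep.span v).cls a w) =
      deltaProj x F a (φ.app (x ⊞ a) (A.pair v w)) :=
  φ.deltaProj_app_eq (Function.surjInv_eq _ _)

theorem norm_transvectionRho_linearCombination [Fintype (x ⟶ a)] (ξ : A.obj.obj (x ⊞ a) →₀ k) :
    (transvectionRho x F a).norm (Finsupp.linearCombination k (φ.app _) ξ) =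
      Finsupp.linearCombination k (φ.app _)
        (∑ u : x ⟶ a, ξ.mapDomain (A.obj.map (transvection u))) := by
  simp only [norm_transvectionRho_apply, φ.map_linearCombination, map_sum]

theorem linearIndependent_delta (hC : IsKTrivial k C) (hφ : ∀ a, LinearIndependent k (φ.app a))
    {v : A.obj.obj x} (hv : v ≠ 0) (a : C) : LinearIndependent k ((φ.delta v).app a) := by
  have : Fintype (x ⟶ a) := @Fintype.ofFinite _ (hC x a).1
  rw [linearIndependent_iff]
  intro ζ hζ
  let lift := Function.surjInv ((SubRep.span v).cls_surjective a)
  let E := ∑ u : x ⟶ a, (ζ.mapDomain (A.pair v <| lift ·)).mapDomain (A.obj.map (transvection u))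
  have hE : E.mapDomain (A.obj.map (biprod.snd ≫ biprod.inr)) = E := by
    have hzero : deltaProj x F a (Finsupp.linearCombination k (φ.app _)
        (ζ.mapDomain (A.pair v <| lift ·))) = 0 := by
      rw [Finsupp.linearCombination_mapDomain, Finsupp.apply_linearCombination]
      exact hζ
    rw [deltaProj_eq_zero_iff (hC x a).2, norm_transvectionRho_linearCombination,
      map_linearCombination] at hzero
    exact hφ _ hzero
  let θ (ω : A.obj.obj (x ⊞ a)) := (A.obj.map biprod.fst ω,
    (SubRep.span v).cls a (A.obj.map biprod.snd ω))
  have hθ : E.mapDomain θ = (Nat.card (x ⟶ a) : k) • ζ.mapDomain (Prod.mk v) :=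
    AddRep.mapDomain_sum_transvection v ζ
  ext q
  have hq : (E.mapDomain θ) (v, q) = 0 := by
    rw [← hE, ← Finsupp.mapDomain_comp]
    refine Finsupp.mapDomain_of_notMem_range _ _ ?_
    rintro ⟨ω, hω⟩
    refine hv (Eq.trans (congrArg Prod.fst hω).symm ?_)
    simp only [θ, Function.comp_apply, ← Functor.map_comp_apply, Category.assoc, biprod.inr_fst,
      comp_zero, AddRep.map_zero_apply]
  rw [hθ, Finsupp.smul_apply, Finsupp.mapDomain_apply (Prod.mk_right_injective v)] at hq
  exact (smul_eq_zero.1 hq).resolve_left (hC x a).2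

end NatFamily

namespace IsGenByLength

theorem tau (h : IsGenByLength F n) (x : C) : IsGenByLength (tau x F) n := by
  refine fun a => top_unique ((h (x ⊞ a)).symm.le.trans (Submodule.span_mono ?_))
  rintro _ ⟨A, hA, φ, ω, rfl⟩
  exact ⟨A, hA, φ.shift (A.obj.map biprod.fst ω), A.obj.map biprod.snd ω,
    congrArg (φ.app (x ⊞ a)) (AddRep.pair_map_fst_map_snd ω)⟩

theorem mem_of_delta_mem (h : IsGenByLength F n) {p : Submodule k ((barDelta x F).obj a)}
    (hp : ∀ A : AddRep C, LengthLE A n → ∀ (φ : NatFamily A F) (v : A.obj.obj x), v ≠ 0 →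
      ∀ w : A.obj.obj a, (φ.delta v).app a ((SubRep.span v).cls a w) ∈ p)
    (y : (barDelta x F).obj a) : y ∈ p := by
  obtain ⟨y, rfl⟩ := deltaProj_surjective x F a y
  refine (Submodule.span_le (p := p.comap (deltaProj x F a))).2 ?_
    ((h (x ⊞ a)).symm.le (Submodule.mem_top (x := y)))
  rintro _ ⟨A, hA, φ, ω, rfl⟩
  rw [SetLike.mem_coe, Submodule.mem_comap, ← AddRep.pair_map_fst_map_snd ω]
  by_cases hv : A.obj.map biprod.fst ω = 0
  · rw [hv, AddRep.pair, map_zero, zero_add, ← φ.naturality, deltaProj_map_inr]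
    exact Submodule.zero_mem _
  · rw [← NatFamily.delta_app_cls]
    exact hp A hA φ _ hv _

theorem barDelta (h : IsGenByLength F (n + 1)) (x : C) : IsGenByLength (barDelta x F) n :=
  fun _ => Submodule.eq_top_iff'.2 <| h.mem_of_delta_mem fun _ hA φ v hv _ =>
    Submodule.subset_span ⟨_, hA.quot_succ (mt SubRep.span_eq_bot.1 hv), φ.delta v, _, rfl⟩

theorem isZero_barDelta (h : IsGenByLength F 0) (x : C) : IsZero (AntiPoly.barDelta x F) :=
  isZero_of_forall_eq_zero fun _ y => (Submodule.mem_bot k).1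
    (h.mem_of_delta_mem (fun _ hA _ v hv => absurd (hA.eq_zero v) hv) y)

theorem foldr_barDelta (l : List C) (h : IsGenByLength F (l.length + n)) :
    IsGenByLength (l.foldr AntiPoly.barDelta F) n := by
  induction l generalizing n with
  | nil => simpa using h
  | cons x l ih => exact (ih (by simpa [add_assoc, add_comm 1] using h)).barDelta x

theorem Fd (h : IsGenByLength F n) : Fd k C n F
  | y :: l, x, hl =>
    isZero_barDelta (foldr_barDelta l (by simpa [Nat.succ_inj.1 hl] using h.tau x)) y

end IsGenByLength

theorem Fd_Q (hC : IsKTrivial k C) (hA : LengthLE A n)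
    (M : ModuleCat.{v} (MonoidAlgebra k (Aut A))) : Fd k C n (Q A M) :=
  Fd_of_mono hC (fromQ A M) (isGenByLength_lowerTensor hA M).Fd

theorem lengthLE_of_isZero_foldr_barDelta (hC : IsKTrivial k C) (φ : NatFamily A F)
    (hφ : ∀ a, LinearIndependent k (φ.app a))
    (h : ∀ l : List C, l.length = n + 1 → IsZero (l.foldr barDelta F)) : LengthLE A n := by
  induction n generalizing A F with
  | zero =>
    refine .of_quot_span fun x v hv => absurd ?_ ((φ.linearIndependent_delta hC hφ hv x).ne_zero 0)
    have : Subsingleton ((barDelta x F).obj x) :=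
      ModuleCat.subsingleton_of_isZero ((Functor.isZero_iff _).1 (h [x] rfl) x)
    exact Subsingleton.elim _ _
  | succ n ih =>
    refine .of_quot_span fun x v hv => ⟨n, n.lt_succ_self,
      ih (φ.delta v) (φ.linearIndependent_delta hC hφ hv) fun l hl => ?_⟩
    simpa using h (l ++ [x]) (by simp [hl])

theorem exists_natFamily_tau_Q (hC : IsKTrivial k C) (hA : IsGenCogen A)
    {M : ModuleCat.{v} (MonoidAlgebra k (Aut A))} (hM : Simple M) :
    ∃ (c : C) (φ : NatFamily A (tau c (Q A M))), ∀ a, LinearIndependent k (φ.app a) := by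
  obtain ⟨⟨a, w, hw⟩, b, hb⟩ := hA
  have hfin := hw.finite hC
  have := (simple_iff_isSimpleModule' M).1 hM
  have := IsSimpleModule.nontrivial (MonoidAlgebra k (Aut A)) M
  obtain ⟨m, hm⟩ : ∃ m : repOf M, m ≠ 0 := exists_ne (0 : M)
  obtain ⟨c, f, η, hη, hne, hf⟩ := hb.exists_mem_upperKer_forall_map_eq k w
  obtain ⟨y₀, hy₀⟩ := Finsupp.support_nonempty_iff.2 hne
  let φ : NatFamily A (tau c (Q A M)) :=
    { app e u := (toQ A M).app _ (upperTensor.mk A M (c ⊞ e) m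
        ⟨η.mapDomain (A.pair · u), mapDomain_pair_mem_upperKer u hη⟩)
      naturality {e e'} g u := by
        refine (NatTrans.naturality_apply (toQ A M) (biprod.map (𝟙 _) g) _).symm.trans ?_
        rw [upperTensor.map_mk]
        congr 2
        refine Subtype.ext ?_
        change (η.mapDomain (A.pair · u)).mapDomain (A.obj.map (biprod.map (𝟙 c) g)) =
          η.mapDomain (A.pair · (A.obj.map g u))
        simp only [← Finsupp.mapDomain_comp, Function.comp_def, AddRep.map_biprodMap_pair] }
  refine ⟨c, φ, fun e => linearIndependent_iff.2 fun ζ hζ => ?_⟩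
  let Z := Finsupp.linearCombination k (fun u : A.obj.obj e => η.mapDomain (A.pair · u)) ζ
  have hZ (y : A.obj.obj c) (u : A.obj.obj e) : Z (A.pair y u) = ζ u * η y :=
    AddRep.linearCombination_mapDomain_pair_apply η ζ y u
  have hsupp (s) (hs : s ∈ Z.support) : A.obj.map (biprod.fst ≫ f) s = w := by
    rw [Finsupp.mem_support_iff, ← AddRep.pair_map_fst_map_snd s, hZ] at hs
    rw [Functor.map_comp_apply]
    exact hf _ (Finsupp.mem_support_iff.2 (right_ne_zero_of_mul hs))
  have hfrom : lowerTensor.mk A M (c ⊞ e) m Z = 0 := by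
    refine (Finsupp.apply_linearCombination ..).trans (Eq.trans ?_
      ((Finsupp.apply_linearCombination k ((fromQ A M).app (c ⊞ e)).hom (φ.app e) ζ).symm.trans
        ((congrArg _ hζ).trans (map_zero _))))
    congr 2
    funext u
    exact (fromQ_toQ_apply (upperTensor.mk A M (c ⊞ e) m
      ⟨η.mapDomain (A.pair · u), mapDomain_pair_mem_upperKer u hη⟩)).symm
  ext u
  have hcoeff := coeff_mk_of_forall_map_eq (v := A.pair y₀ u) (biprod.fst ≫ f) hw
    (by rw [Functor.map_comp_apply, AddRep.map_fst_pair, hf y₀ hy₀]) m hsupp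
  rw [hfrom, map_zero, hZ] at hcoeff
  exact (mul_eq_zero.1 ((smul_eq_zero.1 hcoeff.symm).resolve_right hm)).resolve_right
    (Finsupp.mem_support_iff.1 hy₀)

theorem lengthLE_of_Fd (hC : IsKTrivial k C) (hA : IsGenCogen A)
    {M : ModuleCat.{v} (MonoidAlgebra k (Aut A))} (hM : Simple M) (h : Fd k C n (Q A M)) :
    LengthLE A n := by
  obtain ⟨c, φ, hφ⟩ := exists_natFamily_tau_Q hC hA hM
  exact lengthLE_of_isZero_foldr_barDelta hC φ hφ fun l hl => h l c hl

end NatFamily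

/-! ### Subfunctors of functors to `k`-vector spaces -/

section SubFunctor

variable {k : Type v} [Field k] {C : Type u} [Category.{v} C] {F S : C ⥤ ModuleCat.{v} k}

/-- A subfunctor of a functor to `k`-vector spaces. -/
@[ext]
structure SubFunctor (F : C ⥤ ModuleCat.{v} k) where
  obj : ∀ a : C, Submodule k (F.obj a)
  map_mem : ∀ {a b : C} (f : a ⟶ b) {x : F.obj a}, x ∈ obj a → F.map f x ∈ obj b

namespace SubFunctor

variable (T T' : SubFunctor F)

/-- A subfunctor, as a functor. -/
def toFunctor : C ⥤ ModuleCat.{v} k where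
  obj a := ModuleCat.of k (T.obj a)
  map f := ModuleCat.ofHom ((F.map f).hom.restrict fun _ => T.map_mem f)
  map_id a := by
    ext x : 2
    exact Subtype.ext (F.map_id_apply a x.1)
  map_comp f g := by
    ext x : 2
    exact Subtype.ext (F.map_comp_apply f g x.1)

/-- The inclusion of a subfunctor. -/
def ι : T.toFunctor ⟶ F where
  app a := ModuleCat.ofHom (T.obj a).subtype

variable {T T'}

/-- The inclusion of a subfunctor in a larger one. -/
def homOfLE (h : ∀ a, T.obj a ≤ T'.obj a) : T.toFunctor ⟶ T'.toFunctor where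
  app a := ModuleCat.ofHom (Submodule.inclusion (h a))

theorem eq_zero_of_simple (hS : Simple S) (T : SubFunctor S) {a b : C} {x : S.obj a}
    (hx : x ∉ T.obj a) {y : S.obj b} (hy : y ∈ T.obj b) : y = 0 := by
  have : Mono T.ι := (mono_iff_injective _).2 fun a => (T.obj a).subtype_injective
  have hι : T.ι = 0 := by
    by_contra h
    have := isIso_of_mono_of_nonzero h
    obtain ⟨z, rfl⟩ := (epi_iff_surjective T.ι).1 inferInstance a x
    exact hx z.2
  exact congr($(hι).app b ⟨y, hy⟩)

end SubFunctor

theorem exists_map_ne_zero (hS : Simple S) {a b : C} (x : S.obj b) (hx : x ≠ 0) {y : S.obj a}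
    (hy : y ≠ 0) : ∃ f : a ⟶ b, S.map f y ≠ 0 := by
  let T : SubFunctor S :=
    { obj := fun c => ⨅ f : c ⟶ b, LinearMap.ker (S.map f).hom
      map_mem := fun g z hz => by
        simp only [Submodule.mem_iInf, LinearMap.mem_ker] at hz ⊢
        exact fun f => (S.map_comp_apply g f z).symm.trans (hz (g ≫ f)) }
  by_contra! h
  refine hy (T.eq_zero_of_simple hS (x := x) (fun hT => hx ?_) ((Submodule.mem_iInf _).2 h))
  exact (S.map_id_apply b x).symm.trans ((Submodule.mem_iInf _).1 hT (𝟙 b))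

end SubFunctor

/-! ### Every simple functor receives a nonzero morphism from some `Q^A` -/

section Upper

theorem IsGen.card_ne_zero {k : Type v} [Field k] {C : Type u} [Category.{v} C] [Preadditive C]
    (hC : IsKTrivial k C) {A : AddRep C} {a : C} {v : A.obj.obj a} (hv : IsGen A v) (c : C) :
    (Nat.card (A.obj.obj c) : k) ≠ 0 := by
  obtain ⟨m, hm⟩ := AddSubgroup.card_dvd_of_surjective _ (hv c)
  have h := (hC a c).2
  rw [hm, Nat.cast_mul] at h
  exact left_ne_zero_of_mul h

variable (k : Type v) [Field k] {C : Type u} [Category.{v} C] [Preadditive C]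

/-- The functor `k[A]`, without its action of `Aut A`. -/
abbrev linearization (A : AddRep C) : C ⥤ ModuleCat.{v} k where
  obj a := ModuleCat.of k (A.obj.obj a →₀ k)
  map f := ModuleCat.ofHom (Finsupp.lmapDomain k k (A.obj.map f))
  map_id a := congr(ModuleCat.ofHom $(LinearMap.ext fun ξ => by simp))
  map_comp f g := by
    ext : 4
    simp

/-- The functor `Q^A`, without its action of `Aut A`. -/
def upper (A : AddRep C) : SubFunctor (linearization k A) where
  obj := upperKer k A
  map_mem f _ hξ := upperKer_map k A f hξ

/-- The value at `c` of the kernel of `k[A] ⟶ ∏ k[A/⟨n⟩]`, where `n` runs over `N`. -/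
def spanKer {A : AddRep C} {a : C} (N : Set (A.obj.obj a)) (c : C) :
    Submodule k (A.obj.obj c →₀ k) :=
  ⨅ n ∈ N, cosetKer k ((SubRep.span n).obj c)

variable {k} {A : AddRep C} {a c : C} {N : Set (A.obj.obj a)}

theorem mem_spanKer {ξ : A.obj.obj c →₀ k} :
    ξ ∈ spanKer k N c ↔ ∀ n ∈ N, ξ ∈ cosetKer k ((SubRep.span n).obj c) := by
  simp only [spanKer, Submodule.mem_iInf]

variable (k N) in
/-- The kernel of `k[A] ⟶ ∏ k[A/⟨n⟩]`, where `n` runs over `N`. It interpolates between `k[A]`,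
for `N` empty, and `Q^A`, when `N` meets all nonzero subfunctors of `A` but does not contain `0`. -/
def spanKerFunctor : SubFunctor (linearization k A) where
  obj := spanKer k N
  map_mem f _ hξ := mem_spanKer.2 fun n hn => mapDomain_mem_cosetKer (A.obj.map f)
    (fun y z hyz => by rw [← map_sub]; exact (SubRep.span n).map_mem f _ hyz)
    (mem_spanKer.1 hξ n hn)

theorem spanKer_eq_upperKer (ha : IsCogen A a) (hN : ∀ n, n ∈ N ↔ n ≠ 0) :
    spanKer k N c = upperKer k A c := by
  ext ξ
  rw [mem_spanKer, mem_upperKer]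
  refine ⟨fun h B hB => ?_, fun h n hn => h _ fun hbot => (hN n).1 hn (SubRep.span_eq_bot.1 hbot)⟩
  obtain ⟨d, x, hx, hx0⟩ : ∃ d, ∃ x ∈ B.obj d, x ≠ 0 := by
    by_contra! h0
    exact hB (SubRep.eq_bot_iff_forall.2 h0)
  obtain ⟨f, hf⟩ : ∃ f : d ⟶ a, A.obj.map f x ≠ 0 := by
    by_contra! h0
    exact hx0 (ha d x h0)
  exact cosetKer_mono (SubRep.span_le.2 (B.map_mem f x hx) c) (h _ ((hN _).2 hf))

section Quot

variable (B : SubRep A)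

theorem mapDomain_cls_mem_spanKer {ξ : A.obj.obj c →₀ k} (hξ : ξ ∈ spanKer k N c) :
    ξ.mapDomain (B.cls c) ∈ spanKer k (B.cls a '' N) c := by
  rw [mem_spanKer, Set.forall_mem_image]
  intro n hn
  refine mapDomain_mem_cosetKer (B.cls c) ?_ (mem_spanKer.1 hξ n hn)
  rintro y z ⟨f, hf⟩
  exact ⟨f, by rw [← map_sub, ← hf]; rfl⟩

theorem sub_mem_cosetKer_iff {B : SubRep A} {ξ ζ : A.obj.obj c →₀ k} :
    ξ - ζ ∈ cosetKer k (B.obj c) ↔ ξ.mapDomain (B.cls c) = ζ.mapDomain (B.cls c) := by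
  rw [← sub_eq_zero, ← Finsupp.mapDomain_sub]
  exact mem_cosetKer

variable [Fintype (B.obj c)]

variable (k c) in
/-- A section of the projection `k[A(c)] → k[(A/B)(c)]` when the order of `B(c)` is invertible in
`k`; averaging over `B(c)` makes it preserve the subspaces `spanKer`. -/
def averageLift : (B.quot.obj.obj c →₀ k) →ₗ[k] (A.obj.obj c →₀ k) :=
  cosetAverage k (B.obj c) ∘ₗ Finsupp.lmapDomain k k (Function.surjInv (B.cls_surjective c))

theorem averageLift_mem_spanKer {ξ : B.quot.obj.obj c →₀ k}
    (hξ : ξ ∈ spanKer k (B.cls a '' N) c) : averageLift k c B ξ ∈ spanKer k N c := by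
  refine mem_spanKer.2 fun n hn => cosetAverage_mem_cosetKer (mapDomain_mem_cosetKer _ ?_
    (mem_spanKer.1 hξ _ (Set.mem_image_of_mem _ hn)))
  rintro y z ⟨f, hf⟩
  refine AddSubgroup.mem_sup.2 ⟨A.obj.map f n, ⟨f, rfl⟩, _, SubRep.cls_eq_cls.1 ?_,
    add_sub_cancel _ _⟩
  rw [map_sub, Function.surjInv_eq (B.cls_surjective c), Function.surjInv_eq (B.cls_surjective c),
    ← hf]
  rfl

theorem mapDomain_cls_averageLift (hB : (Nat.card (B.obj c) : k) ≠ 0)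
    (ξ : B.quot.obj.obj c →₀ k) : (averageLift k c B ξ).mapDomain (B.cls c) = ξ := by
  have h := cosetAverage_sub_mem_cosetKer hB (ξ.mapDomain (Function.surjInv (B.cls_surjective c)))
  rw [sub_mem_cosetKer_iff, ← Finsupp.mapDomain_comp,
    (Function.rightInverse_surjInv (B.cls_surjective c)).comp_eq_id, Finsupp.mapDomain_id] at h
  exact h

variable {S : C ⥤ ModuleCat.{v} k}

theorem nontrivial_hom_spanKer_quot (hC : IsKTrivial k C) {b : C} {v : A.obj.obj b} (hv : IsGen A v)
    {φ : (spanKerFunctor k N).toFunctor ⟶ S} (hφ : φ ≠ 0)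
    (hB : ∀ c (ξ : spanKer k N c), ξ.1 ∈ cosetKer k (B.obj c) → φ.app c ξ = 0) :
    Nontrivial ((spanKerFunctor k (B.cls a '' N)).toFunctor ⟶ S) := by
  have (c : C) : Finite (A.obj.obj c) := hv.finite hC c
  have (c : C) : Fintype (B.obj c) := Fintype.ofFinite _
  have hcard (c : C) := card_addSubgroup_ne_zero (B.obj c) (hv.card_ne_zero hC c)
  have hφB {c : C} (ξ ζ : spanKer k N c)
      (h : ξ.1.mapDomain (B.cls c) = ζ.1.mapDomain (B.cls c)) : φ.app c ξ = φ.app c ζ :=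
    sub_eq_zero.1 (((φ.app c).hom.map_sub _ _).symm.trans (hB c (ξ - ζ) (sub_mem_cosetKer_iff.2 h)))
  let σ (c : C) : spanKer k (B.cls a '' N) c →ₗ[k] spanKer k N c :=
    (averageLift k c B).restrict fun _ => averageLift_mem_spanKer B
  have hσ (c : C) (ξ) : (σ c ξ).1.mapDomain (B.cls c) = ξ.1 :=
    mapDomain_cls_averageLift B (hcard c) _
  let ψ : (spanKerFunctor k (B.cls a '' N)).toFunctor ⟶ S :=
    { app := fun c => ModuleCat.ofHom ((φ.app c).hom ∘ₗ σ c)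
      naturality := fun c d f => by
        ext ξ
        refine Eq.trans (hφB _ _ ?_) (NatTrans.naturality_apply φ f (σ c ξ))
        refine (hσ d _).trans ?_
        change ξ.1.mapDomain (B.quot.obj.map f) =
          ((σ c ξ).1.mapDomain (A.obj.map f)).mapDomain (B.cls d)
        rw [← hσ c ξ, ← Finsupp.mapDomain_comp, ← Finsupp.mapDomain_comp]
        rfl }
  obtain ⟨c, ξ, hξ⟩ := exists_app_ne_zero hφ
  refine nontrivial_of_ne ψ 0 fun h0 => hξ ?_
  have h : φ.app c (σ c ⟨_, mapDomain_cls_mem_spanKer B ξ.2⟩) = 0 := congr($(h0).app c _)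
  rwa [hφB _ ξ (hσ c _)] at h

end Quot

/-- The representable functor `C(a, -)`. -/
def corep (a : C) : AddRep C where
  obj := preadditiveCoyoneda.obj (Opposite.op a)
  property := inferInstanceAs (Functor.Additive _)

theorem isGen_corep (a : C) : IsGen (corep a) (𝟙 a : a ⟶ a) :=
  fun _ f => ⟨f, Category.id_comp f⟩

theorem isCogen_quot_annih (A : AddRep C) (a : C) : IsCogen (annih A a).quot a := by
  intro c x hx
  obtain ⟨x, rfl⟩ := SubRep.cls_surjective _ c x
  refine SubRep.cls_eq_zero.2 (mem_annih.2 fun f => ?_)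
  rw [← A.obj.map_id_apply a (A.obj.map f x)]
  exact mem_annih.1 (SubRep.cls_eq_zero.1 (hx f)) (𝟙 a)

section Simple

variable {S : C ⥤ ModuleCat.{v} k}

theorem nontrivial_hom_spanKer_corep {s : S.obj a} (hs : s ≠ 0) :
    Nontrivial ((spanKerFunctor k (∅ : Set ((corep a).obj.obj a))).toFunctor ⟶ S) := by
  let φ : (spanKerFunctor k (∅ : Set ((corep a).obj.obj a))).toFunctor ⟶ S :=
    { app := fun c => ModuleCat.ofHom
        (Finsupp.linearCombination k (fun f : a ⟶ c => S.map f s) ∘ₗ (spanKer k ∅ c).subtype)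
      naturality := fun c d f => by
        ext ξ
        let η : (a ⟶ c) →₀ k := ξ.1
        change Finsupp.linearCombination k (fun g : a ⟶ d => S.map g s) (η.mapDomain (· ≫ f)) =
          (S.map f).hom (Finsupp.linearCombination k (fun g : a ⟶ c => S.map g s) η)
        rw [Finsupp.linearCombination_mapDomain, Finsupp.apply_linearCombination]
        congr 2
        funext g
        exact S.map_comp_apply g f s }
  refine nontrivial_of_ne φ 0 fun h0 => hs ?_
  have h : Finsupp.linearCombination k (fun f : a ⟶ a => S.map f s) (Finsupp.single (𝟙 a) 1) = 0 :=
    congr($(h0).app a ⟨Finsupp.single (𝟙 a) 1, mem_spanKer.2 fun n hn => hn.elim⟩)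
  rwa [Finsupp.linearCombination_single, one_smul, S.map_id_apply] at h

theorem nontrivial_hom_spanKer_quot_annih (hC : IsKTrivial k C) (hS : Simple S)
    {s : S.obj a} (hs : s ≠ 0) {v : A.obj.obj a} (hv : IsGen A v)
    {φ : (spanKerFunctor k N).toFunctor ⟶ S} (hφ : φ ≠ 0) :
    Nontrivial ((spanKerFunctor k ((annih A a).cls a '' N)).toFunctor ⟶ S) := by
  refine nontrivial_hom_spanKer_quot (annih A a) hC hv hφ fun c ξ hξ => ?_
  by_contra hne
  obtain ⟨f, hf⟩ := exists_map_ne_zero hS s hs hne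
  refine hf ((NatTrans.naturality_apply φ f ξ).symm.trans ?_)
  have hmap : ξ.1.mapDomain (A.obj.map f) ∈ cosetKer k (⊥ : AddSubgroup (A.obj.obj a)) := by
    refine mapDomain_mem_cosetKer _ (fun x y hxy => ?_) hξ
    rw [← map_sub]
    exact mem_annih.1 hxy f
  rw [cosetKer_bot, Submodule.mem_bot] at hmap
  have h0 : (spanKerFunctor k N).toFunctor.map f ξ = 0 := Subtype.ext hmap
  rw [h0, map_zero]

theorem nontrivial_hom_upper_of_minimal (hC : IsKTrivial k C) (ha : IsCogen A a) {v : A.obj.obj a}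
    (hv : IsGen A v) (hN : Nontrivial ((spanKerFunctor k N).toFunctor ⟶ S))
    (hmin : ∀ (A' : AddRep C) (v' : A'.obj.obj a) (N' : Set (A'.obj.obj a)), IsGen A' v' →
      Nontrivial ((spanKerFunctor k N').toFunctor ⟶ S) →
      Nat.card (A.obj.obj a) ≤ Nat.card (A'.obj.obj a)) :
    Nontrivial ((upper k A).toFunctor ⟶ S) := by
  have := hv.finite hC a
  obtain ⟨N, hN, hmax⟩ := (Set.toFinite {N : Set (A.obj.obj a) |
    Nontrivial ((spanKerFunctor k N).toFunctor ⟶ S)}).exists_maximal ⟨N, hN⟩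
  have : Nontrivial ((spanKerFunctor k N).toFunctor ⟶ S) := hN
  obtain ⟨φ, hφ⟩ := exists_ne (0 : (spanKerFunctor k N).toFunctor ⟶ S)
  have hmem (n : A.obj.obj a) : n ∈ N ↔ n ≠ 0 := by
    refine ⟨?_, fun hn0 => ?_⟩
    · rintro hn rfl
      obtain ⟨c, ξ, hξ⟩ := exists_app_ne_zero hφ
      have h0 : ξ.1 ∈ cosetKer k ((SubRep.span (0 : A.obj.obj a)).obj c) := mem_spanKer.1 ξ.2 0 hn
      rw [SubRep.span_eq_bot.2 rfl] at h0
      change ξ.1 ∈ cosetKer k (⊥ : AddSubgroup (A.obj.obj c)) at h0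
      rw [cosetKer_bot, Submodule.mem_bot] at h0
      rw [show ξ = 0 from Subtype.ext h0] at hξ
      exact hξ (map_zero _)
    · by_contra hn
      have hquot : Nontrivial ((spanKerFunctor k ((SubRep.span n).cls a '' N)).toFunctor ⟶ S) := by
        refine nontrivial_hom_spanKer_quot (SubRep.span n) hC hv hφ fun c ξ hξ => ?_
        by_contra hne
        let j := SubFunctor.homOfLE (T := spanKerFunctor k (insert n N)) (T' := spanKerFunctor k N)
          fun c η hη => mem_spanKer.2 fun m hm => mem_spanKer.1 hη m (Set.mem_insert_of_mem n hm)
        refine hn (hmax (nontrivial_of_ne (j ≫ φ) 0 fun h0 => hne ?_) (Set.subset_insert n N)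
          (Set.mem_insert n N))
        exact congr($(h0).app c ⟨ξ.1, mem_spanKer.2 (Set.forall_mem_insert.2
          ⟨hξ, mem_spanKer.1 ξ.2⟩)⟩)
      have hbij := ((SubRep.span n).cls_surjective a).bijective_of_nat_card_le
        (hmin _ _ _ (hv.cls _) hquot)
      exact hn0 (hbij.1 ((SubRep.cls_eq_zero.2 (SubRep.self_mem_span n)).trans (map_zero _).symm))
  have h : spanKerFunctor k N = upper k A :=
    SubFunctor.ext (funext fun c => spanKer_eq_upperKer ha hmem)
  exact h ▸ hN

theorem exists_nontrivial_hom_upper (hC : IsKTrivial k C) (hS : Simple S) :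
    ∃ A : AddRep C, IsGenCogen A ∧ Nontrivial ((upper k A).toFunctor ⟶ S) := by
  obtain ⟨a, s, hs⟩ := exists_app_ne_zero (id_nonzero S)
  let P (m : ℕ) : Prop := ∃ (A : AddRep C) (v : A.obj.obj a) (N : Set (A.obj.obj a)),
    IsGen A v ∧ Nontrivial ((spanKerFunctor k N).toFunctor ⟶ S) ∧ Nat.card (A.obj.obj a) = m
  have hP : ∃ m, P m := ⟨_, corep a, 𝟙 a, ∅, isGen_corep a, nontrivial_hom_spanKer_corep hs, rfl⟩
  classical
  obtain ⟨A, v, N, hv, hN, hcard⟩ := Nat.find_spec hP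
  obtain ⟨φ, hφ⟩ := exists_ne (0 : (spanKerFunctor k N).toFunctor ⟶ S)
  have := hv.finite hC a
  have hle : Nat.card ((annih A a).quot.obj.obj a) ≤ Nat.card (A.obj.obj a) :=
    Nat.card_le_card_of_surjective _ ((annih A a).cls_surjective a)
  refine ⟨(annih A a).quot, ⟨⟨a, _, hv.cls (annih A a)⟩, a, isCogen_quot_annih A a⟩,
    nontrivial_hom_upper_of_minimal hC (isCogen_quot_annih A a) (hv.cls _)
      (nontrivial_hom_spanKer_quot_annih hC hS hs hv hφ) fun A' v' N' hv' hN' => ?_⟩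
  exact hle.trans (hcard.trans_le (Nat.find_min' hP ⟨A', v', N', hv', hN', rfl⟩))

end Simple

end Upper

/-! ### Every simple functor is some `Q(A, M)` -/

section Socle

theorem exists_simple_injective {R : Type*} [Ring R] [IsArtinianRing R] [Small.{v} R] (V : Type*)
    [AddCommGroup V] [Module R V] [Nontrivial V] :
    ∃ (M : ModuleCat.{v} R) (f : M →ₗ[R] V), Simple M ∧ Function.Injective f := by
  obtain ⟨x, hx⟩ := exists_ne (0 : V)
  let W := Submodule.span R {x}
  have : Nontrivial W := by
    rwa [Submodule.nontrivial_iff_ne_bot, Ne, Submodule.span_singleton_eq_bot]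
  have : IsArtinian R W := isArtinian_of_fg_of_artinian'
  have : IsAtomic (Submodule R W) := isAtomic_of_orderBot_wellFounded_lt wellFounded_lt
  obtain ⟨P, hP⟩ := IsAtomic.exists_atom (Submodule R W)
  have : Small.{v} P := Module.Finite.small R P
  have : IsSimpleModule R P := isSimpleModule_iff_isAtom.2 hP
  let e := Shrink.linearEquiv.{v} R P
  exact ⟨ModuleCat.of R (Shrink.{v} P), W.subtype ∘ₗ P.subtype ∘ₗ e.toLinearMap,
    simple_iff_isSimpleModule.2 (IsSimpleModule.congr (N := P) e),
    W.subtype_injective.comp (P.subtype_injective.comp e.injective)⟩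

end Socle

section Intertwining

variable {k : Type v} [Field k] {G : Type*} [Group G] {V : Type*} [AddCommGroup V] [Module k V]

/-- The intertwining map from the representation attached to a `k[G]`-module which is given by a
`k[G]`-linear map. -/
def intertwiningOfLinear {M : ModuleCat.{v} (MonoidAlgebra k G)} {ρ : Representation k G V}
    (f : M →ₗ[MonoidAlgebra k G] ρ.asModule) : Representation.IntertwiningMap (repOf M).ρ ρ where
  toFun m := ρ.asModuleEquiv (f m)
  map_add' m m' := congrArg ρ.asModuleEquiv (f.map_add m m')
  map_smul' r m := by
    refine (congrArg ρ.asModuleEquiv (f.map_smul (algebraMap k _ r) m)).trans ?_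
    rw [Representation.asModuleEquiv_map_smul, AlgHom.commutes]
    rfl
  isIntertwining' g := LinearMap.ext fun m => by
    refine (congrArg ρ.asModuleEquiv (f.map_smul (MonoidAlgebra.of k G g) m)).trans ?_
    rw [Representation.asModuleEquiv_map_smul, Representation.asAlgebraHom_of]
    rfl

end Intertwining

section Aut

variable {k : Type v} [Field k] {C : Type u} [Category.{v} C] [Preadditive C] {A A' A'' : AddRep C}
  {S : C ⥤ ModuleCat.{v} k}

theorem mapDomain_iso_mem_upperKer (e : A ≅ A') {a : C} {ξ : A.obj.obj a →₀ k}
    (hξ : ξ ∈ upperKer k A a) : ξ.mapDomain (e.hom.hom.app a) ∈ upperKer k A' a := by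
  rw [mem_upperKer] at hξ ⊢
  intro B hB
  refine mapDomain_mem_cosetKer _ (fun x y hxy => ?_) (hξ (SubRep.orderIsoOfIso e.symm B)
    fun h => hB ((map_eq_bot_iff (SubRep.orderIsoOfIso e.symm)).1 h))
  rw [← map_sub]
  exact hxy

/-- The functoriality of `Q^A` with respect to isomorphisms. -/
def mapUpper (e : A ≅ A') : (upper k A).toFunctor ⟶ (upper k A').toFunctor where
  app a := ModuleCat.ofHom ((Finsupp.lmapDomain k k (e.hom.hom.app a)).restrict
    fun _ => mapDomain_iso_mem_upperKer e)
  naturality a b f := by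
    ext ξ : 2
    refine Subtype.ext ?_
    change (ξ.1.mapDomain (A.obj.map f)).mapDomain (e.hom.hom.app b) =
      (ξ.1.mapDomain (e.hom.hom.app a)).mapDomain (A'.obj.map f)
    rw [← Finsupp.mapDomain_comp, ← Finsupp.mapDomain_comp]
    exact congr(Finsupp.mapDomain $(funext fun x => NatTrans.naturality_apply e.hom.hom f x) ξ.1)

theorem mapUpper_refl : mapUpper (k := k) (Iso.refl A) = 𝟙 _ := by
  ext a ξ : 4
  exact Subtype.ext Finsupp.mapDomain_id

theorem mapUpper_trans (e : A ≅ A') (e' : A' ≅ A'') :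
    mapUpper (k := k) (e ≪≫ e') = mapUpper e ≫ mapUpper e' := by
  ext a ξ : 4
  exact Subtype.ext (Finsupp.mapDomain_comp (f := e.hom.hom.app a) (g := e'.hom.hom.app a))

theorem nontrivial_hom_upper_of_iso (e : A ≅ A') [Nontrivial ((upper k A).toFunctor ⟶ S)] :
    Nontrivial ((upper k A').toFunctor ⟶ S) := by
  obtain ⟨φ, hφ⟩ := exists_ne (0 : (upper k A).toFunctor ⟶ S)
  refine nontrivial_of_ne (mapUpper e.symm ≫ φ) 0 fun h => hφ ?_
  rw [← Category.id_comp φ, ← mapUpper_refl, ← e.self_symm_id, mapUpper_trans, Category.assoc, h,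
    comp_zero]

variable (k A S) in
/-- The representation of `Aut A` on the morphisms from `Q^A` to a functor. -/
def homUpperRho : Representation k (Aut A) ((upper k A).toFunctor ⟶ S) where
  toFun g := Linear.leftComp k S (mapUpper (g⁻¹ : Aut A))
  map_one' := LinearMap.ext fun φ => congr($(mapUpper_refl) ≫ φ).trans (Category.id_comp φ)
  map_mul' g h := LinearMap.ext fun φ =>
    congr($(mapUpper_trans (g⁻¹ : Aut A) (h⁻¹ : Aut A)) ≫ φ).trans (Category.assoc _ _ φ)

theorem homUpperRho_app (g : Aut A) (φ : (upper k A).toFunctor ⟶ S) (a : C) (η : upperKer k A a) :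
    (homUpperRho k A S g φ).app a η = φ.app a (upperRho k A a g⁻¹ η) := rfl

/-- The morphism `M ⊗ Q^A ⟶ S` adjoint to an intertwining map from `M` to the morphisms from `Q^A`
to `S`. -/
def upperTensor.desc {M : ModuleCat.{v} (MonoidAlgebra k (Aut A))}
    (f : Representation.IntertwiningMap (repOf M).ρ (homUpperRho k A S)) :
    upperTensor A M ⟶ S where
  app a := ModuleCat.ofHom (tensorOver.lift M (upperObj k A a)
    (LinearMap.mk₂ k (fun m (η : upperKer k A a) => (f m).app a η)
      (fun m m' η => congr(($(f.toLinearMap.map_add m m')).app a η))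
      (fun r m η => congr(($(f.toLinearMap.map_smul r m)).app a η))
      (fun m η η' => ((f m).app a).hom.map_add η η')
      (fun r m η => ((f m).app a).hom.map_smul r η))
    (fun g m (η : upperKer k A a) => by
      change (f ((repOf M).ρ g m)).app a (upperRho k A a g η) = (f m).app a η
      rw [f.isIntertwining, homUpperRho_app, Representation.inv_self_apply]))
  naturality a b g := by
    ext t
    induction t using upperTensor.induction with
    | zero => rw [map_zero, map_zero]
    | add s t hs ht => rw [map_add, map_add, hs, ht]
    | mk m η => exact NatTrans.naturality_apply (f m) g η

theorem IsGen.finite_aut (hC : IsKTrivial k C) {a : C} {v : A.obj.obj a} (hv : IsGen A v) :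
    Finite (Aut A) := by
  have := hv.finite hC a
  exact Finite.of_injective (fun g : Aut A => g.hom.hom.app a v) fun g h => hv.aut_ext

theorem exists_iso_Q [HasBinaryBiproducts C] (hC : IsKTrivial k C) (hA : IsGenCogen A)
    (hS : Simple S) [Nontrivial ((upper k A).toFunctor ⟶ S)] :
    ∃ M : ModuleCat.{v} (MonoidAlgebra k (Aut A)), Simple M ∧ Nonempty (S ≅ Q A M) := by
  obtain ⟨a, v, hv⟩ := hA.1
  have := hv.finite_aut hC
  have : IsArtinianRing (MonoidAlgebra k (Aut A)) := IsArtinianRing.of_finite k _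
  have : Small.{v} (MonoidAlgebra k (Aut A)) := Module.Finite.small k _
  have : Nontrivial (homUpperRho k A S).asModule :=
    (homUpperRho k A S).asModuleEquiv.toEquiv.nontrivial
  obtain ⟨M, f, hM, hf⟩ := exists_simple_injective (R := MonoidAlgebra k (Aut A))
    (homUpperRho k A S).asModule
  refine ⟨M, hM, nonempty_iso_Q hC hA hM hS (upperTensor.desc (intertwiningOfLinear f))
    fun h0 => ?_⟩
  have := simple_iff_isSimpleModule.1 hM
  have := IsSimpleModule.nontrivial (MonoidAlgebra k (Aut A)) M
  obtain ⟨m, hm⟩ := exists_ne (0 : M)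
  refine hm ((map_eq_zero_iff f hf).1 ((homUpperRho k A S).asModuleEquiv.map_eq_zero_iff.1 ?_))
  ext a η
  exact congr($(h0).app a (upperTensor.mk A M a m η))

end Aut

/-! ### Locally finite categories -/

section LocallyFinite

/-- The elements below `b` satisfy both chain conditions; for a subfunctor `b` of an additive
functor this says that `b` is a finite object. -/
def FinBelow {α : Type*} [Preorder α] (b : α) : Prop :=
  WellFoundedGT (Set.Iic b) ∧ WellFoundedLT (Set.Iic b)

theorem FinBelow.sup {α : Type*} [Lattice α] [IsModularLattice α] {b b' : α} (h : FinBelow b)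
    (h' : FinBelow b') : FinBelow (b ⊔ b') := by
  obtain ⟨_, _⟩ := h
  obtain ⟨_, _⟩ := h'
  let f (x : Set.Iic (b ⊔ b')) : Set.Iic b × Set.Iic b' :=
    (⟨x.1 ⊓ b, inf_le_right⟩, ⟨(x.1 ⊔ b) ⊓ b', inf_le_right⟩)
  have hmono : Monotone f := fun x y hxy =>
    ⟨inf_le_inf_right b hxy, inf_le_inf_right b' (sup_le_sup_right (Subtype.coe_le_coe.2 hxy) b)⟩
  have hsup (x : Set.Iic (b ⊔ b')) : b ⊔ (f x).2 = x.1 ⊔ b := by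
    change b ⊔ (x.1 ⊔ b) ⊓ b' = x.1 ⊔ b
    rw [inf_comm, ← sup_inf_assoc_of_le b' le_sup_right, inf_eq_right]
    exact sup_le x.2 le_sup_left
  have hf : StrictMono f := by
    intro x y hxy
    refine lt_of_le_of_ne (hmono hxy.le) fun heq => hxy.ne (Subtype.ext ?_)
    have hinf : x.1 ⊓ b = y.1 ⊓ b := congr(($heq).1)
    exact eq_of_le_of_inf_le_of_sup_le hxy.le hinf.ge (by rw [← hsup x, ← hsup y, heq])
  exact ⟨hf.wellFoundedGT, hf.wellFoundedLT⟩

theorem finBelow_bot {α : Type*} [PartialOrder α] [OrderBot α] : FinBelow (⊥ : α) :=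
  have : Finite (Set.Iic (⊥ : α)) := by simp [Set.finite_coe_iff]
  ⟨inferInstance, inferInstance⟩

variable {C : Type u} [Category.{v} C] [Preadditive C]

theorem IsFiniteRep.finBelow_map {A G : AddRep C} (hG : IsFiniteRep G) (φ : G ⟶ A) :
    FinBelow (SubRep.map φ ⊤) := by
  obtain ⟨_, _⟩ := hG
  have hmap (W : Set.Iic (SubRep.map φ ⊤)) : SubRep.map φ (SubRep.comap φ W) = W := by
    refine le_antisymm (SubRep.map_le_iff.2 le_rfl) fun a y hy => ?_
    obtain ⟨z, -, rfl⟩ := W.2 a hy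
    exact ⟨z, hy, rfl⟩
  have hf : StrictMono fun U : Set.Iic (SubRep.map φ ⊤) => SubRep.comap φ U :=
    Monotone.strictMono_of_injective (fun _ _ hUV => SubRep.comap_mono φ hUV)
      fun U V (hUV : SubRep.comap φ U = SubRep.comap φ V) =>
        Subtype.ext (by rw [← hmap U, hUV, hmap V])
  exact ⟨hf.wellFoundedGT, hf.wellFoundedLT⟩

theorem isFiniteRep_of_finBelow_top {A : AddRep C} (h : FinBelow (⊤ : SubRep A)) :
    IsFiniteRep A := by
  obtain ⟨_, _⟩ := h
  have hf : StrictMono fun U : SubRep A => (⟨U, Set.mem_Iic.2 le_top⟩ : Set.Iic (⊤ : SubRep A)) :=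
    fun _ _ h => h
  exact ⟨hf.wellFoundedGT, hf.wellFoundedLT⟩

theorem SubRep.eq_top_of_map_le {P : ObjectProperty (AddRep C)} (hP : P.IsSeparating)
    {A : AddRep C} {U : SubRep A} (hU : ∀ G, P G → ∀ φ : G ⟶ A, SubRep.map φ ⊤ ≤ U) : U = ⊤ := by
  have hproj : U.proj = ⟨0⟩ := by
    refine hP _ _ fun G hG φ => ObjectProperty.hom_ext _ ?_
    ext a y
    exact SubRep.cls_eq_zero.2 (hU G hG φ a ⟨y, SubRep.mem_top y, rfl⟩)
  refine SubRep.eq_top_iff_forall.2 fun a y => ?_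
  rw [← SubRep.cls_eq_zero, ← SubRep.proj_app, hproj]
  rfl

theorem IsFinGen.isFiniteRep (hsep : (IsFiniteRep : ObjectProperty (AddRep C)).IsSeparating)
    {A : AddRep C} (hA : IsFinGen A) : IsFiniteRep A := by
  refine isFiniteRep_of_finBelow_top (hA {B | FinBelow B} ⟨⊥, finBelow_bot⟩
    (fun B hB B' hB' => ⟨B ⊔ B', hB.sup hB', le_sup_left, le_sup_right⟩)
    ⟨fun B _ => le_top, fun U hU => ?_⟩)
  exact (SubRep.eq_top_of_map_le hsep fun G hG φ => hU (hG.finBelow_map φ)).ge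

end LocallyFinite

/-! ### Isomorphism classes of simple objects -/

section Irr

theorem Irr.exists_mk {E : Type u} [Category.{w} E] [HasZeroMorphisms E] (q : Irr E) :
    ∃ (X : E) (hX : Simple X), Irr.mk X hX = q := by
  obtain ⟨⟨X, hX⟩, rfl⟩ := Quotient.exists_rep q
  exact ⟨X, hX, rfl⟩

theorem Irr.mk_eq_mk {E : Type u} [Category.{w} E] [HasZeroMorphisms E] {X Y : E} {hX : Simple X}
    {hY : Simple Y} : Irr.mk X hX = Irr.mk Y hY ↔ Nonempty (X ≅ Y) :=
  Quotient.eq (r := simpleSetoid E)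

theorem exists_bijective_irr {E : Type*} [Category* E] [HasZeroMorphisms E] {ι : Type*}
    {I : ι → Type*} {D : ∀ n, I n → Type*} [∀ n i, Category* (D n i)]
    [∀ n i, HasZeroMorphisms (D n i)] (F : ∀ n i, D n i → E)
    (simple : ∀ n i X, Simple X → Simple (F n i X))
    (map_iso : ∀ n i (X Y : D n i), Nonempty (X ≅ Y) → Nonempty (F n i X ≅ F n i Y))
    (index_eq : ∀ n i n' i' (X : D n i) (Y : D n' i'), Simple X → Simple Y →
      Nonempty (F n i X ≅ F n' i' Y) → (⟨n, i⟩ : Sigma I) = ⟨n', i'⟩)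
    (iso_of_map : ∀ n i (X Y : D n i), Nonempty (F n i X ≅ F n i Y) → Nonempty (X ≅ Y))
    (exists_iso : ∀ S, Simple S → ∃ n i X, Simple X ∧ Nonempty (S ≅ F n i X)) :
    ∃ φ : (Σ n i, Irr (D n i)) → Irr E, Function.Bijective φ ∧
      ∀ n i X hX, ∃ hF : Simple (F n i X), φ ⟨n, i, Irr.mk X hX⟩ = Irr.mk (F n i X) hF := by
  let φ (p : Σ n i, Irr (D n i)) : Irr E :=
    Quotient.lift (fun X : {X // Simple X} => Irr.mk _ (simple _ _ X.1 X.2))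
      (fun X Y h => Irr.mk_eq_mk.2 (map_iso _ _ X.1 Y.1 h)) p.2.2
  have hφ n i X hX : φ ⟨n, i, Irr.mk X hX⟩ = Irr.mk (F n i X) (simple n i X hX) := rfl
  refine ⟨φ, ⟨?_, fun q => ?_⟩, fun n i X hX => ⟨simple n i X hX, hφ n i X hX⟩⟩
  · rintro ⟨n, i, q⟩ ⟨n', i', q'⟩ h
    obtain ⟨X, hX, rfl⟩ := q.exists_mk
    obtain ⟨Y, hY, rfl⟩ := q'.exists_mk
    rw [hφ, hφ, Irr.mk_eq_mk] at h
    cases index_eq n i n' i' X Y hX hY h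
    rw [Irr.mk_eq_mk.2 (iso_of_map n i X Y h)]
  · obtain ⟨S, hS, rfl⟩ := q.exists_mk
    obtain ⟨n, i, X, hX, ⟨e⟩⟩ := exists_iso S hS
    exact ⟨⟨n, i, Irr.mk X hX⟩, Irr.mk_eq_mk.2 ⟨e.symm⟩⟩

variable {E : Type*} [Category* E] [Preadditive E] [HasKernels E] (P : ObjectProperty E)
  [P.IsClosedUnderSubobjects]

theorem fullSubcategory_mono_iff {X Y : P.FullSubcategory} (i : X ⟶ Y) :
    Mono i ↔ Mono i.hom := by
  refine ⟨fun _ => Preadditive.mono_of_kernel_zero ?_, fun _ => P.ι.mono_of_mono_map ‹Mono i.hom›⟩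
  let K : P.FullSubcategory := ⟨kernel i.hom, P.prop_of_mono (kernel.ι i.hom) X.property⟩
  let j : K ⟶ X := ⟨kernel.ι i.hom⟩
  have hj : j ≫ i = 0 := ObjectProperty.hom_ext _ (kernel.condition i.hom)
  exact congr(($(zero_of_comp_mono i hj)).hom)

theorem fullSubcategory_simple_iff {X : P.FullSubcategory} : Simple X ↔ Simple X.obj := by
  have isIso_iff {Y : P.FullSubcategory} (i : Y ⟶ X) : IsIso i.hom ↔ IsIso i :=
    isIso_iff_of_reflects_iso i P.ι
  have eq_zero_iff {Y : P.FullSubcategory} (i : Y ⟶ X) : i.hom = 0 ↔ i = 0 :=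
    ⟨fun h => ObjectProperty.hom_ext _ h, fun h => congr(($h).hom)⟩
  refine ⟨fun _ => ⟨fun {Y} i _ => ?_⟩, fun _ => ⟨fun {Y} i _ => ?_⟩⟩
  · let i' : (⟨Y, P.prop_of_mono i X.property⟩ : P.FullSubcategory) ⟶ X := ⟨i⟩
    have : Mono i' := (fullSubcategory_mono_iff P i').2 ‹Mono i›
    have h := Simple.mono_isIso_iff_nonzero i'
    rwa [← isIso_iff, Ne, ← eq_zero_iff] at h
  · have := (fullSubcategory_mono_iff P i).1 inferInstance
    rw [← isIso_iff, Ne, ← eq_zero_iff]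
    exact Simple.mono_isIso_iff_nonzero i.hom

end Irr

/-! ### The classification -/

section Classification

variable {k : Type v} [Field k] {C : Type u} [Category.{v} C] [Preadditive C]
  {L : ℕ → Set (AddRep C)} {n d : ℕ}

theorem IsSystemOfReps.sigma_eq_of_iso (hL : IsSystemOfReps L) {n' : ℕ} {A : L n} {A' : L n'}
    (e : A.1 ≅ A'.1) : (⟨n, A⟩ : Σ n, L n) = ⟨n', A'⟩ := by
  obtain ⟨hf, hl⟩ := (hL n).1 A A.2
  obtain ⟨hf', hl'⟩ := (hL n').1 A' A'.2
  obtain rfl : n = n' := le_antisymm ((hl.of_iso e).le (hl'.lengthLE hf'))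
    ((hl'.of_iso e.symm).le (hl.lengthLE hf))
  rw [Subtype.ext (((hL n).2 A hf hl).unique ⟨A.2, ⟨Iso.refl _⟩⟩ ⟨A'.2, ⟨e⟩⟩)]

variable [HasBinaryBiproducts C]

theorem isClosedUnderSubobjects_Fd (hC : IsKTrivial k C) :
    (Fd k C d).IsClosedUnderSubobjects :=
  ⟨fun f _ hY => Fd_of_mono hC f hY⟩

variable [Nonempty C]

theorem IsSystemOfReps.isGenCogen (hL : IsSystemOfReps L) (A : L n) : IsGenCogen A.1 :=
  ((hL n).1 A A.2).1.isGenCogen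

theorem IsSystemOfReps.sigma_eq_of_Q_iso (hC : IsKTrivial k C) (hL : IsSystemOfReps L) {n' : ℕ}
    {A : L n} {A' : L n'} {M : ModuleCat.{v} (MonoidAlgebra k (Aut A.1))}
    {M' : ModuleCat.{v} (MonoidAlgebra k (Aut A'.1))} (hM : Simple M) (hM' : Simple M')
    (e : Q A.1 M ≅ Q A'.1 M') : (⟨n, A⟩ : Σ n, L n) = ⟨n', A'⟩ := by
  obtain ⟨ε⟩ := nonempty_iso_of_Q_iso hC (hL.isGenCogen A) (hL.isGenCogen A') hM hM' e.symm
  exact hL.sigma_eq_of_iso ε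

theorem IsSystemOfReps.exists_iso_Q (hC : IsKTrivial k C) (hL : IsSystemOfReps L) {A : AddRep C}
    (hA : IsFiniteRep A) (hn : HasLength A n) {S : C ⥤ ModuleCat.{v} k} (hS : Simple S)
    [Nontrivial ((upper k A).toFunctor ⟶ S)] :
    ∃ (B : L n) (M : ModuleCat.{v} (MonoidAlgebra k (Aut B.1))), Simple M ∧
      Nonempty (S ≅ Q B.1 M) := by
  obtain ⟨B, ⟨hB, ⟨e⟩⟩, -⟩ := (hL n).2 A hA hn
  have := nontrivial_hom_upper_of_iso (S := S) e
  exact ⟨⟨B, hB⟩, AntiPoly.exists_iso_Q hC (hL.isGenCogen ⟨B, hB⟩) hS⟩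

theorem IsSystemOfReps.exists_iso_Q_of_Fd (hC : IsKTrivial k C) (hL : IsSystemOfReps L)
    {S : C ⥤ ModuleCat.{v} k} (hS : Simple S) (hd : Fd k C d S) :
    ∃ (n : Set.Iic d) (A : L n) (M : ModuleCat.{v} (MonoidAlgebra k (Aut A.1))), Simple M ∧
      Nonempty (S ≅ Q A.1 M) := by
  obtain ⟨A, hA, _⟩ := exists_nontrivial_hom_upper hC hS
  obtain ⟨M, hM, ⟨e⟩⟩ := AntiPoly.exists_iso_Q hC hA hS
  have hAd : LengthLE A d := lengthLE_of_Fd hC hA hM (Fd_of_mono hC e.inv hd)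
  obtain ⟨n, hn⟩ := hAd.isFiniteRep.exists_hasLength
  exact ⟨⟨n, hn.le hAd⟩, hL.exists_iso_Q hC hAd.isFiniteRep hn hS⟩

theorem IsSystemOfReps.exists_iso_Q_of_isFiniteRep (hC : IsKTrivial k C) (hL : IsSystemOfReps L)
    (hfin : ∀ A : AddRep C, IsFinGen A → IsFinCogen A → IsFiniteRep A)
    {S : C ⥤ ModuleCat.{v} k} (hS : Simple S) :
    ∃ (n : ℕ) (A : L n) (M : ModuleCat.{v} (MonoidAlgebra k (Aut A.1))), Simple M ∧
      Nonempty (S ≅ Q A.1 M) := by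
  obtain ⟨A, ⟨⟨a, v, hv⟩, b, hb⟩, _⟩ := exists_nontrivial_hom_upper hC hS
  have := hv.finite hC b
  have hA : IsFiniteRep A := hfin A hv.isFinGen hb.isFinCogen
  obtain ⟨n, hn⟩ := hA.exists_hasLength
  exact ⟨n, hL.exists_iso_Q hC hA hn hS⟩

theorem IsSystemOfReps.exists_bijective_irr_Fd (hC : IsKTrivial k C) (hL : IsSystemOfReps L)
    (d : ℕ) :
    ∃ φ : (Σ (n : Set.Iic d) (A : L n), Irr (ModuleCat.{v} (MonoidAlgebra k (Aut A.1)))) →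
        Irr (Fd k C d).FullSubcategory,
      Function.Bijective φ ∧ ∀ (n : Set.Iic d) (A : L n)
        (M : ModuleCat.{v} (MonoidAlgebra k (Aut A.1))) (hM : Simple M),
        ∃ (hd : Fd k C d (Q A.1 M))
          (hs : Simple (⟨Q A.1 M, hd⟩ : (Fd k C d).FullSubcategory)),
          φ ⟨n, A, Irr.mk M hM⟩ = Irr.mk ⟨Q A.1 M, hd⟩ hs := by
  have := isClosedUnderSubobjects_Fd hC (d := d)
  have hd (n : Set.Iic d) (A : L n) (M : ModuleCat.{v} (MonoidAlgebra k (Aut A.1))) :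
      Fd k C d (Q A.1 M) :=
    Fd_Q hC ((((hL n).1 A A.2).2.lengthLE ((hL n).1 A A.2).1).mono n.2) M
  obtain ⟨φ, hφ, hφQ⟩ := exists_bijective_irr (E := (Fd k C d).FullSubcategory)
    (D := fun (n : Set.Iic d) (A : L n) => ModuleCat.{v} (MonoidAlgebra k (Aut A.1)))
    (fun n A M => ⟨Q A.1 M, hd n A M⟩)
    (fun _ A _ hM => (fullSubcategory_simple_iff _).2 (simple_Q hC (hL.isGenCogen A) hM))
    (fun _ _ _ _ ⟨e⟩ => (nonempty_Q_iso_of_iso e).map (Fd k C d).fullyFaithfulι.preimageIso)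
    (fun ⟨_, _⟩ _ ⟨_, _⟩ _ _ _ hM hM' ⟨e⟩ => by
      cases hL.sigma_eq_of_Q_iso hC hM hM' ((Fd k C d).ι.mapIso e)
      rfl)
    (fun _ A M M' ⟨e⟩ =>
      nonempty_iso_module_of_Q_iso hC (hL.isGenCogen A) ((Fd k C d).ι.mapIso e))
    (fun S hS => by
      obtain ⟨n, A, M, hM, e⟩ :=
        hL.exists_iso_Q_of_Fd hC ((fullSubcategory_simple_iff _).1 hS) S.property
      exact ⟨n, A, M, hM, e.map (Fd k C d).fullyFaithfulι.preimageIso⟩)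
  exact ⟨φ, hφ, fun n A M hM => ⟨hd n A M, hφQ n A M hM⟩⟩

theorem IsSystemOfReps.exists_bijective_irr_functor (hC : IsKTrivial k C) (hL : IsSystemOfReps L)
    (hfin : ∀ A : AddRep C, IsFinGen A → IsFinCogen A → IsFiniteRep A) :
    ∃ φ : (Σ (n : ℕ) (A : L n), Irr (ModuleCat.{v} (MonoidAlgebra k (Aut A.1)))) →
        Irr (C ⥤ ModuleCat.{v} k),
      Function.Bijective φ ∧ ∀ (n : ℕ) (A : L n)
        (M : ModuleCat.{v} (MonoidAlgebra k (Aut A.1))) (hM : Simple M),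
        ∃ hs : Simple (Q A.1 M), φ ⟨n, A, Irr.mk M hM⟩ = Irr.mk (Q A.1 M) hs :=
  exists_bijective_irr (D := fun n (A : L n) => ModuleCat.{v} (MonoidAlgebra k (Aut A.1)))
    (fun _ A M => Q A.1 M)
    (fun _ A _ hM => simple_Q hC (hL.isGenCogen A) hM)
    (fun _ _ _ _ ⟨e⟩ => nonempty_Q_iso_of_iso e)
    (fun _ _ _ _ _ _ hM hM' ⟨e⟩ => hL.sigma_eq_of_Q_iso hC hM hM' e)
    (fun _ A _ _ ⟨e⟩ => nonempty_iso_module_of_Q_iso hC (hL.isGenCogen A) e)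
    (fun _ hS => hL.exists_iso_Q_of_isFiniteRep hC hfin hS)

end Classification

end

end AntiPoly

theorem mainTheorem2_general (k : Type v) [Field k] (C : Type u) [Category.{v} C] [Preadditive C]
    [Nonempty C] [HasBinaryBiproducts C] (hC : AntiPoly.IsKTrivial k C)
    (L : ℕ → Set (AntiPoly.AddRep C)) (hL : AntiPoly.IsSystemOfReps L) :
    (∀ (A : AntiPoly.AddRep C) (M : ModuleCat.{v} (MonoidAlgebra k (Aut A))),
      AntiPoly.IsFiniteRep A → Simple M → Simple (AntiPoly.Q A M)) ∧
    (∀ d : ℕ,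
      ∃ φ : (Σ (n : Set.Iic d) (A : L n),
            AntiPoly.Irr (ModuleCat.{v} (MonoidAlgebra k (Aut A.1)))) →
          AntiPoly.Irr (AntiPoly.Fd k C d).FullSubcategory,
        Function.Bijective φ ∧
        ∀ (n : Set.Iic d) (A : L n) (M : ModuleCat.{v} (MonoidAlgebra k (Aut A.1)))
          (hM : Simple M),
          ∃ (hd : AntiPoly.Fd k C d (AntiPoly.Q A.1 M))
            (hs : Simple (⟨AntiPoly.Q A.1 M, hd⟩ : (AntiPoly.Fd k C d).FullSubcategory)),
            φ ⟨n, A, AntiPoly.Irr.mk M hM⟩ = AntiPoly.Irr.mk ⟨AntiPoly.Q A.1 M, hd⟩ hs) ∧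
    ((∀ A : AntiPoly.AddRep C,
        AntiPoly.IsFinGen A → AntiPoly.IsFinCogen A → AntiPoly.IsFiniteRep A) →
      ∃ φ : (Σ (n : ℕ) (A : L n),
            AntiPoly.Irr (ModuleCat.{v} (MonoidAlgebra k (Aut A.1)))) →
          AntiPoly.Irr (C ⥤ ModuleCat.{v} k),
        Function.Bijective φ ∧
        ∀ (n : ℕ) (A : L n) (M : ModuleCat.{v} (MonoidAlgebra k (Aut A.1))) (hM : Simple M),
          ∃ hs : Simple (AntiPoly.Q A.1 M),
            φ ⟨n, A, AntiPoly.Irr.mk M hM⟩ = AntiPoly.Irr.mk (AntiPoly.Q A.1 M) hs) ∧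
    ((AntiPoly.IsFiniteRep : ObjectProperty (AntiPoly.AddRep C)).IsSeparating →
      ∀ A : AntiPoly.AddRep C, AntiPoly.IsFinGen A → AntiPoly.IsFiniteRep A) :=
  ⟨fun _ _ hA hM => AntiPoly.simple_Q hC hA.isGenCogen hM, hL.exists_bijective_irr_Fd hC,
    hL.exists_bijective_irr_functor hC, fun hsep _ hA => hA.isFiniteRep hsep⟩

theorem mainTheorem2 (k : Type v) [Field k] (C : Type u) [Category.{v} C] [Preadditive C]
    [HasZeroObject C] [HasBinaryBiproducts C] [EssentiallySmall.{v} C] (hC : AntiPoly.IsKTrivial k C)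
    (L : ℕ → Set (AntiPoly.AddRep C)) (hL : AntiPoly.IsSystemOfReps L) :
    (∀ (A : AntiPoly.AddRep C) (M : ModuleCat.{v} (MonoidAlgebra k (Aut A))),
      AntiPoly.IsFiniteRep A → Simple M → Simple (AntiPoly.Q A M)) ∧
    (∀ d : ℕ,
      ∃ φ : (Σ (n : Set.Iic d) (A : L n),
            AntiPoly.Irr (ModuleCat.{v} (MonoidAlgebra k (Aut A.1)))) →
          AntiPoly.Irr (AntiPoly.Fd k C d).FullSubcategory,
        Function.Bijective φ ∧
        ∀ (n : Set.Iic d) (A : L n) (M : ModuleCat.{v} (MonoidAlgebra k (Aut A.1)))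
          (hM : Simple M),
          ∃ (hd : AntiPoly.Fd k C d (AntiPoly.Q A.1 M))
            (hs : Simple (⟨AntiPoly.Q A.1 M, hd⟩ : (AntiPoly.Fd k C d).FullSubcategory)),
            φ ⟨n, A, AntiPoly.Irr.mk M hM⟩ = AntiPoly.Irr.mk ⟨AntiPoly.Q A.1 M, hd⟩ hs) ∧
    ((∀ A : AntiPoly.AddRep C,
        AntiPoly.IsFinGen A → AntiPoly.IsFinCogen A → AntiPoly.IsFiniteRep A) →
      ∃ φ : (Σ (n : ℕ) (A : L n),
            AntiPoly.Irr (ModuleCat.{v} (MonoidAlgebra k (Aut A.1)))) →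
          AntiPoly.Irr (C ⥤ ModuleCat.{v} k),
        Function.Bijective φ ∧
        ∀ (n : ℕ) (A : L n) (M : ModuleCat.{v} (MonoidAlgebra k (Aut A.1))) (hM : Simple M),
          ∃ hs : Simple (AntiPoly.Q A.1 M),
            φ ⟨n, A, AntiPoly.Irr.mk M hM⟩ = AntiPoly.Irr.mk (AntiPoly.Q A.1 M) hs) ∧
    ((AntiPoly.IsFiniteRep : ObjectProperty (AntiPoly.AddRep C)).IsSeparating →
      ∀ A : AntiPoly.AddRep C,
        AntiPoly.IsFinGen A → AntiPoly.IsFinCogen A → AntiPoly.IsFiniteRep A) := by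
  obtain ⟨simple, irr_Fd, irr, finite⟩ :=
    @mainTheorem2_general k _ C _ _ (HasZeroObject.zero (C := C)).nonempty _ hC L hL
  exact ⟨simple, irr_Fd, irr, fun hsep A hA _ => finite hsep A hA⟩
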